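/- Let $M$ be a connected smooth manifold of dimension $d\ge 3$ with a Riemannian conformal structure $[g]$, and let $I\neq 0$ be a smooth section of the standard conformal tractor bundle that is parallel for the (normal) tractor connection, so that $(M,[g],I)$ is an almost Einstein manifold. Let $\sigma:=I_AX^A$ be the corresponding conformal density of weight $1$, where $X^A$ is the canonical tractor. For a metric $g\in[g]$ a tractor is a triple $(\sigma,\mu_a,\rho)$, $X^A=(0,0,1)$, the tractor metric is $h(I,I)=g^{ab}\mu_a\mu_b+2\sigma\rho$, and the tractor connection is $$\nabla_a(\sigma,\mu_b,\rho)=(\nabla_a\sigma-\mu_a,\ \nabla_a\mu_b+g_{ab}\rho+P_{ab}\sigma,\ \nabla_a\rho-P_{ab}\mu^b).$$ Fix any $g\in[g]$ (densities are trivialised by $g$ and indices are moved with the conformal metric) and put $n_a:=\nabla_a\sigma$. The Riemann tensor is defined by $(\nabla_a\nabla_b-\nabla_b\nabla_a)V^c=R_{ab}{}^c{}_eV^e$ and $\mathrm{Ric}_{ab}=R_{ca}{}^c{}_b$. Let $P_{ab}$ be the Schouten tensor, $\mathrm{Ric}_{ab}=(d-2)P_{ab}+Jg_{ab}$ with $J=P^a{}_a$;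 $C_{abce}$ the Weyl tensor, $R_{abce}=C_{abce}+2g_{c[a}P_{b]e}+2g_{e[b}P_{a]c}$; $A_{abc}=2\nabla_{[b}P_{c]a}$ the Cotton tensor; $B_{ab}=\nabla^cA_{acb}+P^{ec}C_{eacb}$ the Bach tensor; $\Omega_{abCE}$ the curvature of the tractor connection, $(\nabla_a\nabla_b-\nabla_b\nabla_a)V^C=\Omega_{ab}{}^C{}_EV^E$; and $$W_{BCEF}=\tfrac{3}{d-2}\,\mathbb D^AX_{[A}\Omega_{BC]EF},\qquad \Omega_{BCEF}=Z_B{}^bZ_C{}^c\,\Omega_{bcEF}.$$ Here $X_A,Y_A,Z_A{}^a$ are the projectors determined by $g$, and $\mathbb D_AV=(d+2w-2)wY_AV+(d+2w-2)Z_A{}^a\nabla_aV+X_A(\Delta-wJ)V$, with $\Delta=-\nabla^a\nabla_a$, is the tractor-$D$ operator on fields of weight $w$ (here $w=-1$). Then: 1. Everywhere on $M$, $\sigma A_{cab}+n^eC_{abce}=0$, and hence $n^cA_{cab}=0$. 2. Everywhere on $M$, $\sigma B_{ac}+(d-4)n^eA_{cae}=0$, and hence $n^aB_{ab}=0$. 3.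 At every point $p$ with $\sigma(p)=0$ we have $n^aC_{abce}=0$. 4. If $d=4$, then $C_{abce}(p)=0$ at every point $p$ with $\sigma(p)=0$, and $B_{ab}=0$ on all of $M$. 5. If $d\neq4$, then $n^a\Omega_{abCE}=0$ at every point $p$ with $\sigma(p)=0$. 6. In any dimension $d\geq 3$, at every point $p$ where the $1$-jet of $\sigma$ vanishes ($\sigma(p)=0$ and $n_a(p)=0$) we have $C_{abce}=0$ and $A_{bce}=0$ (equivalently $\Omega_{abCE}=0$), and also $W_{BCEF}=0$. -/

import Mathlib

open scoped Manifold ContDiff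

noncomputable section

namespace AlmostEinstein

/-! ### Local conformal tensor calculus

Everything in this part takes place in one coordinate chart and in the scale of one metric
`g` of the conformal class: `G y` is the Gram matrix `(g_{ab})` at the point with coordinates `y`.
A section of a weighted bundle is represented by its components with respect to the coordinate
frame and the trivialisation of the density bundles given by `g`.  In particular the conformal
metric is represented by `G`, and the coupled connection acts on densities as the flat one. -/

/-- Coordinate space of the charts of a `d`-dimensional manifold. -/
abbrev Coord (d : ℕ) := EuclideanSpace ℝ (Fin d)

/-- A field of `d × d` matrices on coordinate space (the components of a metric). -/
abbrev LocalMetric (d : ℕ) := Coord d → Matrix (Fin d) (Fin d) ℝ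

/-- The partial derivative `∂_i f`. -/
def partialDeriv {d : ℕ} (i : Fin d) (f : Coord d → ℝ) (y : Coord d) : ℝ :=
  fderiv ℝ f y (EuclideanSpace.single i 1)

/-- Curvature `F_{ab}{}^C{}_E` of the connection `∇_a V^C = ∂_a V^C + Θ_a{}^C{}_E V^E`
(with `Θ a C E` for `Θ_a{}^C{}_E`), that is
`(∇_a ∇_b - ∇_b ∇_a) V^C = F_{ab}{}^C{}_E V^E` for a torsion free coupling on the form index. -/
def connectionCurvature {d : ℕ} {N : Type*} [Fintype N]
    (Θ : Fin d → N → N → Coord d → ℝ) (a b : Fin d) (C E : N) (y : Coord d) : ℝ :=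
  partialDeriv a (Θ b C E) y - partialDeriv b (Θ a C E) y
    + ∑ D, (Θ a C D y * Θ b D E y - Θ b C D y * Θ a D E y)

section Local

variable {d : ℕ} (G : LocalMetric d)

/-- Christoffel symbols `Γ^c_{ab}` of the Levi-Civita connection. -/
def christoffel (c a b : Fin d) (y : Coord d) : ℝ :=
  (1 / 2) * ∑ e, (G y)⁻¹ c e *
    (partialDeriv a (fun z => G z e b) y + partialDeriv b (fun z => G z e a) y
      - partialDeriv e (fun z => G z a b) y)

/-- Riemann curvature `R_{ab}{}^c{}_e`, with `(∇_a ∇_b - ∇_b ∇_a) V^c = R_{ab}{}^c{}_e V^e`. -/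
def riemannUp (a b c e : Fin d) (y : Coord d) : ℝ :=
  connectionCurvature (fun a c e => christoffel G c a e) a b c e y

/-- Riemann curvature `R_{abce}` with all indices lowered. -/
def riemann (a b c e : Fin d) (y : Coord d) : ℝ :=
  ∑ f, G y c f * riemannUp G a b f e y

/-- Ricci curvature `Ric_{ab} = R_{ca}{}^c{}_b`. -/
def ricci (a b : Fin d) (y : Coord d) : ℝ :=
  ∑ c, riemannUp G c a c b y

/-- Scalar curvature. -/
def scalarCurv (y : Coord d) : ℝ :=
  ∑ a, ∑ b, (G y)⁻¹ a b * ricci G a b y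

/-- Schouten tensor `P_{ab}`: the solution of `Ric_{ab} = (d - 2) P_{ab} + J g_{ab}` with
`J` the trace of `P`, so that `J = Sc / (2 (d - 1))`. -/
def schouten (a b : Fin d) (y : Coord d) : ℝ :=
  (ricci G a b y - scalarCurv G y / (2 * ((d : ℝ) - 1)) * G y a b) / ((d : ℝ) - 2)

/-- `J = g^{ab} P_{ab}`. -/
def traceJ (y : Coord d) : ℝ :=
  ∑ a, ∑ b, (G y)⁻¹ a b * schouten G a b y

/-- Weyl tensor `C_{abce}`, defined by
`R_{abce} = C_{abce} + 2 g_{c[a} P_{b]e} + 2 g_{e[b} P_{a]c}`. -/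
def weyl (a b c e : Fin d) (y : Coord d) : ℝ :=
  riemann G a b c e y
    - (G y c a * schouten G b e y - G y c b * schouten G a e y
      + G y e b * schouten G a c y - G y e a * schouten G b c y)

end Local

/-! #### Standard tractors -/

/-- Index set of the components `(σ, μ_a, ρ)` of a standard tractor. -/
abbrev TIdx (d : ℕ) := Unit ⊕ Fin d ⊕ Unit

/-- The slot of `σ`. -/
abbrev slotY {d : ℕ} : TIdx d := Sum.inl ()

/-- The slot of `μ_a`. -/
abbrev slotZ {d : ℕ} (a : Fin d) : TIdx d := Sum.inr (Sum.inl a)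

/-- The slot of `ρ`. -/
abbrev slotX {d : ℕ} : TIdx d := Sum.inr (Sum.inr ())

section Tractor

variable {d : ℕ} (G : LocalMetric d)

/-- Connection coefficients `Θ_a{}^B{}_C` of the tractor connection
`∇_a (σ, μ_b, ρ) = (∇_a σ - μ_a, ∇_a μ_b + g_{ab} ρ + P_{ab} σ, ∇_a ρ - P_{ab} μ^b)`. -/
def tractorConn (a : Fin d) : TIdx d → TIdx d → Coord d → ℝ
  | .inl (), .inr (.inl c), _ => if a = c then -1 else 0
  | .inr (.inl b), .inl (), y => schouten G a b y
  | .inr (.inl b), .inr (.inl c), y => -christoffel G c a b y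
  | .inr (.inl b), .inr (.inr ()), y => G y a b
  | .inr (.inr ()), .inr (.inl c), y => -∑ b, schouten G a b y * (G y)⁻¹ b c
  | _, _, _ => 0

/-- Tractor metric `h_{AB}`: `h(I, I) = g^{ab} μ_a μ_b + 2 σ ρ`. -/
def tractorMetric : TIdx d → TIdx d → Coord d → ℝ
  | .inl (), .inr (.inr ()), _ => 1
  | .inr (.inr ()), .inl (), _ => 1
  | .inr (.inl a), .inr (.inl b), y => (G y)⁻¹ a b
  | _, _, _ => 0

/-- Inverse tractor metric `h^{AB}`. -/
def tractorMetricInv : TIdx d → TIdx d → Coord d → ℝ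
  | .inl (), .inr (.inr ()), _ => 1
  | .inr (.inr ()), .inl (), _ => 1
  | .inr (.inl a), .inr (.inl b), y => G y a b
  | _, _, _ => 0

/-- Tractor curvature `Ω_{abCE} = h_{CD} Ω_{ab}{}^D{}_E`, where
`(∇_a ∇_b - ∇_b ∇_a) V^D = Ω_{ab}{}^D{}_E V^E` for the tractor connection `∇`. -/
def tractorCurv (a b : Fin d) (C E : TIdx d) (y : Coord d) : ℝ :=
  ∑ D, tractorMetric G C D y * connectionCurvature (tractorConn G) a b D E y

/-- The projector `X_A = h_{AB} X^B`, where `X^B = (0, 0, 1)`. -/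
def projX (A : TIdx d) (y : Coord d) : ℝ := tractorMetric G A slotX y

/-- The projector `Y_A = h_{AB} Y^B`, where `Y^B = (1, 0, 0)`. -/
def projY (A : TIdx d) (y : Coord d) : ℝ := tractorMetric G A slotY y

/-- The projector `Z_A{}^a = h_{AB} Z^{Ba}`, where `Z^{Ba} μ_a = (0, μ_b, 0)`. -/
def projZ (A : TIdx d) (a : Fin d) (y : Coord d) : ℝ := tractorMetric G A (slotZ a) y

/-- Components of a field `T_{a₁ ⋯ a_k A₁ ⋯ A_m}` with `k` lower tensor indices and `m` lower
tractor indices. -/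
abbrev TensorField (d k m : ℕ) := (Fin k → Fin d) → (Fin m → TIdx d) → Coord d → ℝ

/-- The coupled Levi-Civita tractor connection on fields with `k` lower tensor indices
and `m` lower tractor indices; the index of differentiation comes first:
`covD G T ![b, a₁, …] A` is `∇_b T_{a₁ ⋯ A₁ ⋯}`. -/
def covD {k m : ℕ} (T : TensorField d k m) : TensorField d (k + 1) m := fun a A y =>
  partialDeriv (a 0) (T (Fin.tail a) A) y
    - ∑ i : Fin k, ∑ e : Fin d,
        christoffel G e (a 0) (Fin.tail a i) y * T (Function.update (Fin.tail a) i e) A y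
    - ∑ j : Fin m, ∑ E : TIdx d,
        tractorConn G (a 0) E (A j) y * T (Fin.tail a) (Function.update A j E) y

/-- Cotton tensor `A_{abc} = 2 ∇_{[b} P_{c]a}`. -/
def cotton (a b c : Fin d) (y : Coord d) : ℝ :=
  covD G (m := 0) (fun i _ => schouten G (i 0) (i 1)) ![b, c, a] ![] y
    - covD G (m := 0) (fun i _ => schouten G (i 0) (i 1)) ![c, b, a] ![] y

/-- Bach tensor `B_{ab} = ∇^c A_{acb} + P^{ec} C_{eacb}`. -/
def bach (a b : Fin d) (y : Coord d) : ℝ :=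
  (∑ c, ∑ e, (G y)⁻¹ c e *
      covD G (m := 0) (fun i _ => cotton G (i 0) (i 1) (i 2)) ![e, a, c, b] ![] y)
    + ∑ c, ∑ e, (∑ p, ∑ q, (G y)⁻¹ e p * (G y)⁻¹ c q * schouten G p q y) * weyl G e a c b y

/-- The Laplacian `Δ = -g^{ab} ∇_a ∇_b` on tractor fields. -/
def laplacian {m : ℕ} (V : TensorField d 0 m) : TensorField d 0 m := fun _ A y =>
  -∑ a, ∑ b, (G y)⁻¹ a b * covD G (covD G V) ![a, b] A y

/-- The tractor-`D` operator on tractor fields of weight `w` (the new index comes first):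
`𝔻_A V = (d + 2w - 2) w Y_A V + (d + 2w - 2) Z_A{}^a ∇_a V + X_A (Δ - w J) V`. -/
def tractorD (w : ℝ) {m : ℕ} (V : TensorField d 0 m) : TensorField d 0 (m + 1) := fun i A y =>
  ((d : ℝ) + 2 * w - 2) * w * projY G (A 0) y * V i (Fin.tail A) y
    + ((d : ℝ) + 2 * w - 2) * ∑ a, projZ G (A 0) a y * covD G V ![a] (Fin.tail A) y
    + projX G (A 0) y *
      (laplacian G V i (Fin.tail A) y - w * traceJ G y * V i (Fin.tail A) y)

/-- `Ω_{BCEF} = Z_B{}^b Z_C{}^c Ω_{bcEF}`. -/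
def tractorCurvT (B C E F : TIdx d) (y : Coord d) : ℝ :=
  ∑ b, ∑ c, projZ G B b y * projZ G C c y * tractorCurv G b c E F y

/-- `X_{[A} Ω_{BC]EF}`, a tractor field of weight `-1` (index order `A B C E F`). -/
def skewXCurv : TensorField d 0 5 := fun _ A y =>
  (1 / 6) *
    (projX G (A 0) y * tractorCurvT G (A 1) (A 2) (A 3) (A 4) y
      + projX G (A 1) y * tractorCurvT G (A 2) (A 0) (A 3) (A 4) y
      + projX G (A 2) y * tractorCurvT G (A 0) (A 1) (A 3) (A 4) y
      - projX G (A 0) y * tractorCurvT G (A 2) (A 1) (A 3) (A 4) y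
      - projX G (A 1) y * tractorCurvT G (A 0) (A 2) (A 3) (A 4) y
      - projX G (A 2) y * tractorCurvT G (A 1) (A 0) (A 3) (A 4) y)

/-- `W_{BCEF} = 3 / (d - 2) 𝔻^A X_{[A} Ω_{BC]EF}`. -/
def tractorW (B C E F : TIdx d) (y : Coord d) : ℝ :=
  3 / ((d : ℝ) - 2) * ∑ A, ∑ A', tractorMetricInv G A A' y *
    tractorD G (-1) (skewXCurv G) ![] ![A', A, B, C, E, F] y

end Tractor

/-! ### Conformal manifolds, tractor fields, almost Einstein structures -/

section Global

variable (d : ℕ) (M : Type*) [TopologicalSpace M] [ChartedSpace (EuclideanSpace ℝ (Fin d)) M]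
  [IsManifold (𝓡 d) ∞ M]

/-- Smooth Riemannian metrics on `M`. -/
abbrev RiemMetric :=
  Bundle.ContMDiffRiemannianMetric (𝓡 d) ∞ (EuclideanSpace ℝ (Fin d))
    (fun p : M => TangentSpace (𝓡 d) p)

variable {d M}

/-- `ĝ = e^{2u} g`. -/
def IsRescaling (u : C^∞⟮𝓡 d, M; 𝓘(ℝ), ℝ⟯) (g ĝ : RiemMetric d M) : Prop :=
  ∀ (p : M) (v w : TangentSpace (𝓡 d) p),
    ĝ.inner p v w = Real.exp (2 * u p) * g.inner p v w

/-- The differential `Υ = du` at `p`, as a covector. -/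
def dForm (u : C^∞⟮𝓡 d, M; 𝓘(ℝ), ℝ⟯) (p : M) : TangentSpace (𝓡 d) p →L[ℝ] ℝ :=
  mfderiv (𝓡 d) 𝓘(ℝ) u p

variable (d M)

/-- Conformal equivalence of metrics. -/
def conformalSetoid : Setoid (RiemMetric d M) where
  r g ĝ := ∃ u : C^∞⟮𝓡 d, M; 𝓘(ℝ), ℝ⟯, IsRescaling u g ĝ
  iseqv := by
    refine ⟨fun g => ⟨0, fun p v w => by simp⟩, ?_, ?_⟩
    · rintro g ĝ ⟨u, h⟩
      refine ⟨-u, fun p v w => ?_⟩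
      rw [h p v w, ← mul_assoc, ← Real.exp_add]
      simp
    · rintro g₁ g₂ g₃ ⟨u, h⟩ ⟨η, k⟩
      refine ⟨u + η, fun p v w => ?_⟩
      rw [k p v w, h p v w, ← mul_assoc, ← Real.exp_add]
      congr 2
      simp
      ring

/-- Conformal structures on `M`. -/
def ConformalStructure := Quotient (conformalSetoid d M)

variable {d M}

/-- The metrics of a conformal class. -/
def ConformalStructure.metrics (c : ConformalStructure d M) : Set (RiemMetric d M) :=
  {g | Quotient.mk (conformalSetoid d M) g = c}

/-- The `i`-th vector of a basis of `T_p M` (the coordinate frame of the preferred chart). -/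
def frameVec (p : M) (i : Fin d) : TangentSpace (𝓡 d) p :=
  (EuclideanSpace.single i (1 : ℝ) : EuclideanSpace ℝ (Fin d))

/-- The inner product `g^{ab} α_a β_b` of two covectors at `p`, computed in a basis of `T_p M`. -/
def cometric (g : RiemMetric d M) (p : M) (α β : TangentSpace (𝓡 d) p →L[ℝ] ℝ) : ℝ :=
  ∑ i, ∑ j, (Matrix.of fun k l => g.inner p (frameVec p k) (frameVec p l))⁻¹ i j
    * α (frameVec p i) * β (frameVec p j)

/-- The tractor metric `g^{-1}(μ, μ') + σ ρ' + ρ σ'` at `p` on triples `(σ, μ, ρ)`, `(σ', μ', ρ')`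
in the scale `g`. -/
def tractorInner (g : RiemMetric d M) (p : M)
    (s t : ℝ × (TangentSpace (𝓡 d) p →L[ℝ] ℝ) × ℝ) : ℝ :=
  cometric g p s.2.1 t.2.1 + s.1 * t.2.2 + s.2.2 * t.1

/-- A smooth section of the standard tractor bundle of the conformal structure `c`: in the scale
of each metric `g` of the class a triple `(σ, μ_a, ρ)`, a section of
`ℰ[1] ⊕ T^*M[1] ⊕ ℰ[-1]` with the density bundles trivialised by `g`.
For `ĝ = e^{2u} g` and `Υ = du` the triples are related by
`(σ, μ_b + σ Υ_b, ρ - g^{bc} Υ_b μ_c - ½ σ g^{bc} Υ_b Υ_c)`, the factors `e^u`, `e^u`, `e^{-u}`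
being due to the change of the trivialisations of `ℰ[1]` and `ℰ[-1]`. -/
structure TractorField (c : ConformalStructure d M) where
  /-- The component in `ℰ[1]`. -/
  top : c.metrics → C^∞⟮𝓡 d, M; 𝓘(ℝ), ℝ⟯
  /-- The component in `T^*M[1]`. -/
  mid : c.metrics → ContMDiffSection (𝓡 d) (EuclideanSpace ℝ (Fin d) →L[ℝ] ℝ) ∞
    (fun p : M => TangentSpace (𝓡 d) p →L[ℝ] ℝ)
  /-- The component in `ℰ[-1]`. -/
  bot : c.metrics → C^∞⟮𝓡 d, M; 𝓘(ℝ), ℝ⟯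
  top_transf : ∀ (g ĝ : c.metrics) (u : C^∞⟮𝓡 d, M; 𝓘(ℝ), ℝ⟯), IsRescaling u g.1 ĝ.1 →
    ∀ p : M, top ĝ p = Real.exp (u p) * top g p
  mid_transf : ∀ (g ĝ : c.metrics) (u : C^∞⟮𝓡 d, M; 𝓘(ℝ), ℝ⟯), IsRescaling u g.1 ĝ.1 →
    ∀ (p : M) (v : TangentSpace (𝓡 d) p),
      mid ĝ p v = Real.exp (u p) * (mid g p v + top g p * dForm u p v)
  bot_transf : ∀ (g ĝ : c.metrics) (u : C^∞⟮𝓡 d, M; 𝓘(ℝ), ℝ⟯), IsRescaling u g.1 ĝ.1 →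
    ∀ p : M, bot ĝ p = Real.exp (-u p) *
      (bot g p - cometric g.1 p (dForm u p) (mid g p)
        - (1 / 2) * top g p * cometric g.1 p (dForm u p) (dForm u p))

/-- The coordinate vector `∂_i` of the chart `φ` at the point with coordinates `y`. -/
def coordVec (φ : OpenPartialHomeomorph M (EuclideanSpace ℝ (Fin d))) (y : Coord d) (i : Fin d) :
    TangentSpace (𝓡 d) (φ.symm y) :=
  mfderiv (𝓡 d) (𝓡 d) φ.symm y (EuclideanSpace.single i (1 : ℝ) : EuclideanSpace ℝ (Fin d))

/-- The components `g_{ij}` of `g` in the chart `φ`. -/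
def coordMetric (g : RiemMetric d M) (φ : OpenPartialHomeomorph M (EuclideanSpace ℝ (Fin d))) :
    LocalMetric d := fun y =>
  Matrix.of fun i j => g.inner (φ.symm y) (coordVec φ y i) (coordVec φ y j)

namespace TractorField

variable {c : ConformalStructure d M} (I : TractorField c)

/-- The triple representing `I` at `p` in the scale `g`. -/
def triple (g : c.metrics) (p : M) : ℝ × (TangentSpace (𝓡 d) p →L[ℝ] ℝ) × ℝ :=
  (I.top g p, I.mid g p, I.bot g p)

/-- `I` is not the zero section. -/
def IsNonzero : Prop := ∃ (g : c.metrics) (p : M), I.triple g p ≠ 0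

/-- The density `σ = I_A X^A` of weight `1`, in the scale `g`, where `X^A = (0, 0, 1)`. -/
def scale (g : c.metrics) (p : M) : ℝ := tractorInner g.1 p (I.triple g p) (0, 0, 1)

/-- The components `I^A` in the scale `g` and the chart `φ`. -/
def comp (g : c.metrics) (φ : OpenPartialHomeomorph M (EuclideanSpace ℝ (Fin d))) :
    TIdx d → Coord d → ℝ
  | .inl (), y => I.top g (φ.symm y)
  | .inr (.inl a), y => I.mid g (φ.symm y) (coordVec φ y a)
  | .inr (.inr ()), y => I.bot g (φ.symm y)

/-- `I` is parallel for the tractor connection: `∇_a I^A = 0`. -/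
def IsParallel : Prop :=
  ∀ g : c.metrics, ∀ φ ∈ IsManifold.maximalAtlas (𝓡 d) ∞ M, ∀ y ∈ φ.target,
    ∀ (a : Fin d) (A : TIdx d),
      partialDeriv a (I.comp g φ A) y
        + ∑ B, tractorConn (coordMetric g.1 φ) a A B y * I.comp g φ B y = 0

/-- `n_a = ∇_a σ` in the scale `g` and the chart `φ`. -/
def nLow (g : c.metrics) (φ : OpenPartialHomeomorph M (EuclideanSpace ℝ (Fin d)))
    (a : Fin d) (y : Coord d) : ℝ :=
  partialDeriv a (fun z => I.scale g (φ.symm z)) y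

/-- `n^a = g^{ab} n_b`. -/
def nUp (g : c.metrics) (φ : OpenPartialHomeomorph M (EuclideanSpace ℝ (Fin d)))
    (a : Fin d) (y : Coord d) : ℝ :=
  ∑ b, (coordMetric g.1 φ y)⁻¹ a b * I.nLow g φ b y

end TractorField

end Global

end AlmostEinstein

end

open AlmostEinstein

/-! The curvature of a connection annihilates its parallel sections, so $\Omega_{ab}{}^C{}_E I^E=0$.
In a scale the tractor curvature has only Weyl and Cotton entries, and $\nabla I=0$ forces the
middle slot of $I$ to be $n_a=\nabla_a\sigma$. The middle and bottom slots of $\Omega I=0$ are then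
$\sigma A_{cab}+n^eC_{abce}=0$ (`cotton_add_weyl`) and $n^cA_{cab}=0$ (`raisedMid_cotton`). Where
$\sigma=0$ the first says that $n$ annihilates Weyl.

The divergence of the first identity gives the Bach equation (`bach_add_cotton`). It uses $\nabla_f
n^e=-\rho\,\delta_f^e-\sigma P_f{}^e$ and the contracted Bianchi identity
$\nabla^cC_{abce}=(d-3)A_{eab}$ (`divergence_weyl`). Contraction with $n$ removes the Cotton term by
skewness and leaves $\sigma\, n^aB_{ab}=0$. The factor $\sigma$ can be cancelled by continuity,
because $\sigma$ vanishes on no nonempty open set: there $n$ and then $\rho$ would vanish too,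
whereas a nonzero parallel tractor on a connected manifold has no zeros (uniqueness for linear ODEs
along segments). For $d=4$ the same cancellation in $\sigma B_{ab}=0$ gives $B=0$; for $d\ne4$ the
Bach equation at $\sigma=0$ gives $n^eA_{cae}=0$, hence $n^a\Omega_{abCE}=0$.

At a zero of the 1-jet of $\sigma$ one has $\rho\neq0$, so $n$ vanishes there with invertible
derivative $-\rho\,\mathrm{id}$. Differentiating $\sigma A+n\cdot C=0$, $n^cA_{cab}=0$ and
$n^aB_{ab}=0$ therefore gives $C=0$, $A=0$ and $B=0$ at the point. There the tractor-$D$ contraction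
defining $W$ collapses to a divergence of $\Omega$, whose entries come from $B$ and $(d-3)A$, so
$W=0$.

For $d=4$ and $\sigma=0$, either $n=0$ and the preceding case applies, or $n\ne0$ and Weyl is a
trace-free curvature tensor on the three-dimensional space $n^\perp$, hence zero. -/

noncomputable section

namespace AlmostEinstein

set_option linter.unusedSectionVars false
set_option linter.unusedSimpArgs false

/-! ### Smoothness and positivity of chart components. -/

section Charts

variable {d : ℕ} {M : Type*} [TopologicalSpace M] [ChartedSpace (EuclideanSpace ℝ (Fin d)) M]
  [IsManifold (𝓡 d) ∞ M]

lemma mdifferentiable_of_mem_maximalAtlas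
    {φ : OpenPartialHomeomorph M (EuclideanSpace ℝ (Fin d))}
    (hφ : φ ∈ IsManifold.maximalAtlas (𝓡 d) ∞ M) : φ.MDifferentiable (𝓡 d) (𝓡 d) :=
  ⟨(contMDiffOn_of_mem_maximalAtlas hφ).mdifferentiableOn (by simp),
    (contMDiffOn_symm_of_mem_maximalAtlas hφ).mdifferentiableOn (by simp)⟩

/-- The frame field is the tangent map of `φ.symm` applied to a constant section of the trivial
tangent bundle of coordinate space, and tangent maps of smooth maps are smooth. -/
lemma contMDiffAt_coordVec {φ : OpenPartialHomeomorph M (EuclideanSpace ℝ (Fin d))}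
    (hφ : φ ∈ IsManifold.maximalAtlas (𝓡 d) ∞ M) {y : Coord d} (hy : y ∈ φ.target) (i : Fin d) :
    ContMDiffAt (𝓡 d) (𝓡 d).tangent ∞
      (fun z => Bundle.TotalSpace.mk' (EuclideanSpace ℝ (Fin d))
        (E := (TangentSpace (𝓡 d) : M → Type _)) (φ.symm z) (coordVec φ z i)) y := by
  have h1 := (contMDiffOn_symm_of_mem_maximalAtlas hφ).contMDiffOn_tangentMapWithin
    (m := ∞) (by simp) (φ.open_target.uniqueMDiffOn)
  have h2 : ContMDiff (𝓡 d) (𝓡 d).tangent ∞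
      (fun z : EuclideanSpace ℝ (Fin d) => (⟨z, EuclideanSpace.single i (1 : ℝ)⟩ :
        TangentBundle (𝓡 d) (EuclideanSpace ℝ (Fin d)))) := by
    have h := (contMDiff_id (I := 𝓡 d) (M := EuclideanSpace ℝ (Fin d)) (n := ∞)).prodMk
      (contMDiff_const (I := 𝓡 d) (I' := 𝓡 d)
      (c := (EuclideanSpace.single i (1 : ℝ) : EuclideanSpace ℝ (Fin d))))
    rw [chartedSpaceSelf_prod] at h
    exact contMDiff_tangentBundleModelSpaceHomeomorph_symm.comp h
  have h3 := h1.comp (h2.contMDiffOn (s := φ.target)) (fun z hz => hz)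
  refine (h3.congr fun z hz => ?_).contMDiffAt (φ.open_target.mem_nhds hy)
  simp only [Function.comp, tangentMapWithin, coordVec]
  rw [mfderivWithin_of_isOpen φ.open_target hz]

lemma contDiffOn_coordMetric (g : RiemMetric d M)
    {φ : OpenPartialHomeomorph M (EuclideanSpace ℝ (Fin d))}
    (hφ : φ ∈ IsManifold.maximalAtlas (𝓡 d) ∞ M) (i j : Fin d) :
    ContDiffOn ℝ ∞ (fun y => coordMetric g φ y i j) φ.target := by
  rw [← contMDiffOn_iff_contDiffOn]
  intro y hy
  have hs : ContMDiffAt (𝓡 d) (𝓡 d) ∞ φ.symm y := contMDiffAt_symm_of_mem_maximalAtlas hφ hy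
  have := (g.contMDiff.contMDiffAt.comp y hs).clm_bundle_apply₂
    (F₁ := EuclideanSpace ℝ (Fin d)) (F₂ := EuclideanSpace ℝ (Fin d)) (F₃ := ℝ)
    (E₃ := Bundle.Trivial M ℝ)
    (contMDiffAt_coordVec hφ hy i) (contMDiffAt_coordVec hφ hy j)
  rw [Bundle.contMDiffAt_totalSpace] at this
  exact this.2.contMDiffWithinAt

lemma contDiffOn_covector
    (μ : ContMDiffSection (𝓡 d) (EuclideanSpace ℝ (Fin d) →L[ℝ] ℝ) ∞
      (fun p : M => TangentSpace (𝓡 d) p →L[ℝ] ℝ))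
    {φ : OpenPartialHomeomorph M (EuclideanSpace ℝ (Fin d))}
    (hφ : φ ∈ IsManifold.maximalAtlas (𝓡 d) ∞ M) (i : Fin d) :
    ContDiffOn ℝ ∞ (fun y => μ (φ.symm y) (coordVec φ y i)) φ.target := by
  rw [← contMDiffOn_iff_contDiffOn]
  intro y hy
  have hs : ContMDiffAt (𝓡 d) (𝓡 d) ∞ φ.symm y := contMDiffAt_symm_of_mem_maximalAtlas hφ hy
  have := (μ.contMDiff.contMDiffAt.comp y hs).clm_bundle_apply
    (F₁ := EuclideanSpace ℝ (Fin d)) (F₂ := ℝ)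
    (E₂ := Bundle.Trivial M ℝ) (contMDiffAt_coordVec hφ hy i)
  rw [Bundle.contMDiffAt_totalSpace] at this
  exact this.2.contMDiffWithinAt

lemma contDiffOn_function (f : C^∞⟮𝓡 d, M; 𝓘(ℝ), ℝ⟯)
    {φ : OpenPartialHomeomorph M (EuclideanSpace ℝ (Fin d))}
    (hφ : φ ∈ IsManifold.maximalAtlas (𝓡 d) ∞ M) :
    ContDiffOn ℝ ∞ (fun y => f (φ.symm y)) φ.target := by
  rw [← contMDiffOn_iff_contDiffOn]
  exact f.contMDiff.comp_contMDiffOn (contMDiffOn_symm_of_mem_maximalAtlas hφ)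

lemma sum_smul_single (x : Fin d → ℝ) :
    ∑ i, x i • (EuclideanSpace.single i (1 : ℝ) : EuclideanSpace ℝ (Fin d)) =
      WithLp.toLp 2 x := by
  ext j
  simp [Finset.sum_apply, Pi.single_apply]

/-- Stated on plain Euclidean space, so that the linear algebra never meets `TangentSpace`; tangent
spaces enter by definitional unfolding. The matrix is the Gram matrix of the images of the standard
basis. -/
lemma posDef_of_injective (B : EuclideanSpace ℝ (Fin d) →L[ℝ] EuclideanSpace ℝ (Fin d) →L[ℝ] ℝ)
    (hsymm : ∀ v w, B v w = B w v) (hpos : ∀ v, v ≠ 0 → 0 < B v v)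
    (L : EuclideanSpace ℝ (Fin d) →L[ℝ] EuclideanSpace ℝ (Fin d)) (hL : Function.Injective L) :
    (Matrix.of fun i j => B (L (EuclideanSpace.single i 1)) (L (EuclideanSpace.single j 1))).PosDef
    := by
  refine Matrix.PosDef.of_dotProduct_mulVec_pos ?_ fun {x} hx => ?_
  · ext i j
    simp only [Matrix.conjTranspose_apply, Matrix.of_apply, star_trivial]
    exact hsymm _ _
  · have h0 : L (WithLp.toLp 2 x) ≠ 0 := by
      rw [Ne, map_eq_zero_iff L hL]
      simpa using hx
    have := hpos _ h0
    rw [← sum_smul_single] at this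
    refine this.trans_eq ?_
    simp only [dotProduct, Matrix.mulVec, star_trivial, map_sum, map_smul,
      sum_apply, smul_apply,
      Matrix.of_apply, smul_eq_mul, Finset.mul_sum]
    rw [Finset.sum_comm]
    refine Finset.sum_congr rfl fun i _ => Finset.sum_congr rfl fun j _ => ?_
    rw [hsymm]
    ring

lemma coordMetric_posDef (g : RiemMetric d M)
    {φ : OpenPartialHomeomorph M (EuclideanSpace ℝ (Fin d))}
    (hφ : φ ∈ IsManifold.maximalAtlas (𝓡 d) ∞ M) {y : Coord d} (hy : y ∈ φ.target) :
    (coordMetric g φ y).PosDef :=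
  posDef_of_injective (g.inner (φ.symm y)) (g.symm _) (g.pos _) (mfderiv (𝓡 d) (𝓡 d) φ.symm y)
    ((mdifferentiable_of_mem_maximalAtlas hφ).symm.mfderiv_injective hy)

lemma eq_zero_of_surjective (α : EuclideanSpace ℝ (Fin d) →L[ℝ] ℝ)
    (L : EuclideanSpace ℝ (Fin d) →L[ℝ] EuclideanSpace ℝ (Fin d)) (hL : Function.Surjective L)
    (h : ∀ i, α (L (EuclideanSpace.single i 1)) = 0) : α = 0 := by
  ext v
  obtain ⟨w, rfl⟩ := hL v
  have : w = ∑ i, w i • EuclideanSpace.single i (1 : ℝ) := by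
    rw [sum_smul_single]
  rw [this]
  simp only [map_sum, map_smul, h, smul_zero, Finset.sum_const_zero, zero_apply]

lemma eq_zero_of_coordVec {φ : OpenPartialHomeomorph M (EuclideanSpace ℝ (Fin d))}
    (hφ : φ ∈ IsManifold.maximalAtlas (𝓡 d) ∞ M) {y : Coord d} (hy : y ∈ φ.target)
    (α : TangentSpace (𝓡 d) (φ.symm y) →L[ℝ] ℝ) (h : ∀ i, α (coordVec φ y i) = 0) : α = 0 :=
  eq_zero_of_surjective α (mfderiv (𝓡 d) (𝓡 d) φ.symm y)
    ((mdifferentiable_of_mem_maximalAtlas hφ).symm.mfderiv_surjective hy) h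

end Charts

/-! ### Calculus of partial derivatives, matrix valued functions and linear connections. -/

section Calculus

variable {d : ℕ} {U : Set (Coord d)}

/-- Smoothness on a set of coordinate space. -/
def SmoothOn (U : Set (Coord d)) (f : Coord d → ℝ) : Prop := ContDiffOn ℝ ∞ f U

namespace SmoothOn

variable {f g : Coord d → ℝ}

lemma differentiableAt (hf : SmoothOn U f) (hU : IsOpen U) {y : Coord d} (hy : y ∈ U) :
    DifferentiableAt ℝ f y :=
  (ContDiffOn.contDiffAt hf (hU.mem_nhds hy)).differentiableAt (by simp)

lemma continuousOn (hf : SmoothOn U f) : ContinuousOn f U := ContDiffOn.continuousOn hf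

lemma const (c : ℝ) : SmoothOn U (fun _ => c) := contDiffOn_const

lemma add (hf : SmoothOn U f) (hg : SmoothOn U g) : SmoothOn U (fun y => f y + g y) :=
  ContDiffOn.add hf hg

lemma sub (hf : SmoothOn U f) (hg : SmoothOn U g) : SmoothOn U (fun y => f y - g y) :=
  ContDiffOn.sub hf hg

lemma neg (hf : SmoothOn U f) : SmoothOn U (fun y => -f y) :=
  ContDiffOn.neg hf

lemma mul (hf : SmoothOn U f) (hg : SmoothOn U g) : SmoothOn U (fun y => f y * g y) :=
  ContDiffOn.mul hf hg

lemma div_const (hf : SmoothOn U f) (c : ℝ) : SmoothOn U (fun y => f y / c) :=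
  ContDiffOn.div_const hf c

lemma sum {ι : Type*} {s : Finset ι} {F : ι → Coord d → ℝ} (hF : ∀ i, SmoothOn U (F i)) :
    SmoothOn U (fun y => ∑ i ∈ s, F i y) :=
  ContDiffOn.sum fun i _ => hF i

lemma prod {ι : Type*} {s : Finset ι} {F : ι → Coord d → ℝ} (hF : ∀ i, SmoothOn U (F i)) :
    SmoothOn U (fun y => ∏ i ∈ s, F i y) :=
  contDiffOn_prod fun i _ => hF i

lemma congr (hf : SmoothOn U f) (h : ∀ y ∈ U, g y = f y) : SmoothOn U g :=
  ContDiffOn.congr hf h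

lemma partialDeriv (hf : SmoothOn U f) (hU : IsOpen U) (i : Fin d) :
    SmoothOn U (partialDeriv i f) :=
  (ContDiffOn.fderiv_of_isOpen hf hU (m := ∞) (by simp)).clm_apply contDiffOn_const

end SmoothOn

section Rules

variable {f g : Coord d → ℝ} {y : Coord d} (i : Fin d)

lemma partialDeriv_congr (hU : IsOpen U) (hy : y ∈ U) (h : ∀ z ∈ U, f z = g z) :
    partialDeriv i f y = partialDeriv i g y := by
  unfold partialDeriv
  rw [Filter.EventuallyEq.fderiv_eq (Filter.eventuallyEq_of_mem (hU.mem_nhds hy) h)]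

lemma partialDeriv_const (c : ℝ) : partialDeriv i (fun _ => c) y = 0 := by
  simp [partialDeriv]

lemma partialDeriv_eq_zero (hU : IsOpen U) (hy : y ∈ U) (h : ∀ z ∈ U, f z = 0) :
    partialDeriv i f y = 0 :=
  (partialDeriv_congr i hU hy h).trans (partialDeriv_const i 0)

lemma partialDeriv_add (hf : DifferentiableAt ℝ f y) (hg : DifferentiableAt ℝ g y) :
    partialDeriv i (fun z => f z + g z) y = partialDeriv i f y + partialDeriv i g y := by
  simp [partialDeriv, fderiv_fun_add hf hg]

lemma partialDeriv_sub (hf : DifferentiableAt ℝ f y) (hg : DifferentiableAt ℝ g y) :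
    partialDeriv i (fun z => f z - g z) y = partialDeriv i f y - partialDeriv i g y := by
  simp [partialDeriv, fderiv_fun_sub hf hg]

lemma partialDeriv_neg : partialDeriv i (fun z => -f z) y = -partialDeriv i f y := by
  simp [partialDeriv]

lemma partialDeriv_mul (hf : DifferentiableAt ℝ f y) (hg : DifferentiableAt ℝ g y) :
    partialDeriv i (fun z => f z * g z) y =
      partialDeriv i f y * g y + f y * partialDeriv i g y := by
  simp [partialDeriv, fderiv_fun_mul hf hg]
  ring

lemma partialDeriv_sum {ι : Type*} {s : Finset ι} {F : ι → Coord d → ℝ}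
    (hF : ∀ k, DifferentiableAt ℝ (F k) y) :
    partialDeriv i (fun z => ∑ k ∈ s, F k z) y = ∑ k ∈ s, partialDeriv i (F k) y := by
  simp [partialDeriv, fderiv_fun_sum fun k _ => hF k]

/-- Both sides are values of the second Fréchet derivative, which is symmetric for smooth functions.
-/
lemma partialDeriv_comm (hf : SmoothOn U f) (hU : IsOpen U) (hy : y ∈ U) (j : Fin d) :
    partialDeriv i (partialDeriv j f) y = partialDeriv j (partialDeriv i f) y := by
  have hc : ContDiffAt ℝ ∞ f y := ContDiffOn.contDiffAt hf (hU.mem_nhds hy)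
  have hd : DifferentiableAt ℝ (fderiv ℝ f) y :=
    (hc.fderiv_right (m := 1) (by norm_cast)).differentiableAt (by simp)
  have key : ∀ k l : Fin d, partialDeriv k (partialDeriv l f) y =
      fderiv ℝ (fderiv ℝ f) y (EuclideanSpace.single k 1) (EuclideanSpace.single l 1) := by
    intro k l
    change fderiv ℝ (fun z => fderiv ℝ f z (EuclideanSpace.single l 1)) y _ = _
    rw [fderiv_clm_apply hd (differentiableAt_const _)]
    simp
  rw [key, key]
  exact (hc.isSymmSndFDerivAt (by simpa using WithTop.coe_le_coe.2 (le_top : (2 : ℕ∞) ≤ ⊤))) _ _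

end Rules

/-! ### Matrix valued functions -/

section MatrixCalculus

variable {m n p : Type*} [Fintype m] [Fintype n] {y : Coord d}

/-- Entrywise smoothness of a matrix valued function. -/
def SmoothMatOn (U : Set (Coord d)) (A : Coord d → Matrix m n ℝ) : Prop :=
  ∀ i j, SmoothOn U (fun y => A y i j)

/-- Entrywise partial derivative of a matrix valued function. -/
def matDeriv (k : Fin d) (A : Coord d → Matrix m n ℝ) (y : Coord d) : Matrix m n ℝ :=
  Matrix.of fun i j => partialDeriv k (fun z => A z i j) y

namespace SmoothMatOn

variable {A B : Coord d → Matrix m n ℝ} {C : Coord d → Matrix n p ℝ}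

lemma mul (hA : SmoothMatOn U A) (hC : SmoothMatOn U C) : SmoothMatOn U (fun y => A y * C y) :=
  fun i j => by
    simp only [Matrix.mul_apply]
    exact SmoothOn.sum fun k => (hA i k).mul (hC k j)

lemma add (hA : SmoothMatOn U A) (hB : SmoothMatOn U B) : SmoothMatOn U (fun y => A y + B y) :=
  fun i j => (hA i j).add (hB i j)

lemma sub (hA : SmoothMatOn U A) (hB : SmoothMatOn U B) : SmoothMatOn U (fun y => A y - B y) :=
  fun i j => (hA i j).sub (hB i j)

lemma transpose (hA : SmoothMatOn U A) : SmoothMatOn U (fun y => (A y).transpose) :=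
  fun i j => hA j i

lemma matDeriv (hA : SmoothMatOn U A) (hU : IsOpen U) (k : Fin d) :
    SmoothMatOn U (matDeriv k A) :=
  fun i j => (hA i j).partialDeriv hU k

end SmoothMatOn

variable {A B : Coord d → Matrix m n ℝ} {C : Coord d → Matrix n p ℝ}

lemma matDeriv_mul (hU : IsOpen U) (hy : y ∈ U) (hA : SmoothMatOn U A) (hC : SmoothMatOn U C)
    (k : Fin d) :
    matDeriv k (fun z => A z * C z) y = matDeriv k A y * C y + A y * matDeriv k C y := by
  ext i j
  simp only [matDeriv, Matrix.mul_apply, Matrix.add_apply, Matrix.of_apply]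
  rw [partialDeriv_sum k fun l => ((hA i l).mul (hC l j)).differentiableAt hU hy,
    ← Finset.sum_add_distrib]
  exact Finset.sum_congr rfl fun l _ => partialDeriv_mul k ((hA i l).differentiableAt hU hy)
    ((hC l j).differentiableAt hU hy)

lemma matDeriv_add (hU : IsOpen U) (hy : y ∈ U) (hA : SmoothMatOn U A) (hB : SmoothMatOn U B)
    (k : Fin d) :
    matDeriv k (fun z => A z + B z) y = matDeriv k A y + matDeriv k B y := by
  ext i j
  exact partialDeriv_add k ((hA i j).differentiableAt hU hy) ((hB i j).differentiableAt hU hy)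

lemma matDeriv_sub (hU : IsOpen U) (hy : y ∈ U) (hA : SmoothMatOn U A) (hB : SmoothMatOn U B)
    (k : Fin d) :
    matDeriv k (fun z => A z - B z) y = matDeriv k A y - matDeriv k B y := by
  ext i j
  exact partialDeriv_sub k ((hA i j).differentiableAt hU hy) ((hB i j).differentiableAt hU hy)

lemma matDeriv_neg (k : Fin d) : matDeriv k (fun z => -A z) y = -matDeriv k A y := by
  ext i j
  exact partialDeriv_neg k

lemma matDeriv_transpose (k : Fin d) :
    matDeriv k (fun z => (A z).transpose) y = (matDeriv k A y).transpose := rfl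

lemma matDeriv_congr (hU : IsOpen U) (hy : y ∈ U) (h : ∀ z ∈ U, A z = B z) (k : Fin d) :
    matDeriv k A y = matDeriv k B y := by
  ext i j
  exact partialDeriv_congr k hU hy fun z hz => by rw [h z hz]

lemma matDeriv_const (M : Matrix m n ℝ) (k : Fin d) : matDeriv k (fun _ => M) y = 0 := by
  ext i j
  exact partialDeriv_const k _

lemma matDeriv_comm (hU : IsOpen U) (hy : y ∈ U) (hA : SmoothMatOn U A) (k l : Fin d) :
    matDeriv k (matDeriv l A) y = matDeriv l (matDeriv k A) y := by
  ext i j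
  exact partialDeriv_comm k (hA i j) hU hy l

lemma SmoothMatOn.det [DecidableEq m] {A : Coord d → Matrix m m ℝ} (hA : SmoothMatOn U A) :
    SmoothOn U (fun y => (A y).det) := by
  simp only [Matrix.det_apply']
  exact SmoothOn.sum fun s => (SmoothOn.const _).mul (SmoothOn.prod fun i => hA _ _)

/-- Cramer's rule: the adjugate and the determinant are polynomials in the entries. -/
lemma SmoothMatOn.inv [DecidableEq m] {A : Coord d → Matrix m m ℝ} (hA : SmoothMatOn U A)
    (h : ∀ y ∈ U, (A y).det ≠ 0) : SmoothMatOn U (fun y => (A y)⁻¹) := by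
  intro i j
  have hadj : SmoothOn U (fun y => (A y).adjugate i j) := by
    simp only [Matrix.adjugate_apply]
    refine SmoothMatOn.det fun k l => ?_
    by_cases hk : k = j
    · subst hk
      simpa using SmoothOn.const _
    · simpa [Matrix.updateRow_ne hk] using hA k l
  have hdet : SmoothOn U (fun y => ((A y).det)⁻¹) := ContDiffOn.inv hA.det h
  refine (hdet.mul hadj).congr fun y _ => ?_
  simp [Matrix.inv_def]

end MatrixCalculus

/-! ### Linear connections -/

section Connection

variable {N : Type*} [Fintype N] {y : Coord d}

/-- The curvature `F_{ab} = ∂_a Θ_b - ∂_b Θ_a + [Θ_a, Θ_b]` of a matrix valued connection form. -/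
def matCurvature (Θ : Fin d → Coord d → Matrix N N ℝ) (a b : Fin d) (y : Coord d) :
    Matrix N N ℝ :=
  matDeriv a (Θ b) y - matDeriv b (Θ a) y + Θ a y * Θ b y - Θ b y * Θ a y

lemma matCurvature_apply (Θ : Fin d → N → N → Coord d → ℝ) (a b : Fin d) (C E : N)
    (y : Coord d) :
    matCurvature (fun a y => Matrix.of fun C E => Θ a C E y) a b y C E =
      connectionCurvature Θ a b C E y := by
  simp only [matCurvature, connectionCurvature, matDeriv, Matrix.sub_apply, Matrix.add_apply,
    Matrix.mul_apply, Matrix.of_apply, Finset.sum_sub_distrib]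
  ring

variable {Θ : Fin d → Coord d → Matrix N N ℝ}

lemma SmoothMatOn.matCurvature (hU : IsOpen U) (hΘ : ∀ a, SmoothMatOn U (Θ a)) (a b : Fin d) :
    SmoothMatOn U (matCurvature Θ a b) :=
  (((((hΘ b).matDeriv hU a).sub ((hΘ a).matDeriv hU b)).add ((hΘ a).mul (hΘ b)))).sub
    ((hΘ b).mul (hΘ a))

lemma matCurvature_antisymm (Θ : Fin d → Coord d → Matrix N N ℝ) (a b : Fin d) (y : Coord d) :
    matCurvature Θ a b y = -matCurvature Θ b a y := by
  simp only [matCurvature]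
  abel

lemma matDeriv_matCurvature (hU : IsOpen U) (hy : y ∈ U) (hΘ : ∀ a, SmoothMatOn U (Θ a))
    (c a b : Fin d) :
    matDeriv c (matCurvature Θ a b) y =
      matDeriv c (matDeriv a (Θ b)) y - matDeriv c (matDeriv b (Θ a)) y
        + (matDeriv c (Θ a) y * Θ b y + Θ a y * matDeriv c (Θ b) y)
        - (matDeriv c (Θ b) y * Θ a y + Θ b y * matDeriv c (Θ a) y) := by
  have h1 := (hΘ b).matDeriv hU a
  have h2 := (hΘ a).matDeriv hU b
  have h3 := (hΘ a).mul (hΘ b)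
  have h4 := (hΘ b).mul (hΘ a)
  unfold matCurvature
  rw [matDeriv_sub hU hy ((h1.sub h2).add h3) h4, matDeriv_add hU hy (h1.sub h2) h3,
    matDeriv_sub hU hy h1 h2, matDeriv_mul hU hy (hΘ a) (hΘ b), matDeriv_mul hU hy (hΘ b) (hΘ a)]

/-- The differential Bianchi identity of a linear connection. -/
lemma bianchi_matCurvature (hU : IsOpen U) (hy : y ∈ U) (hΘ : ∀ a, SmoothMatOn U (Θ a))
    (a b c : Fin d) :
    (matDeriv a (matCurvature Θ b c) y + Θ a y * matCurvature Θ b c y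
        - matCurvature Θ b c y * Θ a y)
      + (matDeriv b (matCurvature Θ c a) y + Θ b y * matCurvature Θ c a y
        - matCurvature Θ c a y * Θ b y)
      + (matDeriv c (matCurvature Θ a b) y + Θ c y * matCurvature Θ a b y
        - matCurvature Θ a b y * Θ c y) = 0 := by
  -- Once the second derivatives of each `Θ` are put in the same order, the cyclic sum is an
  -- identity between noncommuting polynomials in `Θ` and its derivatives.
  rw [matDeriv_matCurvature hU hy hΘ, matDeriv_matCurvature hU hy hΘ,
    matDeriv_matCurvature hU hy hΘ, matDeriv_comm hU hy (hΘ c) a b,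
    matDeriv_comm hU hy (hΘ b) a c, matDeriv_comm hU hy (hΘ a) b c]
  simp only [matCurvature]
  noncomm_ring

/-- The curvature annihilates parallel sections. -/
lemma matCurvature_mul_parallel {p : Type*} [Fintype p] (hU : IsOpen U) (hy : y ∈ U)
    (hΘ : ∀ a, SmoothMatOn U (Θ a)) {I : Coord d → Matrix N p ℝ} (hI : SmoothMatOn U I)
    (hpar : ∀ z ∈ U, ∀ a, matDeriv a I z = -(Θ a z * I z)) (a b : Fin d) :
    matCurvature Θ a b y * I y = 0 := by
  -- Differentiating $\partial_bI=-\Theta_bI$ again and using $\partial_aI=-\Theta_aI$; the part of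
  -- the result skew in $a,b$ is $-F_{ab}I$, and it vanishes since partial derivatives commute.
  have key : ∀ a b, matDeriv a (matDeriv b I) y =
      -(matDeriv a (Θ b) y * I y - Θ b y * (Θ a y * I y)) := by
    intro a b
    rw [matDeriv_congr hU hy (fun z hz => hpar z hz b), matDeriv_neg,
      matDeriv_mul hU hy (hΘ b) hI, hpar y hy a, Matrix.mul_neg, sub_eq_add_neg]
  have h := matDeriv_comm hU hy hI a b
  rw [key, key] at h
  simp only [matCurvature, Matrix.sub_mul, Matrix.add_mul, Matrix.mul_assoc]
  rw [neg_inj] at h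
  rw [← sub_eq_zero] at h
  rw [← h]
  abel

end Connection

end Calculus

/-! ### Levi-Civita connection and symmetries of the Riemann tensor. -/

section Metric

variable {d : ℕ} {U : Set (Coord d)} {G : LocalMetric d}

/-- A smooth Riemannian metric on an open subset of coordinate space. -/
structure IsMetricOn (U : Set (Coord d)) (G : LocalMetric d) : Prop where
  isOpen : IsOpen U
  smooth : SmoothMatOn U G
  posDef : ∀ y ∈ U, (G y).PosDef

/-- The matrix `Γ^c_{fe}` of the Levi-Civita connection in the direction `f`. -/
def christoffelMat (G : LocalMetric d) (f : Fin d) (y : Coord d) : Matrix (Fin d) (Fin d) ℝ :=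
  Matrix.of fun c e => christoffel G c f e y

namespace IsMetricOn

variable (h : IsMetricOn U G) {y : Coord d} (hy : y ∈ U)
include h

lemma det_ne_zero (y : Coord d) (hy : y ∈ U) : (G y).det ≠ 0 := (h.posDef y hy).det_pos.ne'

lemma smooth_inv : SmoothMatOn U (fun y => (G y)⁻¹) := h.smooth.inv h.det_ne_zero

lemma smooth_inv_apply (a b : Fin d) : SmoothOn U (fun y => (G y)⁻¹ a b) := h.smooth_inv a b

lemma smooth_christoffel (c a b : Fin d) : SmoothOn U (christoffel G c a b) := by
  unfold christoffel
  exact (SmoothOn.const _).mul (SmoothOn.sum fun e => (h.smooth_inv c e).mul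
    ((((h.smooth e b).partialDeriv h.isOpen a).add ((h.smooth e a).partialDeriv h.isOpen b)).sub
      ((h.smooth a b).partialDeriv h.isOpen e)))

lemma smooth_christoffelMat (f : Fin d) : SmoothMatOn U (christoffelMat G f) :=
  fun c e => h.smooth_christoffel c f e

include hy

lemma transpose_eq : (G y).transpose = G y := by
  have := (h.posDef y hy).isHermitian
  rwa [Matrix.IsHermitian, Matrix.conjTranspose_eq_transpose_of_trivial] at this

lemma symm (a b : Fin d) : G y a b = G y b a := by
  conv_lhs => rw [← h.transpose_eq hy]
  rfl

lemma isUnit_det : IsUnit (G y).det := (h.det_ne_zero y hy).isUnit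

lemma mul_inv : G y * (G y)⁻¹ = 1 := Matrix.mul_nonsing_inv _ (h.isUnit_det hy)

lemma inv_mul : (G y)⁻¹ * G y = 1 := Matrix.nonsing_inv_mul _ (h.isUnit_det hy)

lemma inv_transpose : ((G y)⁻¹).transpose = (G y)⁻¹ := by
  rw [Matrix.transpose_nonsing_inv, h.transpose_eq hy]

lemma inv_symm (a b : Fin d) : (G y)⁻¹ a b = (G y)⁻¹ b a := by
  conv_lhs => rw [← h.inv_transpose hy]
  rfl

lemma sum_mul_inv (a b : Fin d) : ∑ e, G y a e * (G y)⁻¹ e b = if a = b then 1 else 0 := by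
  have := congrFun (congrFun (h.mul_inv hy) a) b
  rwa [Matrix.mul_apply, Matrix.one_apply] at this

lemma sum_inv_mul (a b : Fin d) : ∑ e, (G y)⁻¹ a e * G y e b = if a = b then 1 else 0 := by
  have := congrFun (congrFun (h.inv_mul hy) a) b
  rwa [Matrix.mul_apply, Matrix.one_apply] at this

/-- The Levi-Civita connection is metric. -/
lemma matDeriv_metric (f : Fin d) :
    matDeriv f G y = (christoffelMat G f y).transpose * G y + G y * christoffelMat G f y := by
  -- Lowering the upper index gives the Christoffel symbols of the first kind. In the sum with the
  -- transpose the terms skew in $a,b$ cancel and $\partial_fg_{ab}$ remains.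
  have key : ∀ a b, (G y * christoffelMat G f y) a b = (1 / 2) *
      (partialDeriv f (fun z => G z a b) y + partialDeriv b (fun z => G z a f) y
        - partialDeriv a (fun z => G z f b) y) := by
    intro a b
    have : christoffelMat G f y = (1 / 2 : ℝ) • ((G y)⁻¹ * Matrix.of fun e b =>
        (partialDeriv f (fun z => G z e b) y + partialDeriv b (fun z => G z e f) y
        - partialDeriv e (fun z => G z f b) y)) := by
      ext c b
      simp [christoffelMat, christoffel, Matrix.mul_apply]
    rw [this, Matrix.mul_smul, ← Matrix.mul_assoc, h.mul_inv hy, Matrix.one_mul]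
    simp
  have hs : ∀ k a b, partialDeriv k (fun z => G z a b) y = partialDeriv k (fun z => G z b a) y :=
    fun k a b => partialDeriv_congr k h.isOpen hy fun z hz => h.symm hz a b
  have ht : (christoffelMat G f y).transpose * G y = (G y * christoffelMat G f y).transpose := by
    rw [Matrix.transpose_mul, h.transpose_eq hy]
  ext a b
  rw [ht, Matrix.add_apply, Matrix.transpose_apply, key, key, hs f b a, hs a b f, hs b f a]
  simp only [matDeriv, Matrix.of_apply]
  ring

lemma partialDeriv_metric (f a b : Fin d) : partialDeriv f (fun z => G z a b) y =
    ∑ e, christoffel G e f a y * G y e b + ∑ e, christoffel G e f b y * G y a e := by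
  have := congrFun (congrFun (h.matDeriv_metric hy f) a) b
  simp only [matDeriv, Matrix.of_apply, Matrix.add_apply, Matrix.mul_apply,
    Matrix.transpose_apply, christoffelMat] at this
  rw [this]
  congr 1
  exact Finset.sum_congr rfl fun e _ => mul_comm _ _

lemma matDeriv_inv (f : Fin d) : matDeriv f (fun z => (G z)⁻¹) y =
    -(christoffelMat G f y * (G y)⁻¹ + (G y)⁻¹ * (christoffelMat G f y).transpose) := by
  -- Differentiate $g^{-1}g=1$, then solve for $\partial g^{-1}$ by multiplying with $g^{-1}$ on the
  -- right.
  have h1 : matDeriv f (fun z => (G z)⁻¹ * G z) y = 0 :=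
    (matDeriv_congr h.isOpen hy (fun z hz => h.inv_mul hz) f).trans (matDeriv_const 1 f)
  rw [matDeriv_mul h.isOpen hy h.smooth_inv h.smooth, h.matDeriv_metric hy] at h1
  have h2 : (matDeriv f (fun z => (G z)⁻¹) y * G y + (G y)⁻¹ *
      ((christoffelMat G f y).transpose * G y + G y * christoffelMat G f y)) * (G y)⁻¹ = 0 := by
    rw [h1, Matrix.zero_mul]
  have h3 : (matDeriv f (fun z => (G z)⁻¹) y * G y + (G y)⁻¹ *
      ((christoffelMat G f y).transpose * G y + G y * christoffelMat G f y)) * (G y)⁻¹ =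
      matDeriv f (fun z => (G z)⁻¹) y * (G y * (G y)⁻¹) + (G y)⁻¹ *
        (christoffelMat G f y).transpose * (G y * (G y)⁻¹)
      + ((G y)⁻¹ * G y) * christoffelMat G f y * (G y)⁻¹ := by
    noncomm_ring
  rw [h3, h.mul_inv hy, h.inv_mul hy, Matrix.mul_one, Matrix.mul_one, Matrix.one_mul] at h2
  rw [eq_neg_iff_add_eq_zero, ← h2]
  abel

lemma partialDeriv_inv (f a b : Fin d) : partialDeriv f (fun z => (G z)⁻¹ a b) y =
    -(∑ e, christoffel G a f e y * (G y)⁻¹ e b + ∑ e, christoffel G b f e y * (G y)⁻¹ a e) := by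
  have := congrFun (congrFun (h.matDeriv_inv hy f) a) b
  simp only [matDeriv, Matrix.of_apply, Matrix.add_apply, Matrix.mul_apply, Matrix.neg_apply,
    Matrix.transpose_apply, christoffelMat] at this
  rw [this]
  congr 2
  exact Finset.sum_congr rfl fun e _ => mul_comm _ _

lemma christoffel_symm (c a b : Fin d) : christoffel G c a b y = christoffel G c b a y := by
  unfold christoffel
  congr 1
  refine Finset.sum_congr rfl fun e _ => ?_
  rw [partialDeriv_congr e h.isOpen hy fun z hz => h.symm hz a b]
  ring

end IsMetricOn

/-! ### The Riemann tensor -/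

/-- The matrix `R_{ab}{}^c{}_e` in `c`, `e`. -/
def riemannMat (G : LocalMetric d) (a b : Fin d) (y : Coord d) : Matrix (Fin d) (Fin d) ℝ :=
  matCurvature (christoffelMat G) a b y

lemma riemannMat_apply (G : LocalMetric d) (a b c e : Fin d) (y : Coord d) :
    riemannMat G a b y c e = riemannUp G a b c e y :=
  matCurvature_apply (fun a c e => christoffel G c a e) a b c e y

lemma riemann_eq (G : LocalMetric d) (a b c e : Fin d) (y : Coord d) :
    riemann G a b c e y = (G y * riemannMat G a b y) c e := by
  simp only [riemann, Matrix.mul_apply, riemannMat_apply]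

lemma riemann_swap₁₂ (G : LocalMetric d) (a b c e : Fin d) (y : Coord d) :
    riemann G a b c e y = -riemann G b a c e y := by
  rw [riemann_eq, riemann_eq, riemannMat, matCurvature_antisymm, Matrix.mul_neg, Matrix.neg_apply]
  rfl

/-- The covariant derivative of a covariant two-tensor. -/
def nabla₂ (G : LocalMetric d) (T : Fin d → Fin d → Coord d → ℝ) (f a b : Fin d) (y : Coord d) :
    ℝ :=
  partialDeriv f (T a b) y - ∑ k, christoffel G k f a y * T k b y
    - ∑ k, christoffel G k f b y * T a k y

/-- The covariant derivative of a covariant three-tensor. -/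
def nabla₃ (G : LocalMetric d) (T : Fin d → Fin d → Fin d → Coord d → ℝ) (f a b c : Fin d)
    (y : Coord d) : ℝ :=
  partialDeriv f (T a b c) y - ∑ k, christoffel G k f a y * T k b c y
    - ∑ k, christoffel G k f b y * T a k c y - ∑ k, christoffel G k f c y * T a b k y

/-- The covariant derivative of a covariant four-tensor. -/
def nabla₄ (G : LocalMetric d) (T : Fin d → Fin d → Fin d → Fin d → Coord d → ℝ)
    (f a b c e : Fin d) (y : Coord d) : ℝ :=
  partialDeriv f (T a b c e) y - ∑ k, christoffel G k f a y * T k b c e y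
    - ∑ k, christoffel G k f b y * T a k c e y - ∑ k, christoffel G k f c y * T a b k e y
    - ∑ k, christoffel G k f e y * T a b c k y

/-- Bridge from the tuple-indexed `covD` to a fixed-arity formula, so that later computations avoid
`Function.update`. -/
lemma covD_two (G : LocalMetric d) (T : Fin d → Fin d → Coord d → ℝ) (f a b : Fin d)
    (y : Coord d) :
    covD G (m := 0) (fun i _ => T (i 0) (i 1)) ![f, a, b] ![] y = nabla₂ G T f a b y := by
  simp [covD, nabla₂, Fin.sum_univ_two, Fin.tail, sub_sub]

lemma covD_three (G : LocalMetric d) (T : Fin d → Fin d → Fin d → Coord d → ℝ)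
    (f a b c : Fin d) (y : Coord d) :
    covD G (m := 0) (fun i _ => T (i 0) (i 1) (i 2)) ![f, a, b, c] ![] y =
      nabla₃ G T f a b c y := by
  simp [covD, nabla₃, Fin.sum_univ_three, Fin.tail, sub_sub, add_assoc]

namespace IsMetricOn

variable (h : IsMetricOn U G) {y : Coord d} (hy : y ∈ U)
include h

lemma smooth_riemannMat (a b : Fin d) : SmoothMatOn U (riemannMat G a b) :=
  SmoothMatOn.matCurvature h.isOpen h.smooth_christoffelMat a b

lemma smooth_riemann (a b c e : Fin d) : SmoothOn U (riemann G a b c e) := by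
  refine ((h.smooth.mul (h.smooth_riemannMat a b)) c e).congr fun y _ => ?_
  rw [riemann_eq]

include hy

/-- The metric is parallel, so the curvature acting on it vanishes: expand
$\partial_a\partial_bg=\partial_b\partial_ag$ with `matDeriv_metric`. -/
lemma riemannMat_skew (a b : Fin d) :
    (G y * riemannMat G a b y) + (G y * riemannMat G a b y).transpose = 0 := by
  have key : ∀ a b, matDeriv a (matDeriv b G) y =
      (matDeriv a (christoffelMat G b) y).transpose * G y
      + (christoffelMat G b y).transpose *
        ((christoffelMat G a y).transpose * G y + G y * christoffelMat G a y)
      + (((christoffelMat G a y).transpose * G y + G y * christoffelMat G a y)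
          * christoffelMat G b y + G y * matDeriv a (christoffelMat G b) y) := by
    intro a b
    have hb := h.smooth_christoffelMat b
    rw [matDeriv_congr h.isOpen hy (fun z hz => h.matDeriv_metric hz b),
      matDeriv_add h.isOpen hy (hb.transpose.mul h.smooth) (h.smooth.mul hb),
      matDeriv_mul h.isOpen hy hb.transpose h.smooth,
      matDeriv_mul h.isOpen hy h.smooth hb, matDeriv_transpose, h.matDeriv_metric hy a]
  have hc := matDeriv_comm h.isOpen hy h.smooth a b
  rw [key, key, ← sub_eq_zero] at hc
  rw [Matrix.transpose_mul, h.transpose_eq hy, ← hc, riemannMat, matCurvature]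
  simp only [Matrix.transpose_sub, Matrix.transpose_add, Matrix.transpose_mul]
  noncomm_ring

lemma riemann_swap₃₄ (a b c e : Fin d) : riemann G a b c e y = -riemann G a b e c y := by
  have := congrFun (congrFun (h.riemannMat_skew hy a b) c) e
  rw [Matrix.add_apply, Matrix.transpose_apply, ← riemann_eq, ← riemann_eq, Matrix.zero_apply]
    at this
  linarith

/-- A consequence of vanishing torsion: with the lower indices of every $\Gamma$ sorted, the terms
of the cyclic sum cancel in pairs. -/
lemma riemannUp_cyclic (a b e c : Fin d) :
    riemannUp G a b c e y + riemannUp G b e c a y + riemannUp G e a c b y = 0 := by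
  have hs : ∀ k a b, partialDeriv k (christoffel G c a b) y =
      partialDeriv k (christoffel G c b a) y :=
    fun k a b => partialDeriv_congr k h.isOpen hy fun z hz => h.christoffel_symm hz c a b
  have ht : ∀ (u a b : Fin d), ∑ k, christoffel G c u k y * christoffel G k a b y =
      ∑ k, christoffel G c u k y * christoffel G k b a y :=
    fun u a b => Finset.sum_congr rfl fun k _ => by rw [h.christoffel_symm hy k a b]
  simp only [riemannUp, connectionCurvature, Finset.sum_sub_distrib]
  rw [hs b a e, hs a e b, hs e b a, ht a b e, ht b a e, ht e b a]
  ring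

lemma riemann_cyclic (a b e c : Fin d) :
    riemann G a b c e y + riemann G b e c a y + riemann G e a c b y = 0 := by
  simp only [riemann, ← Finset.sum_add_distrib, ← mul_add, h.riemannUp_cyclic hy, mul_zero,
    Finset.sum_const_zero]

/-- The classical octahedron argument: a combination of four cyclic identities, reduced by the skew
symmetries in each pair. -/
lemma riemann_pair (a b c e : Fin d) : riemann G a b c e y = riemann G c e a b y := by
  linarith [h.riemann_cyclic hy a b c e, h.riemann_cyclic hy b c e a, h.riemann_cyclic hy c e a b,
    h.riemann_cyclic hy e a b c, h.riemann_swap₃₄ hy a b c e, h.riemann_swap₃₄ hy b c e a,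
    h.riemann_swap₃₄ hy c a b e, h.riemann_swap₃₄ hy c e a b, h.riemann_swap₃₄ hy e b c a,
    h.riemann_swap₃₄ hy e a b c,  h.riemann_swap₃₄ hy a c b e, h.riemann_swap₃₄ hy b a c e,
    h.riemann_swap₃₄ hy b e c a, h.riemann_swap₃₄ hy a c e b, h.riemann_swap₃₄ hy b e a c,
    riemann_swap₁₂ G a b c e y, riemann_swap₁₂ G b c e a y, riemann_swap₁₂ G c e a b y,
    riemann_swap₁₂ G e a b c y, riemann_swap₁₂ G a c b e y, riemann_swap₁₂ G b e c a y,
    riemann_swap₁₂ G b e a c y, riemann_swap₁₂ G a c e b y, riemann_swap₁₂ G a b e c y,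
    riemann_swap₁₂ G c e b a y, riemann_swap₁₂ G b c a e y, riemann_swap₁₂ G e a c b y]

/-- Lowering an index commutes with $\nabla$. This isolates the covariant derivative of the
endomorphism $R_{ab}$, to which `bianchi_matCurvature` applies, from the Christoffel terms of the
form indices. -/
lemma nabla₄_riemann (f a b c e : Fin d) : nabla₄ G (riemann G) f a b c e y =
    (G y * (matDeriv f (riemannMat G a b) y + christoffelMat G f y * riemannMat G a b y
      - riemannMat G a b y * christoffelMat G f y)) c e
    - ∑ k, christoffel G k f a y * riemann G k b c e y
    - ∑ k, christoffel G k f b y * riemann G a k c e y := by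
  have h1 : partialDeriv f (riemann G a b c e) y =
      matDeriv f (fun z => G z * riemannMat G a b z) y c e := by
    simp only [matDeriv, Matrix.of_apply]
    exact partialDeriv_congr f h.isOpen hy fun z _ => riemann_eq G a b c e z
  rw [nabla₄, h1, matDeriv_mul h.isOpen hy h.smooth (h.smooth_riemannMat a b),
    h.matDeriv_metric hy]
  have h2 : ∑ k, christoffel G k f c y * riemann G a b k e y =
      ((christoffelMat G f y).transpose * (G y * riemannMat G a b y)) c e := by
    rw [Matrix.mul_apply (M := (christoffelMat G f y).transpose)]
    simp only [riemann_eq, christoffelMat, Matrix.transpose_apply, Matrix.of_apply]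
  have h3 : ∑ k, christoffel G k f e y * riemann G a b c k y =
      ((G y * riemannMat G a b y) * christoffelMat G f y) c e := by
    rw [Matrix.mul_apply (N := christoffelMat G f y)]
    simp only [riemann_eq, christoffelMat, Matrix.of_apply, mul_comm]
  rw [h2, h3]
  have h4 : ((christoffelMat G f y).transpose * G y + G y * christoffelMat G f y)
        * riemannMat G a b y + G y * matDeriv f (riemannMat G a b) y
      - (christoffelMat G f y).transpose * (G y * riemannMat G a b y)
      - (G y * riemannMat G a b y) * christoffelMat G f y =
      G y * (matDeriv f (riemannMat G a b) y + christoffelMat G f y * riemannMat G a b y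
        - riemannMat G a b y * christoffelMat G f y) := by noncomm_ring
  rw [← h4]
  simp only [Matrix.sub_apply]
  ring

/-- The second Bianchi identity. -/
lemma bianchi_riemann (f a b c e : Fin d) : nabla₄ G (riemann G) f a b c e y
    + nabla₄ G (riemann G) a b f c e y + nabla₄ G (riemann G) b f a c e y = 0 := by
  rw [h.nabla₄_riemann hy, h.nabla₄_riemann hy, h.nabla₄_riemann hy]
  set X : Fin d → Fin d → Fin d → Matrix (Fin d) (Fin d) ℝ := fun f a b =>
    matDeriv f (riemannMat G a b) y + christoffelMat G f y * riemannMat G a b y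
      - riemannMat G a b y * christoffelMat G f y with hX
  have hB : (G y * X f a b) c e + (G y * X a b f) c e + (G y * X b f a) c e = 0 := by
    have : X f a b + X a b f + X b f a = 0 :=
      bianchi_matCurvature h.isOpen hy h.smooth_christoffelMat f a b
    rw [← Matrix.add_apply, ← Matrix.add_apply, ← Matrix.mul_add, ← Matrix.mul_add, this,
      Matrix.mul_zero, Matrix.zero_apply]
  -- The Christoffel terms of the form indices cancel in pairs over the cyclic sum, by vanishing
  -- torsion and skewness of $R$ in its first pair.
  have hs : ∀ u v w, ∑ k, christoffel G k u v y * riemann G k w c e y =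
      -∑ k, christoffel G k v u y * riemann G w k c e y := by
    intro u v w
    rw [← Finset.sum_neg_distrib]
    refine Finset.sum_congr rfl fun k _ => ?_
    rw [h.christoffel_symm hy k u v, riemann_swap₁₂ G k w]
    ring
  rw [hs f a b, hs a b f, hs b f a]
  linarith

end IsMetricOn

end Metric

/-! ### Schouten, Weyl and Cotton tensors, and the Bianchi identity for Weyl. -/

section Weyl

variable {d : ℕ} {U : Set (Coord d)} {G : LocalMetric d}

lemma sum_rotate₁₃ (F : Fin d → Fin d → Fin d → ℝ) :
    ∑ a, ∑ c, ∑ k, F a c k = ∑ a, ∑ c, ∑ k, F k c a := by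
  rw [Finset.sum_comm]
  conv_rhs => rw [Finset.sum_comm]
  exact Finset.sum_congr rfl fun c _ => Finset.sum_comm

lemma sum_rotate₂₃ (F : Fin d → Fin d → Fin d → ℝ) :
    ∑ a, ∑ c, ∑ k, F a c k = ∑ a, ∑ c, ∑ k, F a k c :=
  Finset.sum_congr rfl fun _ _ => Finset.sum_comm

namespace IsMetricOn

variable (h : IsMetricOn U G) {y : Coord d}
include h

lemma smooth_ricci (a b : Fin d) : SmoothOn U (ricci G a b) := by
  unfold ricci
  refine SmoothOn.sum fun c => (h.smooth_riemannMat c a c b).congr fun z _ => ?_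
  rw [riemannMat_apply]

lemma smooth_scalarCurv : SmoothOn U (scalarCurv G) := by
  unfold scalarCurv
  exact SmoothOn.sum fun a => SmoothOn.sum fun b => (h.smooth_inv a b).mul (h.smooth_ricci a b)

lemma smooth_schouten (a b : Fin d) : SmoothOn U (schouten G a b) := by
  unfold schouten
  exact ((h.smooth_ricci a b).sub ((h.smooth_scalarCurv.div_const _).mul
    (h.smooth a b))).div_const _

lemma smooth_weyl (a b c e : Fin d) : SmoothOn U (weyl G a b c e) := by
  have hK : ∀ a b c e, SmoothOn U (fun y => G y a b * schouten G c e y) :=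
    fun a b c e => (h.smooth a b).mul (h.smooth_schouten c e)
  unfold weyl
  exact (h.smooth_riemann a b c e).sub ((((hK c a b e).sub (hK c b a e)).add (hK e b a c)).sub
    (hK e a b c))

lemma smooth_nabla₂ {T : Fin d → Fin d → Coord d → ℝ} (hT : ∀ a b, SmoothOn U (T a b))
    (f a b : Fin d) : SmoothOn U (nabla₂ G T f a b) := by
  unfold nabla₂
  exact (((hT a b).partialDeriv h.isOpen f).sub
    (SmoothOn.sum fun k => (h.smooth_christoffel k f a).mul (hT k b))).sub
    (SmoothOn.sum fun k => (h.smooth_christoffel k f b).mul (hT a k))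

lemma smooth_nabla₃ {T : Fin d → Fin d → Fin d → Coord d → ℝ}
    (hT : ∀ a b c, SmoothOn U (T a b c))
    (f a b c : Fin d) : SmoothOn U (nabla₃ G T f a b c) := by
  unfold nabla₃
  exact ((((hT a b c).partialDeriv h.isOpen f).sub
    (SmoothOn.sum fun k => (h.smooth_christoffel k f a).mul (hT k b c))).sub
    (SmoothOn.sum fun k => (h.smooth_christoffel k f b).mul (hT a k c))).sub
    (SmoothOn.sum fun k => (h.smooth_christoffel k f c).mul (hT a b k))

omit h in
lemma _root_.AlmostEinstein.cotton_eq (G : LocalMetric d) (a b c : Fin d) (y : Coord d) :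
    cotton G a b c y = nabla₂ G (schouten G) b c a y - nabla₂ G (schouten G) c b a y := by
  unfold cotton
  rw [covD_two, covD_two]

omit h in
lemma _root_.AlmostEinstein.cotton_swap (G : LocalMetric d) (a b c : Fin d) (y : Coord d) :
    cotton G a b c y = -cotton G a c b y := by
  rw [cotton_eq, cotton_eq]
  ring

omit h in
lemma _root_.AlmostEinstein.bach_eq (G : LocalMetric d) (a b : Fin d) (y : Coord d) :
    bach G a b y = (∑ c, ∑ e, (G y)⁻¹ c e * nabla₃ G (cotton G) e a c b y)
      + ∑ c, ∑ e, (∑ p, ∑ q, (G y)⁻¹ e p * (G y)⁻¹ c q * schouten G p q y)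
        * weyl G e a c b y := by
  unfold bach
  simp only [covD_three]

lemma smooth_cotton (a b c : Fin d) : SmoothOn U (cotton G a b c) :=
  ((h.smooth_nabla₂ h.smooth_schouten b c a).sub (h.smooth_nabla₂ h.smooth_schouten c b a)).congr
    fun z _ => cotton_eq G a b c z

lemma smooth_bach (a b : Fin d) : SmoothOn U (bach G a b) :=
  ((SmoothOn.sum fun c => SmoothOn.sum fun e => (h.smooth_inv c e).mul
    (h.smooth_nabla₃ h.smooth_cotton e a c b)).add
    (SmoothOn.sum fun c => SmoothOn.sum fun e => (SmoothOn.sum fun p => SmoothOn.sum fun q =>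
      ((h.smooth_inv e p).mul (h.smooth_inv c q)).mul (h.smooth_schouten p q)).mul
        (h.smooth_weyl e a c b))).congr fun z _ => bach_eq G a b z

variable (hy : y ∈ U)
include hy

/-! #### Contractions with the metric -/

lemma sum_inv_mul_sum_mul (k : Fin d) (X : Fin d → ℝ) :
    ∑ c, (G y)⁻¹ k c * ∑ f, G y c f * X f = X k := by
  have : (G y)⁻¹.mulVec ((G y).mulVec X) = X := by
    rw [Matrix.mulVec_mulVec, h.inv_mul hy, Matrix.one_mulVec]
  exact congrFun this k

lemma trace_left (a : Fin d) (X : Fin d → ℝ) :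
    ∑ f, ∑ c, (G y)⁻¹ f c * (G y c a * X f) = X a := by
  simp only [← mul_assoc, ← Finset.sum_mul, h.sum_inv_mul hy]
  simp

lemma trace_right (a : Fin d) (X : Fin d → ℝ) :
    ∑ f, ∑ c, (G y)⁻¹ f c * (G y a f * X c) = X a := by
  rw [Finset.sum_comm]
  have : ∀ c, ∑ f, (G y)⁻¹ f c * (G y a f * X c) = (∑ f, G y a f * (G y)⁻¹ f c) * X c := by
    intro c
    rw [Finset.sum_mul]
    exact Finset.sum_congr rfl fun f _ => by ring
  simp only [this, h.sum_mul_inv hy]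
  simp

lemma trace_metric (x : ℝ) : ∑ f, ∑ c, (G y)⁻¹ f c * (G y c f * x) = d * x := by
  simp only [← mul_assoc, ← Finset.sum_mul, h.sum_inv_mul hy]
  simp

/-! #### Ricci and Schouten tensors -/

lemma raise_riemann (a b k e : Fin d) :
    ∑ c, (G y)⁻¹ k c * riemann G a b c e y = riemannUp G a b k e y :=
  h.sum_inv_mul_sum_mul hy k _

lemma trace_riemann (b e : Fin d) :
    ∑ a, ∑ c, (G y)⁻¹ a c * riemann G a b c e y = ricci G b e y :=
  Finset.sum_congr rfl fun a _ => h.raise_riemann hy a b a e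

lemma ricci_symm (a b : Fin d) : ricci G a b y = ricci G b a y := by
  rw [← h.trace_riemann hy, ← h.trace_riemann hy, Finset.sum_comm]
  refine Finset.sum_congr rfl fun c _ => Finset.sum_congr rfl fun e _ => ?_
  rw [h.inv_symm hy, h.riemann_pair hy]

lemma schouten_symm (a b : Fin d) : schouten G a b y = schouten G b a y := by
  unfold schouten
  rw [h.ricci_symm hy, h.symm hy]

lemma trace_metric_self : ∑ a, ∑ b, (G y)⁻¹ a b * G y a b = d := by
  have := h.trace_metric hy 1
  simp only [mul_one] at this
  rw [← this]
  exact Finset.sum_congr rfl fun a _ => Finset.sum_congr rfl fun b _ => by rw [h.symm hy a b]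

/-- Checks that the scalar used in defining `schouten` is the trace of the resulting tensor, which
turns the definition into the relation `ricci_eq`. -/
lemma traceJ_eq (hd : 3 ≤ d) : traceJ G y = scalarCurv G y / (2 * ((d : ℝ) - 1)) := by
  have hd' : (3 : ℝ) ≤ d := by exact_mod_cast hd
  have h1 : (d : ℝ) - 1 ≠ 0 := by linarith
  have h2 : (d : ℝ) - 2 ≠ 0 := by linarith
  have : traceJ G y = ((∑ a, ∑ b, (G y)⁻¹ a b * ricci G a b y) -
      scalarCurv G y / (2 * ((d : ℝ) - 1)) * ∑ a, ∑ b, (G y)⁻¹ a b * G y a b) / ((d : ℝ) - 2) := by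
    rw [traceJ]
    simp only [schouten, Finset.mul_sum, ← Finset.sum_sub_distrib, Finset.sum_div]
    exact Finset.sum_congr rfl fun a _ => Finset.sum_congr rfl fun b _ => by ring
  rw [← scalarCurv] at this
  rw [this, h.trace_metric_self hy]
  field_simp
  ring

lemma ricci_eq (hd : 3 ≤ d) (a b : Fin d) :
    ricci G a b y = ((d : ℝ) - 2) * schouten G a b y + traceJ G y * G y a b := by
  have hd' : (3 : ℝ) ≤ d := by exact_mod_cast hd
  have h2 : (d : ℝ) - 2 ≠ 0 := by linarith
  rw [h.traceJ_eq hy hd, schouten]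
  field_simp
  ring

/-! #### Algebraic properties of the Weyl tensor -/

omit h hy in
lemma _root_.AlmostEinstein.weyl_swap₁₂ (G : LocalMetric d) (a b c e : Fin d) (y : Coord d) :
    weyl G a b c e y = -weyl G b a c e y := by
  rw [weyl, weyl, riemann_swap₁₂]
  ring

lemma weyl_swap₃₄ (a b c e : Fin d) : weyl G a b c e y = -weyl G a b e c y := by
  rw [weyl, weyl, h.riemann_swap₃₄ hy]
  ring

lemma weyl_pair (a b c e : Fin d) : weyl G a b c e y = weyl G c e a b y := by
  rw [weyl, weyl, h.riemann_pair hy, h.symm hy c a, h.symm hy c b, h.symm hy e b, h.symm hy e a,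
    h.schouten_symm hy b e, h.schouten_symm hy a e, h.schouten_symm hy a c,
    h.schouten_symm hy b c]
  ring

/-- The trace of the metric–Schouten part is $dP_{be}-2P_{be}+Jg_{be}$, which is
$\mathrm{Ric}_{be}$. -/
lemma trace_weyl (hd : 3 ≤ d) (b e : Fin d) :
    ∑ a, ∑ c, (G y)⁻¹ a c * weyl G a b c e y = 0 := by
  have h1 := h.trace_metric hy (schouten G b e y)
  have h2 := h.trace_left hy b (fun a => schouten G a e y)
  have h3 : ∑ a, ∑ c, (G y)⁻¹ a c * (G y e b * schouten G a c y) = traceJ G y * G y e b := by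
    simp only [traceJ, Finset.sum_mul]
    exact Finset.sum_congr rfl fun a _ => Finset.sum_congr rfl fun c _ => by ring
  have h4 := h.trace_right hy e (fun c => schouten G b c y)
  simp only [weyl, mul_sub, mul_add, Finset.sum_sub_distrib, Finset.sum_add_distrib]
  rw [h.trace_riemann hy, h1, h2, h3, h4, h.ricci_eq hy hd, h.symm hy e b]
  ring

/-! #### The contracted Bianchi identities -/

/-- The inverse metric is parallel, so tracing commutes with $\nabla$; here this is needed only for
a trace that vanishes on all of `U`. -/
lemma nabla₄_trace {T : Fin d → Fin d → Fin d → Fin d → Coord d → ℝ}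
    (hT : ∀ a b c e, SmoothOn U (T a b c e))
    (h0 : ∀ z ∈ U, ∀ b e, ∑ a, ∑ c, (G z)⁻¹ a c * T a b c e z = 0) (f b e : Fin d) :
    ∑ a, ∑ c, (G y)⁻¹ a c * nabla₄ G T f a b c e y = 0 := by
  have h1 : partialDeriv f (fun z => ∑ a, ∑ c, (G z)⁻¹ a c * T a b c e z) y = 0 :=
    partialDeriv_eq_zero f h.isOpen hy fun z hz => h0 z hz b e
  have hp : ∀ a c, SmoothOn U (fun z => (G z)⁻¹ a c * T a b c e z) :=
    fun a c => (h.smooth_inv_apply a c).mul (hT a b c e)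
  have h2 : partialDeriv f (fun z => ∑ a, ∑ c, (G z)⁻¹ a c * T a b c e z) y =
      ∑ a, ∑ c, (partialDeriv f (fun z => (G z)⁻¹ a c) y * T a b c e y
        + (G y)⁻¹ a c * partialDeriv f (T a b c e) y) := by
    rw [partialDeriv_sum f fun a => (SmoothOn.sum fun c => hp a c).differentiableAt h.isOpen hy]
    refine Finset.sum_congr rfl fun a _ => ?_
    rw [partialDeriv_sum f fun c => (hp a c).differentiableAt h.isOpen hy]
    exact Finset.sum_congr rfl fun c _ => partialDeriv_mul f
      ((h.smooth_inv_apply a c).differentiableAt h.isOpen hy)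
      ((hT a b c e).differentiableAt h.isOpen hy)
  -- The derivative of $g^{-1}$ supplies exactly the Christoffel terms of the two traced slots.
  have h3 : ∑ a, ∑ c, partialDeriv f (fun z => (G z)⁻¹ a c) y * T a b c e y =
      -(∑ a, ∑ c, ∑ k, (G y)⁻¹ a c * (christoffel G k f a y * T k b c e y))
      - ∑ a, ∑ c, ∑ k, (G y)⁻¹ a c * (christoffel G k f c y * T a b k e y) := by
    rw [sum_rotate₁₃ fun a c k => (G y)⁻¹ a c * (christoffel G k f a y * T k b c e y),
      sum_rotate₂₃ fun a c k => (G y)⁻¹ a c * (christoffel G k f c y * T a b k e y),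
      ← Finset.sum_neg_distrib, ← Finset.sum_sub_distrib]
    refine Finset.sum_congr rfl fun a _ => ?_
    rw [← Finset.sum_neg_distrib, ← Finset.sum_sub_distrib]
    refine Finset.sum_congr rfl fun c _ => ?_
    rw [h.partialDeriv_inv hy, ← Finset.sum_neg_distrib, ← Finset.sum_sub_distrib,
      ← Finset.sum_add_distrib, ← Finset.sum_neg_distrib, Finset.sum_mul]
    exact Finset.sum_congr rfl fun k _ => by ring
  -- The Christoffel terms of the two free slots are combinations of the vanishing trace itself.
  have h4 : ∀ (v : Fin d) (S : Fin d → Fin d → Fin d → ℝ),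
      (∀ k, ∑ a, ∑ c, (G y)⁻¹ a c * S k a c = 0) →
      ∑ a, ∑ c, (G y)⁻¹ a c * ∑ k, christoffel G k f v y * S k a c = 0 := by
    intro v S hS
    have : ∑ a, ∑ c, (G y)⁻¹ a c * ∑ k, christoffel G k f v y * S k a c =
        ∑ k, christoffel G k f v y * ∑ a, ∑ c, (G y)⁻¹ a c * S k a c := by
      simp only [Finset.mul_sum]
      rw [sum_rotate₂₃, Finset.sum_comm]
      refine Finset.sum_congr rfl fun k _ => Finset.sum_congr rfl fun a _ =>
        Finset.sum_congr rfl fun c _ => by ring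
    rw [this]
    simp [hS]
  have h5 := h4 b (fun k a c => T a k c e y) fun k => h0 y hy k e
  have h6 := h4 e (fun k a c => T a b c k y) fun k => h0 y hy b k
  rw [h2] at h1
  simp only [Finset.sum_add_distrib] at h1
  rw [h3] at h1
  simp only [nabla₄, mul_sub, Finset.sum_sub_distrib]
  rw [h5, h6]
  simp only [Finset.mul_sum]
  linarith

lemma nabla₄_weyl (f a b c e : Fin d) : nabla₄ G (weyl G) f a b c e y =
    nabla₄ G (riemann G) f a b c e y
      - (G y c a * nabla₂ G (schouten G) f b e y - G y c b * nabla₂ G (schouten G) f a e y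
        + G y e b * nabla₂ G (schouten G) f a c y - G y e a * nabla₂ G (schouten G) f b c y) := by
  have hs : ∀ a b c e, SmoothOn U (fun y => G y a b * schouten G c e y) :=
    fun a b c e => (h.smooth a b).mul (h.smooth_schouten c e)
  have hK : ∀ a b c e, partialDeriv f (fun y => G y a b * schouten G c e y) y =
      (∑ k, christoffel G k f a y * G y k b + ∑ k, christoffel G k f b y * G y a k)
        * schouten G c e y + G y a b * partialDeriv f (schouten G c e) y := by
    intro a b c e
    rw [partialDeriv_mul f ((h.smooth a b).differentiableAt h.isOpen hy)
      ((h.smooth_schouten c e).differentiableAt h.isOpen hy), h.partialDeriv_metric hy]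
  have h1 : partialDeriv f (weyl G a b c e) y = partialDeriv f (riemann G a b c e) y
      - (partialDeriv f (fun y => G y c a * schouten G b e y) y
        - partialDeriv f (fun y => G y c b * schouten G a e y) y
        + partialDeriv f (fun y => G y e b * schouten G a c y) y
        - partialDeriv f (fun y => G y e a * schouten G b c y) y) := by
    have e1 := (hs c a b e).sub (hs c b a e)
    have e2 := e1.add (hs e b a c)
    have D := fun {f} (hf : SmoothOn U f) => hf.differentiableAt h.isOpen hy
    unfold weyl
    rw [partialDeriv_sub f (D (h.smooth_riemann a b c e)) (D (e2.sub (hs e a b c))),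
      partialDeriv_sub f (D e2) (D (hs e a b c)), partialDeriv_add f (D e1) (D (hs e b a c)),
      partialDeriv_sub f (D (hs c a b e)) (D (hs c b a e))]
  rw [nabla₄, h1, hK, hK, hK, hK, nabla₄]
  simp only [nabla₂, weyl, mul_sub, mul_add, Finset.sum_sub_distrib, Finset.sum_add_distrib,
    Finset.mul_sum, mul_comm, mul_left_comm]
  ring

/-- The second Bianchi identity for $R$; in the cyclic sum the terms $g\,\nabla P$ of the
metric–Schouten part pair up into Cotton tensors. -/
lemma bianchi_weyl (f a b c e : Fin d) : nabla₄ G (weyl G) f a b c e y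
    + nabla₄ G (weyl G) a b f c e y + nabla₄ G (weyl G) b f a c e y
    + (G y c a * cotton G e f b y + G y c b * cotton G e a f y + G y c f * cotton G e b a y)
    - (G y e a * cotton G c f b y + G y e b * cotton G c a f y + G y e f * cotton G c b a y)
      = 0 := by
  rw [h.nabla₄_weyl hy, h.nabla₄_weyl hy, h.nabla₄_weyl hy]
  simp only [cotton_eq]
  linear_combination h.bianchi_riemann hy f a b c e

end IsMetricOn

end Weyl

/-! ### Divergence of Weyl and trace of Cotton. -/

section Divergence

variable {d : ℕ} {U : Set (Coord d)} {G : LocalMetric d}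

lemma sum_swap_pairs (F : Fin d → Fin d → Fin d → Fin d → ℝ) :
    ∑ a, ∑ b, ∑ c, ∑ e, F a b c e = ∑ c, ∑ e, ∑ a, ∑ b, F a b c e := by
  have h1 : ∀ a, ∑ b, ∑ c, ∑ e, F a b c e = ∑ c, ∑ e, ∑ b, F a b c e := fun a => by
    rw [Finset.sum_comm]
    exact Finset.sum_congr rfl fun c _ => Finset.sum_comm
  simp only [h1]
  rw [Finset.sum_comm]
  exact Finset.sum_congr rfl fun c _ => Finset.sum_comm

namespace IsMetricOn

variable (h : IsMetricOn U G) {y : Coord d} (hy : y ∈ U)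
include h hy

lemma nabla₄_weyl_swap₁₂ (f a b c e : Fin d) :
    nabla₄ G (weyl G) f a b c e y = -nabla₄ G (weyl G) f b a c e y := by
  have h1 : partialDeriv f (weyl G a b c e) y = -partialDeriv f (weyl G b a c e) y := by
    rw [← partialDeriv_neg]
    exact partialDeriv_congr f h.isOpen hy fun z _ => weyl_swap₁₂ G a b c e z
  have h2 : ∀ v w, ∑ k, christoffel G k f w y *
      weyl G k v c e y = -∑ k, christoffel G k f w y * weyl G v k c e y := by
    intro v w
    rw [← Finset.sum_neg_distrib]
    exact Finset.sum_congr rfl fun k _ => by rw [weyl_swap₁₂]; ring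
  have h3 : ∀ k, weyl G a b k e y = -weyl G b a k e y := fun k => weyl_swap₁₂ G a b k e y
  have h4 : ∀ k, weyl G a b c k y = -weyl G b a c k y := fun k => weyl_swap₁₂ G a b c k y
  simp only [nabla₄, h1, h2 b a, h2 a b, h3, h4, mul_neg,
    Finset.sum_neg_distrib]
  ring

lemma nabla₄_weyl_swap₃₄ (f a b c e : Fin d) :
    nabla₄ G (weyl G) f a b c e y = -nabla₄ G (weyl G) f a b e c y := by
  have h1 : partialDeriv f (weyl G a b c e) y = -partialDeriv f (weyl G a b e c) y := by
    rw [← partialDeriv_neg]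
    exact partialDeriv_congr f h.isOpen hy fun z hz => h.weyl_swap₃₄ hz a b c e
  simp only [nabla₄, h1]
  simp only [h.weyl_swap₃₄ hy _ _ c _, h.weyl_swap₃₄ hy _ _ _ e, mul_neg,
    Finset.sum_neg_distrib]
  ring

lemma trace₁₃_nabla₄_weyl (hd : 3 ≤ d) (f b e : Fin d) :
    ∑ a, ∑ c, (G y)⁻¹ a c * nabla₄ G (weyl G) f a b c e y = 0 :=
  h.nabla₄_trace hy h.smooth_weyl (fun _ hz => h.trace_weyl hz hd) f b e

lemma trace₂₃_nabla₄_weyl (hd : 3 ≤ d) (f a e : Fin d) :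
    ∑ b, ∑ c, (G y)⁻¹ b c * nabla₄ G (weyl G) f a b c e y = 0 := by
  rw [← neg_eq_zero, ← h.trace₁₃_nabla₄_weyl hy hd f a e]
  simp only [← Finset.sum_neg_distrib]
  exact Finset.sum_congr rfl fun b _ => Finset.sum_congr rfl fun c _ => by
    rw [h.nabla₄_weyl_swap₁₂ hy f a b]; ring

lemma trace₂₄_nabla₄_weyl (hd : 3 ≤ d) (f a c : Fin d) :
    ∑ e, ∑ b, (G y)⁻¹ e b * nabla₄ G (weyl G) f a b c e y = 0 := by
  rw [← neg_eq_zero, ← h.trace₂₃_nabla₄_weyl hy hd f a c, Finset.sum_comm]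
  simp only [← Finset.sum_neg_distrib]
  exact Finset.sum_congr rfl fun b _ => Finset.sum_congr rfl fun e _ => by
    rw [h.nabla₄_weyl_swap₃₄ hy f a b c, h.inv_symm hy]; ring

/-- Trace of `bianchi_weyl` over $f,c$. The trace of the metric gives $d$ copies of Cotton and three
index contractions remove one each, whence $d-3$. The traces of Cotton are kept, since they are only
known to vanish after a second contraction. -/
lemma divergence_weyl_aux (hd : 3 ≤ d) (a b e : Fin d) :
    ∑ f, ∑ c, (G y)⁻¹ f c * nabla₄ G (weyl G) f a b c e y =
      ((d : ℝ) - 3) * cotton G e a b y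
        + G y e a * (∑ f, ∑ c, (G y)⁻¹ f c * cotton G c f b y)
        - G y e b * (∑ f, ∑ c, (G y)⁻¹ f c * cotton G c f a y) := by
  have hB : ∑ f, ∑ c, (G y)⁻¹ f c * (nabla₄ G (weyl G) f a b c e y
    + nabla₄ G (weyl G) a b f c e y + nabla₄ G (weyl G) b f a c e y
    + (G y c a * cotton G e f b y + G y c b * cotton G e a f y + G y c f * cotton G e b a y)
    - (G y e a * cotton G c f b y + G y e b * cotton G c a f y + G y e f * cotton G c b a y))
      = 0 := by
    simp only [h.bianchi_weyl hy, mul_zero, Finset.sum_const_zero]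
  have h1 : ∑ f, ∑ c, (G y)⁻¹ f c * (G y e a * cotton G c f b y) =
      G y e a * ∑ f, ∑ c, (G y)⁻¹ f c * cotton G c f b y := by
    simp only [Finset.mul_sum, mul_left_comm]
  have h2 : ∑ f, ∑ c, (G y)⁻¹ f c * (G y e b * cotton G c a f y) =
      -(G y e b * ∑ f, ∑ c, (G y)⁻¹ f c * cotton G c f a y) := by
    simp only [Finset.mul_sum, ← Finset.sum_neg_distrib]
    exact Finset.sum_congr rfl fun f _ => Finset.sum_congr rfl fun c _ => by
      rw [cotton_swap]; ring
  simp only [mul_sub, mul_add, Finset.sum_sub_distrib, Finset.sum_add_distrib] at hB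
  rw [h.trace₂₃_nabla₄_weyl hy hd, h.trace₁₃_nabla₄_weyl hy hd, h.trace_left hy a,
    h.trace_left hy b, h.trace_metric hy, h1, h2, h.trace_right hy e (fun c => cotton G c b a y),
    cotton_swap G e b a] at hB
  linarith

/-- Trace `divergence_weyl_aux` once more: Weyl is trace-free, so the left side vanishes, while the
right side is $-(d-3)t+t-dt=-(2d-4)t$ for the trace $t$ of Cotton. -/
lemma trace_cotton (hd : 3 ≤ d) (a : Fin d) :
    ∑ f, ∑ c, (G y)⁻¹ f c * cotton G c f a y = 0 := by
  set t : Fin d → ℝ := fun a => ∑ f, ∑ c, (G y)⁻¹ f c * cotton G c f a y with ht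
  have h1 : ∑ e, ∑ b, (G y)⁻¹ e b *
      ∑ f, ∑ c, (G y)⁻¹ f c * nabla₄ G (weyl G) f a b c e y = 0 := by
    have : ∑ e, ∑ b, (G y)⁻¹ e b * ∑ f, ∑ c, (G y)⁻¹ f c * nabla₄ G (weyl G) f a b c e y =
        ∑ f, ∑ c, (G y)⁻¹ f c * ∑ e, ∑ b, (G y)⁻¹ e b * nabla₄ G (weyl G) f a b c e y := by
      simp only [Finset.mul_sum]
      rw [sum_swap_pairs]
      simp only [mul_left_comm]
    rw [this]
    simp only [h.trace₂₄_nabla₄_weyl hy hd, mul_zero, Finset.sum_const_zero]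
  have h2 : ∑ e, ∑ b, (G y)⁻¹ e b * (((d : ℝ) - 3) * cotton G e a b y) =
      -(((d : ℝ) - 3) * t a) := by
    simp only [ht, Finset.mul_sum, ← Finset.sum_neg_distrib]
    rw [Finset.sum_comm]
    exact Finset.sum_congr rfl fun f _ => Finset.sum_congr rfl fun c _ => by
      rw [cotton_swap, h.inv_symm hy]; ring
  have h3 : ∑ e, ∑ b, (G y)⁻¹ e b * (G y e a * t b) = t a := by
    rw [Finset.sum_comm]
    rw [← h.trace_left hy a t]
    exact Finset.sum_congr rfl fun f _ => Finset.sum_congr rfl fun c _ => by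
      rw [h.inv_symm hy]
  have h4 : ∑ e, ∑ b, (G y)⁻¹ e b * (G y e b * t a) = d * t a := by
    rw [← h.trace_metric hy]
    exact Finset.sum_congr rfl fun f _ => Finset.sum_congr rfl fun c _ => by
      rw [h.symm hy f c]
  simp only [h.divergence_weyl_aux hy hd, mul_sub, mul_add, Finset.sum_sub_distrib,
    Finset.sum_add_distrib] at h1
  have h1' : ∑ e, ∑ b, (G y)⁻¹ e b * (((d : ℝ) - 3) * cotton G e a b y)
      + ∑ e, ∑ b, (G y)⁻¹ e b * (G y e a * t b)
      - ∑ e, ∑ b, (G y)⁻¹ e b * (G y e b * t a) = 0 := by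
    rw [← h1]
  rw [h2, h3, h4] at h1'
  have hd' : (3 : ℝ) ≤ d := by exact_mod_cast hd
  have : (2 * (d : ℝ) - 4) * t a = 0 := by linarith
  rcases mul_eq_zero.1 this with h0 | h0
  · linarith
  · exact h0

/-- The divergence of the Weyl tensor is a multiple of the Cotton tensor. -/
lemma divergence_weyl (hd : 3 ≤ d) (a b e : Fin d) :
    ∑ f, ∑ c, (G y)⁻¹ f c * nabla₄ G (weyl G) f a b c e y =
      ((d : ℝ) - 3) * cotton G e a b y := by
  rw [h.divergence_weyl_aux hy hd, h.trace_cotton hy hd, h.trace_cotton hy hd]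
  ring

lemma nabla₂_schouten_symm (f a b : Fin d) :
    nabla₂ G (schouten G) f a b y = nabla₂ G (schouten G) f b a y := by
  have h1 : partialDeriv f (schouten G a b) y = partialDeriv f (schouten G b a) y :=
    partialDeriv_congr f h.isOpen hy fun z hz => h.schouten_symm hz a b
  simp only [nabla₂, h1, h.schouten_symm hy _ b, h.schouten_symm hy a]
  ring

lemma cotton_cyclic (a b c : Fin d) :
    cotton G a b c y + cotton G b c a y + cotton G c a b y = 0 := by
  simp only [cotton_eq]
  linarith [h.nabla₂_schouten_symm hy a b c, h.nabla₂_schouten_symm hy b c a,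
    h.nabla₂_schouten_symm hy c a b]

end IsMetricOn

end Divergence

/-! ### Curvature of the tractor connection, slot by slot. -/

section TractorCurvature

variable {d : ℕ} {U : Set (Coord d)} {G : LocalMetric d}

/-- The connection matrix of the tractor connection. -/
def tractorMat (G : LocalMetric d) (a : Fin d) (y : Coord d) : Matrix (TIdx d) (TIdx d) ℝ :=
  Matrix.of fun C E => tractorConn G a C E y

section Entries

variable (G) (a b c : Fin d) (u v : Unit)

lemma tractorConn_YY : tractorConn G a (Sum.inl u) (Sum.inl v) = fun _ => 0 := rfl

lemma tractorConn_YZ : tractorConn G a (Sum.inl u) (Sum.inr (Sum.inl c)) =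
    fun _ => if a = c then -1 else 0 := rfl

lemma tractorConn_YX : tractorConn G a (Sum.inl u) (Sum.inr (Sum.inr v)) = fun _ => 0 := rfl

lemma tractorConn_ZY : tractorConn G a (Sum.inr (Sum.inl b)) (Sum.inl v) = schouten G a b := rfl

lemma tractorConn_ZZ : tractorConn G a (Sum.inr (Sum.inl b)) (Sum.inr (Sum.inl c)) =
    fun y => -christoffel G c a b y := rfl

lemma tractorConn_ZX : tractorConn G a (Sum.inr (Sum.inl b)) (Sum.inr (Sum.inr v)) =
    fun y => G y a b := rfl

lemma tractorConn_XY : tractorConn G a (Sum.inr (Sum.inr u)) (Sum.inl v) = fun _ => 0 := rfl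

lemma tractorConn_XZ : tractorConn G a (Sum.inr (Sum.inr u)) (Sum.inr (Sum.inl c)) =
    fun y => -∑ b, schouten G a b y * (G y)⁻¹ b c := rfl

lemma tractorConn_XX : tractorConn G a (Sum.inr (Sum.inr u)) (Sum.inr (Sum.inr v)) =
    fun _ => 0 := rfl

end Entries

/-- Splits the contracted tractor index into its three slots, so that the entry lemmas above can
evaluate each product. -/
lemma connectionCurvature_tractorConn (G : LocalMetric d) (a b : Fin d) (C E : TIdx d)
    (y : Coord d) : connectionCurvature (tractorConn G) a b C E y =
      partialDeriv a (tractorConn G b C E) y - partialDeriv b (tractorConn G a C E) y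
      + ((tractorConn G a C slotY y * tractorConn G b slotY E y
          - tractorConn G b C slotY y * tractorConn G a slotY E y)
        + (∑ k, tractorConn G a C (slotZ k) y * tractorConn G b (slotZ k) E y
          - ∑ k, tractorConn G b C (slotZ k) y * tractorConn G a (slotZ k) E y)
        + (tractorConn G a C slotX y * tractorConn G b slotX E y
          - tractorConn G b C slotX y * tractorConn G a slotX E y)) := by
  simp only [connectionCurvature, Fintype.sum_sum_type, Finset.univ_unique,
    Finset.sum_singleton, PUnit.default_eq_unit, Finset.sum_sub_distrib]
  ring

namespace IsMetricOn

variable (h : IsMetricOn U G)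
include h

lemma smooth_schouten_up (a c : Fin d) :
    SmoothOn U (fun y => ∑ b, schouten G a b y * (G y)⁻¹ b c) :=
  SmoothOn.sum fun b => (h.smooth_schouten a b).mul (h.smooth_inv b c)

lemma smooth_tractorMat (a : Fin d) : SmoothMatOn U (tractorMat G a) := by
  rintro (⟨⟩ | b | ⟨⟩) (⟨⟩ | c | ⟨⟩)
  · exact SmoothOn.const _
  · exact SmoothOn.const _
  · exact SmoothOn.const _
  · exact h.smooth_schouten a b
  · exact (h.smooth_christoffel c a b).neg
  · exact h.smooth a b
  · exact SmoothOn.const _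
  · exact (h.smooth_schouten_up a c).neg
  · exact SmoothOn.const _

variable {y : Coord d} (hy : y ∈ U)
include hy

/-- Raising an index commutes with $\nabla$, written out with the Christoffel terms of $P_b{}^c$. -/
lemma partialDeriv_schouten_up (f b c : Fin d) :
    partialDeriv f (fun z => ∑ k, schouten G b k z * (G z)⁻¹ k c) y =
      ∑ k, nabla₂ G (schouten G) f b k y * (G y)⁻¹ k c
        + ∑ l, christoffel G l f b y * ∑ k, schouten G l k y * (G y)⁻¹ k c
        - ∑ l, (∑ k, schouten G b k y * (G y)⁻¹ k l) * christoffel G c f l y := by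
  have D := fun {f} (hf : SmoothOn U f) => hf.differentiableAt h.isOpen hy
  have h1 : partialDeriv f (fun z => ∑ k, schouten G b k z * (G z)⁻¹ k c) y =
      ∑ k, (partialDeriv f (schouten G b k) y * (G y)⁻¹ k c
        - schouten G b k y * (∑ e, christoffel G k f e y * (G y)⁻¹ e c
          + ∑ e, christoffel G c f e y * (G y)⁻¹ k e)) := by
    rw [partialDeriv_sum f fun k => D ((h.smooth_schouten b k).mul (h.smooth_inv_apply k c))]
    refine Finset.sum_congr rfl fun k _ => ?_
    rw [partialDeriv_mul f (D (h.smooth_schouten b k)) (D (h.smooth_inv_apply k c)),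
      h.partialDeriv_inv hy]
    ring
  rw [h1]
  simp only [nabla₂, sub_mul, mul_add, Finset.sum_sub_distrib, Finset.sum_add_distrib,
    Finset.mul_sum, Finset.sum_mul]
  have h2 : ∑ k, ∑ l, christoffel G l f b y * schouten G l k y * (G y)⁻¹ k c =
      ∑ l, ∑ k, christoffel G l f b y * (schouten G l k y * (G y)⁻¹ k c) := by
    rw [Finset.sum_comm]
    exact Finset.sum_congr rfl fun k _ => Finset.sum_congr rfl fun l _ => by ring
  have h3 : ∑ k, ∑ l, christoffel G l f k y * schouten G b l y * (G y)⁻¹ k c =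
      ∑ l, ∑ k, schouten G b l y * (christoffel G l f k y * (G y)⁻¹ k c) := by
    rw [Finset.sum_comm]
    exact Finset.sum_congr rfl fun k _ => Finset.sum_congr rfl fun l _ => by ring
  have h4 : ∑ k, ∑ l, schouten G b l y * (G y)⁻¹ l k * christoffel G c f k y =
      ∑ l, ∑ k, schouten G b l y * (christoffel G c f k y * (G y)⁻¹ l k) := by
    rw [Finset.sum_comm]
    exact Finset.sum_congr rfl fun k _ => Finset.sum_congr rfl fun l _ => by ring
  rw [h2, h3, h4]
  ring

/-- The three entries are the skew parts of $P_{ab}$, $\Gamma^e_{ab}$ and $g_{ab}$, all of which are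
symmetric. -/
lemma tractorCurvature_Y (a b : Fin d) (E : TIdx d) :
    connectionCurvature (tractorConn G) a b slotY E y = 0 := by
  rcases E with ⟨⟩ | e | ⟨⟩
  · simp [connectionCurvature_tractorConn, tractorConn_YY, tractorConn_YZ, tractorConn_YX,
    tractorConn_ZY, tractorConn_ZZ,
    tractorConn_ZX, tractorConn_XY, tractorConn_XZ, tractorConn_XX, partialDeriv_const, 
      h.schouten_symm hy a b]
  · simp [connectionCurvature_tractorConn, tractorConn_YY, tractorConn_YZ, tractorConn_YX,
    tractorConn_ZY, tractorConn_ZZ,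
    tractorConn_ZX, tractorConn_XY, tractorConn_XZ, tractorConn_XX, partialDeriv_const, 
      h.christoffel_symm hy e a b]
  · simp [connectionCurvature_tractorConn, tractorConn_YY, tractorConn_YZ, tractorConn_YX,
    tractorConn_ZY, tractorConn_ZZ,
    tractorConn_ZX, tractorConn_XY, tractorConn_XZ, tractorConn_XX, partialDeriv_const, 
      h.symm hy a b]

lemma tractorCurvature_ZY (a b c : Fin d) :
    connectionCurvature (tractorConn G) a b (slotZ c) slotY y = cotton G c a b y := by
  have : ∑ k, christoffel G k a b y * schouten G k c y =
    ∑ k, christoffel G k b a y * schouten G k c y :=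
    Finset.sum_congr rfl fun k _ => by rw [h.christoffel_symm hy]
  simp [connectionCurvature_tractorConn, tractorConn_YY, tractorConn_YZ, tractorConn_YX,
    tractorConn_ZY, tractorConn_ZZ,
    tractorConn_ZX, tractorConn_XY, tractorConn_XZ, tractorConn_XX, cotton_eq, nabla₂]
  rw [this]
  ring

lemma raise_weyl (a b c e : Fin d) : ∑ k, (G y)⁻¹ e k * weyl G a b c k y =
    -riemannUp G a b e c y + (if e = a then schouten G b c y else 0)
      - (if e = b then schouten G a c y else 0)
      + G y c b * ∑ k, schouten G a k y * (G y)⁻¹ k e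
      - G y c a * ∑ k, schouten G b k y * (G y)⁻¹ k e := by
  have h0 : ∀ k, (G y)⁻¹ e k * weyl G a b c k y = -((G y)⁻¹ e k * riemann G a b k c y)
      + (G y)⁻¹ e k * G y k a * schouten G b c y - (G y)⁻¹ e k * G y k b * schouten G a c y
      + G y c b * (schouten G a k y * (G y)⁻¹ k e)
      - G y c a * (schouten G b k y * (G y)⁻¹ k e) := by
    intro k
    rw [h.weyl_swap₃₄ hy, weyl, h.inv_symm hy e k]
    ring
  simp only [h0, Finset.sum_sub_distrib, Finset.sum_add_distrib, Finset.sum_neg_distrib,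
    h.raise_riemann hy, ← Finset.mul_sum, ← Finset.sum_mul, h.sum_inv_mul hy]
  simp

/-- The Christoffel block contributes minus the Riemann tensor, since it acts on covectors; the
products of the $g$ and $P$ entries are the terms turning Riemann into Weyl, as recorded in
`raise_weyl`. -/
lemma tractorCurvature_ZZ (a b c e : Fin d) :
    connectionCurvature (tractorConn G) a b (slotZ c) (slotZ e) y =
      ∑ k, (G y)⁻¹ e k * weyl G a b c k y := by
  have hs : ∀ u v, ∑ k, christoffel G k u c y * christoffel G e v k y =
      ∑ k, christoffel G e v k y * christoffel G k u c y := fun u v =>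
    Finset.sum_congr rfl fun k _ => mul_comm _ _
  have hR : riemannUp G a b e c y =
      partialDeriv a (christoffel G e b c) y - partialDeriv b (christoffel G e a c) y
        + (∑ k, christoffel G e a k y * christoffel G k b c y
          - ∑ k, christoffel G e b k y * christoffel G k a c y) := by
    rw [riemannUp, connectionCurvature, Finset.sum_sub_distrib]
  rw [h.raise_weyl hy, hR]
  simp only [connectionCurvature_tractorConn, tractorConn_YY, tractorConn_YZ, tractorConn_YX,
    tractorConn_ZY, tractorConn_ZZ,
    tractorConn_ZX, tractorConn_XY, tractorConn_XZ, tractorConn_XX, 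
    partialDeriv_neg, Finset.sum_sub_distrib, zero_mul,
    neg_mul_neg]
  rw [hs, hs, h.symm hy c a, h.symm hy c b, h.schouten_symm hy b c, h.schouten_symm hy a c,
    h.symm hy a c, h.symm hy b c]
  simp only [eq_comm (a := e), h.schouten_symm hy c]
  split_ifs <;> ring

/-- This entry is $\nabla_ag_{bc}-\nabla_bg_{ac}$, zero for a metric torsion-free connection. -/
lemma tractorCurvature_ZX (a b c : Fin d) :
    connectionCurvature (tractorConn G) a b (slotZ c) slotX y = 0 := by
  have h1 : ∑ k, christoffel G k a b y * G y k c = ∑ k, christoffel G k b a y * G y k c :=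
    Finset.sum_congr rfl fun k _ => by rw [h.christoffel_symm hy]
  simp [connectionCurvature_tractorConn, tractorConn_YY, tractorConn_YZ, tractorConn_YX,
    tractorConn_ZY, tractorConn_ZZ,
    tractorConn_ZX, tractorConn_XY, tractorConn_XZ, tractorConn_XX, h.partialDeriv_metric hy]
  rw [h1]
  ring

lemma tractorCurvature_XY (a b : Fin d) :
    connectionCurvature (tractorConn G) a b slotX slotY y = 0 := by
  simp only [connectionCurvature_tractorConn, tractorConn_YY, tractorConn_YZ, tractorConn_YX,
    tractorConn_ZY, tractorConn_ZZ,
    tractorConn_ZX, tractorConn_XY, tractorConn_XZ, tractorConn_XX, 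
    partialDeriv_const, Finset.sum_sub_distrib, zero_mul]
  have : ∑ x, (-∑ k, schouten G a k y * (G y)⁻¹ k x) * schouten G b x y =
      ∑ x, (-∑ k, schouten G b k y * (G y)⁻¹ k x) * schouten G a x y := by
    simp only [neg_mul, Finset.sum_mul, Finset.sum_neg_distrib]
    rw [Finset.sum_comm]
    congr 1
    exact Finset.sum_congr rfl fun k _ => Finset.sum_congr rfl fun l _ => by
      rw [h.inv_symm hy]; ring
  rw [this]
  ring

lemma tractorCurvature_XZ (a b c : Fin d) :
    connectionCurvature (tractorConn G) a b slotX (slotZ c) y =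
      -∑ k, (G y)⁻¹ c k * cotton G k a b y := by
  have hc : ∑ k, (G y)⁻¹ c k * cotton G k a b y =
      ∑ k, nabla₂ G (schouten G) a b k y * (G y)⁻¹ k c
      - ∑ k, nabla₂ G (schouten G) b a k y * (G y)⁻¹ k c := by
    rw [← Finset.sum_sub_distrib]
    exact Finset.sum_congr rfl fun k _ => by rw [cotton_eq, h.inv_symm hy c k]; ring
  have hg : ∑ l, christoffel G l a b y * ∑ k, schouten G l k y * (G y)⁻¹ k c =
      ∑ l, christoffel G l b a y * ∑ k, schouten G l k y * (G y)⁻¹ k c :=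
    Finset.sum_congr rfl fun k _ => by rw [h.christoffel_symm hy]
  simp only [connectionCurvature_tractorConn, tractorConn_YY, tractorConn_YZ, tractorConn_YX,
    tractorConn_ZY, tractorConn_ZZ,
    tractorConn_ZX, tractorConn_XY, tractorConn_XZ, tractorConn_XX, 
    partialDeriv_neg, Finset.sum_sub_distrib, zero_mul,
    neg_mul_neg, h.partialDeriv_schouten_up hy]
  rw [hc, hg]
  ring

lemma tractorCurvature_XX (a b : Fin d) :
    connectionCurvature (tractorConn G) a b slotX slotX y = 0 := by
  simp only [connectionCurvature_tractorConn, tractorConn_YY, tractorConn_YZ, tractorConn_YX,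
    tractorConn_ZY, tractorConn_ZZ,
    tractorConn_ZX, tractorConn_XY, tractorConn_XZ, tractorConn_XX, 
    partialDeriv_const, zero_mul]
  have : ∀ a b, ∑ x, (-∑ k, schouten G a k y * (G y)⁻¹ k x) * G y b x = -schouten G a b y := by
    intro a b
    have : ∀ x, (-∑ k, schouten G a k y * (G y)⁻¹ k x) * G y b x =
        -∑ k, (G y)⁻¹ k x * (G y x b * schouten G a k y) := by
      intro x
      rw [neg_mul, Finset.sum_mul]
      congr 1
      exact Finset.sum_congr rfl fun k _ => by rw [h.symm hy b x]; ring
    rw [Finset.sum_congr rfl fun x _ => this x, Finset.sum_neg_distrib, Finset.sum_comm,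
      h.trace_left hy b]
  rw [this a b, this b a, h.schouten_symm hy a b]
  ring

end IsMetricOn

end TractorCurvature

/-! ### Identities satisfied by a parallel tractor. -/

section Parallel

variable {d : ℕ} {U : Set (Coord d)} {G : LocalMetric d} {I : TIdx d → Coord d → ℝ}

/-- A smooth parallel standard tractor on an open set of coordinate space. -/
structure IsParallelOn (U : Set (Coord d)) (G : LocalMetric d) (I : TIdx d → Coord d → ℝ) :
    Prop where
  smooth : ∀ A, SmoothOn U (I A)
  parallel : ∀ y ∈ U, ∀ a A, partialDeriv a (I A) y + ∑ B, tractorConn G a A B y * I B y = 0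

/-- The vector field `μ^a = g^{ab} μ_b`, where `μ_b` is the middle slot of a tractor. -/
def raisedMid (G : LocalMetric d) (I : TIdx d → Coord d → ℝ) (a : Fin d) (y : Coord d) : ℝ :=
  ∑ b, (G y)⁻¹ a b * I (slotZ b) y

namespace IsParallelOn

variable (hI : IsParallelOn U G I) {y : Coord d}
include hI

lemma partialDeriv_top (hy : y ∈ U) (a : Fin d) :
    partialDeriv a (I slotY) y = I (slotZ a) y := by
  have := hI.parallel y hy a slotY
  simp only [Fintype.sum_sum_type, Finset.univ_unique, Finset.sum_singleton,
    tractorConn_YY, tractorConn_YZ, tractorConn_YX, PUnit.default_eq_unit, zero_mul,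
    ite_mul, Finset.sum_ite_eq, Finset.mem_univ, if_true] at this
  linarith

lemma partialDeriv_mid (hy : y ∈ U) (a b : Fin d) :
    partialDeriv a (I (slotZ b)) y = ∑ k, christoffel G k a b y * I (slotZ k) y
      - G y a b * I slotX y - schouten G a b y * I slotY y := by
  have := hI.parallel y hy a (slotZ b)
  simp only [Fintype.sum_sum_type, Finset.univ_unique, Finset.sum_singleton,
    tractorConn_ZY, tractorConn_ZZ, tractorConn_ZX, PUnit.default_eq_unit, neg_mul,
    Finset.sum_neg_distrib] at this
  linarith

variable (h : IsMetricOn U G)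
include h

lemma smooth_raisedMid (a : Fin d) : SmoothOn U (raisedMid G I a) := by
  unfold raisedMid
  exact SmoothOn.sum fun b => (h.smooth_inv a b).mul (hI.smooth _)

variable (hy : y ∈ U)
include hy

lemma curvature_apply (a b : Fin d) (C : TIdx d) :
    ∑ E, connectionCurvature (tractorConn G) a b C E y * I E y = 0 := by
  have hpar : ∀ z ∈ U, ∀ a, matDeriv a (fun y => Matrix.of fun A (_ : Unit) => I A y) z =
      -(tractorMat G a z * Matrix.of fun A (_ : Unit) => I A z) := by
    intro z hz a
    ext A _
    have := hI.parallel z hz a A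
    simp only [matDeriv, Matrix.of_apply, Matrix.neg_apply, Matrix.mul_apply, tractorMat]
    linarith
  have := matCurvature_mul_parallel h.isOpen hy h.smooth_tractorMat
    (I := fun y => Matrix.of fun A (_ : Unit) => I A y) (fun A _ => hI.smooth A) hpar a b
  have := congrFun (congrFun this C) ()
  rw [Matrix.mul_apply] at this
  simp only [Matrix.of_apply, Matrix.zero_apply] at this
  rw [← this]
  exact Finset.sum_congr rfl fun E _ => by
    rw [← matCurvature_apply]; rfl

/-- The middle slot of $\Omega_{ab}I=0$. -/
lemma cotton_add_weyl (a b c : Fin d) :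
    I slotY y * cotton G c a b y + ∑ e, raisedMid G I e y * weyl G a b c e y = 0 := by
  have h1 := hI.curvature_apply h hy a b (slotZ c)
  simp only [Fintype.sum_sum_type, Finset.univ_unique, Finset.sum_singleton,
    PUnit.default_eq_unit, h.tractorCurvature_ZY hy, h.tractorCurvature_ZZ hy,
    h.tractorCurvature_ZX hy, zero_mul, add_zero] at h1
  rw [mul_comm, ← h1]
  congr 1
  simp only [raisedMid, Finset.sum_mul]
  rw [Finset.sum_comm]
  exact Finset.sum_congr rfl fun k _ => Finset.sum_congr rfl fun e _ => by
    rw [h.inv_symm hy]; ring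

/-- The bottom slot of $\Omega_{ab}I=0$. -/
lemma raisedMid_cotton (a b : Fin d) : ∑ c, raisedMid G I c y * cotton G c a b y = 0 := by
  have h1 := hI.curvature_apply h hy a b slotX
  simp only [Fintype.sum_sum_type, Finset.univ_unique, Finset.sum_singleton,
    PUnit.default_eq_unit, h.tractorCurvature_XY hy, h.tractorCurvature_XZ hy,
    h.tractorCurvature_XX hy, zero_mul, add_zero, zero_add, neg_mul, Finset.sum_neg_distrib,
    neg_eq_zero] at h1
  rw [← h1]
  simp only [raisedMid, Finset.sum_mul]
  rw [Finset.sum_comm]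
  exact Finset.sum_congr rfl fun k _ => Finset.sum_congr rfl fun e _ => by
    rw [h.inv_symm hy]; ring

/-- The middle slot of $\nabla I=0$ with its index raised. At a zero of $\sigma$ it says that
$\nabla\mu$ is $-\rho$ times the identity. -/
lemma nabla_raisedMid (f e : Fin d) :
    partialDeriv f (raisedMid G I e) y + ∑ k, christoffel G e f k y * raisedMid G I k y =
      -(if e = f then I slotX y else 0)
        - I slotY y * ∑ b, (G y)⁻¹ e b * schouten G f b y := by
  have D := fun {f} (hf : SmoothOn U f) => hf.differentiableAt h.isOpen hy
  have h1 : partialDeriv f (raisedMid G I e) y =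
      ∑ b, (partialDeriv f (fun z => (G z)⁻¹ e b) y * I (slotZ b) y
        + (G y)⁻¹ e b * partialDeriv f (I (slotZ b)) y) := by
    unfold raisedMid
    rw [partialDeriv_sum f fun b => D ((h.smooth_inv_apply e b).mul (hI.smooth _))]
    exact Finset.sum_congr rfl fun b _ => partialDeriv_mul f (D (h.smooth_inv_apply e b))
      (D (hI.smooth _))
  have h2 : ∑ b, (G y)⁻¹ e b * (G y f b * I slotX y) = if e = f then I slotX y else 0 := by
    have : ∀ b, (G y)⁻¹ e b * (G y f b * I slotX y) = (G y)⁻¹ e b * G y b f * I slotX y := by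
      intro b
      rw [h.symm hy f b]; ring
    rw [Finset.sum_congr rfl fun b _ => this b, ← Finset.sum_mul, h.sum_inv_mul hy]
    simp
  have h3 : ∑ b, (G y)⁻¹ e b * (schouten G f b y * I slotY y) =
      I slotY y * ∑ b, (G y)⁻¹ e b * schouten G f b y := by
    rw [Finset.mul_sum]
    exact Finset.sum_congr rfl fun b _ => by ring
  rw [h1]
  simp only [hI.partialDeriv_mid hy, h.partialDeriv_inv hy, Finset.sum_add_distrib, mul_sub,
    Finset.sum_sub_distrib]
  rw [h2, h3]
  have h4 : ∑ k, christoffel G e f k y * raisedMid G I k y =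
      ∑ b, (∑ k, christoffel G e f k y * (G y)⁻¹ k b) * I (slotZ b) y := by
    simp only [raisedMid, Finset.mul_sum, Finset.sum_mul]
    rw [Finset.sum_comm]
    simp only [mul_assoc]
  have h5 : ∑ b, (G y)⁻¹ e b * ∑ k, christoffel G k f b y * I (slotZ k) y =
      ∑ b, (∑ k, christoffel G b f k y * (G y)⁻¹ e k) * I (slotZ b) y := by
    simp only [Finset.mul_sum, Finset.sum_mul]
    rw [Finset.sum_comm]
    exact Finset.sum_congr rfl fun k _ => Finset.sum_congr rfl fun e _ => by ring
  rw [h4, h5]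
  simp only [neg_mul, add_mul, Finset.sum_neg_distrib, Finset.sum_add_distrib]
  ring

lemma nabla_cotton_add_weyl (f a b c : Fin d) :
    I (slotZ f) y * cotton G c a b y + I slotY y * nabla₃ G (cotton G) f c a b y
      + ∑ e, (partialDeriv f (raisedMid G I e) y
          + ∑ k, christoffel G e f k y * raisedMid G I k y) * weyl G a b c e y
      + ∑ e, raisedMid G I e y * nabla₄ G (weyl G) f a b c e y = 0 := by
  have D := fun {f} (hf : SmoothOn U f) => hf.differentiableAt h.isOpen hy
  have hu := hI.smooth_raisedMid h
  have h0 : partialDeriv f (fun z => I slotY z * cotton G c a b z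
      + ∑ e, raisedMid G I e z * weyl G a b c e z) y = 0 :=
    partialDeriv_eq_zero f h.isOpen hy fun z hz => hI.cotton_add_weyl h hz a b c
  have hs : ∀ e, SmoothOn U (fun z => raisedMid G I e z * weyl G a b c e z) :=
    fun e => (hu e).mul (h.smooth_weyl a b c e)
  rw [partialDeriv_add f (D ((hI.smooth slotY).mul (h.smooth_cotton c a b)))
      (D (SmoothOn.sum hs)), partialDeriv_sum f fun e => D (hs e),
    partialDeriv_mul f (D (hI.smooth slotY)) (D (h.smooth_cotton c a b)),
    hI.partialDeriv_top hy, Finset.sum_congr rfl fun e _ => partialDeriv_mul f (D (hu e))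
      (D (h.smooth_weyl a b c e)), Finset.sum_add_distrib] at h0
  have hc := hI.cotton_add_weyl h hy
  -- The Christoffel terms of the free indices $c,a,b$ are combinations of the undifferentiated
  -- identity.
  have h1 : ∑ k, christoffel G k f c y * (I slotY y * cotton G k a b y
      + ∑ e, raisedMid G I e y * weyl G a b k e y) = 0 := by simp only [hc, mul_zero,
        Finset.sum_const_zero]
  have h2 : ∑ k, christoffel G k f a y * (I slotY y * cotton G c k b y
      + ∑ e, raisedMid G I e y * weyl G k b c e y) = 0 := by simp only [hc, mul_zero,
        Finset.sum_const_zero]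
  have h3 : ∑ k, christoffel G k f b y * (I slotY y * cotton G c a k y
      + ∑ e, raisedMid G I e y * weyl G a k c e y) = 0 := by simp only [hc, mul_zero,
        Finset.sum_const_zero]
  -- The Christoffel terms of the contracted index $e$ cancel between $\mu^e$ and Weyl.
  have h4 : ∑ e, (∑ k, christoffel G e f k y * raisedMid G I k y) * weyl G a b c e y =
      ∑ e, raisedMid G I e y * ∑ k, christoffel G k f e y * weyl G a b c k y := by
    simp only [Finset.mul_sum, Finset.sum_mul]
    rw [Finset.sum_comm]
    exact Finset.sum_congr rfl fun k _ => Finset.sum_congr rfl fun e _ => by ring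
  have h5 : ∀ (v : Fin d) (S : Fin d → Fin d → ℝ), ∑ k, christoffel G k f v y *
      ∑ e, raisedMid G I e y * S k e = ∑ e, raisedMid G I e y *
        ∑ k, christoffel G k f v y * S k e := by
    intro v S
    simp only [Finset.mul_sum]
    rw [Finset.sum_comm]
    exact Finset.sum_congr rfl fun k _ => Finset.sum_congr rfl fun e _ => by ring
  have h6 : ∀ (v : Fin d) (S : Fin d → ℝ), ∑ k, christoffel G k f v y * (I slotY y * S k) =
      I slotY y * ∑ k, christoffel G k f v y * S k := by
    intro v S
    rw [Finset.mul_sum]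
    exact Finset.sum_congr rfl fun k _ => by ring
  simp only [mul_add, Finset.sum_add_distrib, h5, h6] at h1 h2 h3
  simp only [nabla₃, nabla₄, add_mul, mul_sub, Finset.sum_add_distrib, Finset.sum_sub_distrib]
  rw [h4]
  linarith

end IsParallelOn

namespace IsMetricOn

variable (h : IsMetricOn U G) {y : Coord d} (hy : y ∈ U)
include h hy

lemma nabla₄_weyl_pair (f a b c e : Fin d) :
    nabla₄ G (weyl G) f a b c e y = nabla₄ G (weyl G) f c e a b y := by
  have h1 : partialDeriv f (weyl G a b c e) y = partialDeriv f (weyl G c e a b) y :=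
    partialDeriv_congr f h.isOpen hy fun z hz => h.weyl_pair hz a b c e
  have h2 : ∀ k, weyl G k b c e y = weyl G c e k b y := fun k => h.weyl_pair hy _ _ _ _
  have h3 : ∀ k, weyl G a k c e y = weyl G c e a k y := fun k => h.weyl_pair hy _ _ _ _
  have h4 : ∀ k, weyl G a b k e y = weyl G k e a b y := fun k => h.weyl_pair hy _ _ _ _
  have h5 : ∀ k, weyl G a b c k y = weyl G c k a b y := fun k => h.weyl_pair hy _ _ _ _
  simp only [nabla₄, h1, h2, h3, h4, h5]
  ring

end IsMetricOn

namespace IsParallelOn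

variable (hI : IsParallelOn U G I) {y : Coord d} (h : IsMetricOn U G) (hy : y ∈ U)
include hI h hy

/-- Contract the cyclic identity of Cotton with $\mu$; one of the three terms vanishes by
`raisedMid_cotton`. -/
lemma raisedMid_cotton_symm (a c : Fin d) : ∑ e, raisedMid G I e y * cotton G c a e y =
    ∑ e, raisedMid G I e y * cotton G a c e y := by
  have h1 : ∑ e, raisedMid G I e y *
      (cotton G c a e y + cotton G a e c y + cotton G e c a y) = 0 := by
    simp only [h.cotton_cyclic hy, mul_zero, Finset.sum_const_zero]
  simp only [mul_add, Finset.sum_add_distrib, hI.raisedMid_cotton h hy,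
    cotton_swap G a _ c, mul_neg, Finset.sum_neg_distrib] at h1
  linarith

/-- The divergence of `cotton_add_weyl`. The derivative of $\sigma$ contributes $-1$ and the
divergence of Weyl $d-3$ copies of $\mu^eA_{cae}$, whence $d-4$; the $\sigma P$ part of $\nabla\mu$
supplies the term $P^{ec}C_{eacb}$ of Bach. -/
lemma bach_add_cotton (hd : 3 ≤ d) (a c : Fin d) :
    I slotY y * bach G a c y
      + ((d : ℝ) - 4) * ∑ e, raisedMid G I e y * cotton G c a e y = 0 := by
  rw [hI.raisedMid_cotton_symm h hy]
  -- Frees the letter $a$ for the form index of `nabla_cotton_add_weyl` that is contracted with the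
  -- derivative index $f$.
  rename' a => c, c => b
  have h0 : ∑ f, ∑ a, (G y)⁻¹ f a * (I (slotZ f) y * cotton G c a b y
      + I slotY y * nabla₃ G (cotton G) f c a b y
      + ∑ e, (partialDeriv f (raisedMid G I e) y
          + ∑ k, christoffel G e f k y * raisedMid G I k y) * weyl G a b c e y
      + ∑ e, raisedMid G I e y * nabla₄ G (weyl G) f a b c e y) = 0 := by
    simp only [hI.nabla_cotton_add_weyl h hy, mul_zero, Finset.sum_const_zero]
  have h1 : ∑ f, ∑ a, (G y)⁻¹ f a * (I (slotZ f) y * cotton G c a b y) =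
      -∑ e, raisedMid G I e y * cotton G c b e y := by
    rw [Finset.sum_comm, ← Finset.sum_neg_distrib]
    refine Finset.sum_congr rfl fun a _ => ?_
    rw [raisedMid, Finset.sum_mul, ← Finset.sum_neg_distrib]
    refine Finset.sum_congr rfl fun f _ => ?_
    rw [h.inv_symm hy, cotton_swap]
    ring
  have h2 : ∑ f, ∑ a, (G y)⁻¹ f a * (I slotY y * nabla₃ G (cotton G) f c a b y) =
      I slotY y * ∑ a, ∑ f, (G y)⁻¹ a f * nabla₃ G (cotton G) f c a b y := by
    simp only [Finset.mul_sum]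
    rw [Finset.sum_comm]
    exact Finset.sum_congr rfl fun a _ => Finset.sum_congr rfl fun f _ => by
      rw [h.inv_symm hy]; ring
  have h3 : ∑ f, ∑ a, (G y)⁻¹ f a * ∑ e, (partialDeriv f (raisedMid G I e) y
          + ∑ k, christoffel G e f k y * raisedMid G I k y) * weyl G a b c e y =
      I slotY y * ∑ a, ∑ e, (∑ p, ∑ q, (G y)⁻¹ e p * (G y)⁻¹ a q * schouten G p q y)
        * weyl G e c a b y := by
    have e1 : ∀ f a, ∑ e, (partialDeriv f (raisedMid G I e) y
        + ∑ k, christoffel G e f k y * raisedMid G I k y) * weyl G a b c e y =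
        -(I slotX y * weyl G a b c f y)
        + I slotY y * ∑ e, (∑ p, (G y)⁻¹ e p * schouten G f p y) * weyl G e c a b y := by
      intro f a
      have e2 : ∀ e, weyl G e c a b y = -weyl G a b c e y := fun e => by
        rw [h.weyl_pair hy, h.weyl_swap₃₄ hy]
      simp only [hI.nabla_raisedMid h hy, sub_mul, Finset.sum_sub_distrib, neg_mul, ite_mul,
        zero_mul, Finset.sum_neg_distrib, Finset.sum_ite_eq', Finset.mem_univ, if_true, e2,
        mul_neg, mul_assoc, ← Finset.mul_sum]
      ring
    -- The $\rho$ part of $\nabla\mu$ meets a trace of Weyl.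
    have e3 : ∑ f, ∑ a, (G y)⁻¹ f a * (I slotX y * weyl G a b c f y) = 0 := by
      have : I slotX y * ∑ a, ∑ f, (G y)⁻¹ a f * weyl G a b f c y = 0 := by
        rw [h.trace_weyl hy hd, mul_zero]
      rw [← neg_eq_zero, ← this, Finset.sum_comm]
      simp only [Finset.mul_sum, ← Finset.sum_neg_distrib]
      exact Finset.sum_congr rfl fun a _ => Finset.sum_congr rfl fun f _ => by
        rw [h.inv_symm hy, h.weyl_swap₃₄ hy]; ring
    simp only [e1, mul_add, mul_neg, Finset.sum_add_distrib, Finset.sum_neg_distrib, e3]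
    rw [neg_zero, zero_add, Finset.sum_comm, Finset.mul_sum]
    refine Finset.sum_congr rfl fun a _ => ?_
    simp only [Finset.mul_sum, Finset.sum_mul]
    rw [Finset.sum_comm]
    refine Finset.sum_congr rfl fun e _ => ?_
    rw [Finset.sum_comm]
    refine Finset.sum_congr rfl fun p _ => Finset.sum_congr rfl fun q _ => ?_
    rw [h.inv_symm hy q a, h.schouten_symm hy q p]
    ring
  have h4 : ∑ f, ∑ a, (G y)⁻¹ f a * ∑ e, raisedMid G I e y * nabla₄ G (weyl G) f a b c e y =
      ((d : ℝ) - 3) * ∑ e, raisedMid G I e y * cotton G c b e y := by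
    rw [hI.raisedMid_cotton_symm h hy]
    have e1 : ∑ f, ∑ a, (G y)⁻¹ f a * ∑ e, raisedMid G I e y * nabla₄ G (weyl G) f a b c e y =
        ∑ e, raisedMid G I e y * ∑ f, ∑ a, (G y)⁻¹ f a * nabla₄ G (weyl G) f c e a b y := by
      simp only [Finset.mul_sum]
      rw [sum_rotate₂₃, Finset.sum_comm]
      exact Finset.sum_congr rfl fun e _ => Finset.sum_congr rfl fun f _ =>
        Finset.sum_congr rfl fun a _ => by rw [h.nabla₄_weyl_pair hy f a b c e]; ring
    rw [e1]
    simp only [h.divergence_weyl hy hd, Finset.mul_sum]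
    exact Finset.sum_congr rfl fun e _ => by ring
  simp only [mul_add, Finset.sum_add_distrib] at h0 h1 h2 h3 h4
  rw [h1, h2, h3, h4] at h0
  rw [bach_eq]
  linarith

/-- Contracting `bach_add_cotton` with $\mu^a$ leaves $\mu^a\mu^eA_{bae}$, which is zero by
skewness. The factor $\sigma$ is removed later, by continuity. -/
lemma raisedMid_bach_mul (hd : 3 ≤ d) (b : Fin d) :
    I slotY y * ∑ a, raisedMid G I a y * bach G a b y = 0 := by
  have h1 : ∑ a, raisedMid G I a y * (I slotY y * bach G a b y
      + ((d : ℝ) - 4) * ∑ e, raisedMid G I e y * cotton G b a e y) = 0 := by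
    simp only [hI.bach_add_cotton h hy hd, mul_zero, Finset.sum_const_zero]
  have h2 : ∑ a, ∑ e, raisedMid G I a y * (raisedMid G I e y * cotton G b a e y) = 0 := by
    have : ∑ a, ∑ e, raisedMid G I a y * (raisedMid G I e y * cotton G b a e y) =
        -∑ a, ∑ e, raisedMid G I a y * (raisedMid G I e y * cotton G b a e y) := by
      conv_lhs => rw [Finset.sum_comm]
      simp only [← Finset.sum_neg_distrib]
      exact Finset.sum_congr rfl fun a _ => Finset.sum_congr rfl fun e _ => by
        rw [cotton_swap]; ring
    linarith
  have h3 : ∑ a, raisedMid G I a y * (((d : ℝ) - 4) *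
      ∑ e, raisedMid G I e y * cotton G b a e y) = 0 := by
    rw [← mul_zero ((d : ℝ) - 4), ← h2, Finset.mul_sum]
    exact Finset.sum_congr rfl fun a _ => by rw [← Finset.mul_sum]; ring
  simp only [mul_add, Finset.sum_add_distrib] at h1
  rw [h3, add_zero] at h1
  rw [← h1, Finset.mul_sum]
  exact Finset.sum_congr rfl fun a _ => by ring

/-- A continuous function that vanishes wherever `σ ≠ 0` vanishes identically. -/
lemma eq_zero_of_mul_top (hd : 3 ≤ d) (hne : ∀ z ∈ U, ∃ A, I A z ≠ 0) {f : Coord d → ℝ}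
    (hf : ContinuousOn f U) (h0 : ∀ z ∈ U, I slotY z * f z = 0) : f y = 0 := by
  -- If $f(y)\ne0$, then $\sigma$ vanishes on the open set where $f\ne0$; there $\mu=d\sigma=0$, and
  -- the middle slot of $\nabla I=0$ leaves $g_{aa}\rho=0$, contradicting $I\ne0$.
  by_contra hfy
  have hV : IsOpen (U ∩ f ⁻¹' {0}ᶜ) := hf.isOpen_inter_preimage h.isOpen isOpen_compl_singleton
  set V := U ∩ f ⁻¹' {0}ᶜ
  have hyV : y ∈ V := ⟨hy, hfy⟩
  have hσ : ∀ z ∈ V, I slotY z = 0 := fun z hz => (mul_eq_zero.1 (h0 z hz.1)).resolve_right hz.2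
  have hμ : ∀ z ∈ V, ∀ a, I (slotZ a) z = 0 := fun z hz a => by
    rw [← hI.partialDeriv_top hz.1]
    exact partialDeriv_eq_zero a hV hz hσ
  have a : Fin d := ⟨0, by omega⟩
  have h1 := hI.partialDeriv_mid hy a a
  rw [partialDeriv_eq_zero a hV hyV fun z hz => hμ z hz a, hσ y hyV] at h1
  simp only [hμ y hyV, mul_zero, Finset.sum_const_zero, zero_sub, sub_zero] at h1
  have hρ : I slotX y = 0 := by
    have := (h.posDef y hy).diag_pos (i := a)
    rcases mul_eq_zero.1 (neg_eq_zero.1 h1.symm) with h2 | h2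
    · exact absurd h2 this.ne'
    · exact h2
  obtain ⟨A, hA⟩ := hne y hy
  rcases A with ⟨⟩ | a | ⟨⟩
  · exact hA (hσ y hyV)
  · exact hA (hμ y hyV a)
  · exact hA hρ

end IsParallelOn

end Parallel

/-! ### Tractor curvature as a linear expression in Weyl and Cotton. -/

section TractorCurvatureEntries

variable {d : ℕ} {U : Set (Coord d)} {G : LocalMetric d}

lemma tractorCurv_swap (G : LocalMetric d) (a b : Fin d) (C E : TIdx d) (y : Coord d) :
    tractorCurv G a b C E y = -tractorCurv G b a C E y := by
  simp only [tractorCurv, ← matCurvature_apply, ← Finset.sum_neg_distrib]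
  refine Finset.sum_congr rfl fun D _ => ?_
  rw [matCurvature_antisymm, Matrix.neg_apply]
  ring

lemma tractorCurvT_swap (G : LocalMetric d) (B C E F : TIdx d) (y : Coord d) :
    tractorCurvT G B C E F y = -tractorCurvT G C B E F y := by
  simp only [tractorCurvT]
  rw [Finset.sum_comm]
  simp only [← Finset.sum_neg_distrib]
  exact Finset.sum_congr rfl fun b _ => Finset.sum_congr rfl fun c _ => by
    rw [tractorCurv_swap]; ring

section Entries

variable (G) (a b : Fin d) (u v : Unit) (y : Coord d)

lemma tractorMetric_YY : tractorMetric G (Sum.inl u) (Sum.inl v) y = 0 := rfl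

lemma tractorMetric_YZ : tractorMetric G (Sum.inl u) (Sum.inr (Sum.inl b)) y = 0 := rfl

lemma tractorMetric_YX : tractorMetric G (Sum.inl u) (Sum.inr (Sum.inr v)) y = 1 := rfl

lemma tractorMetric_ZY : tractorMetric G (Sum.inr (Sum.inl a)) (Sum.inl v) y = 0 := rfl

lemma tractorMetric_ZZ : tractorMetric G (Sum.inr (Sum.inl a)) (Sum.inr (Sum.inl b)) y =
    (G y)⁻¹ a b := rfl

lemma tractorMetric_ZX : tractorMetric G (Sum.inr (Sum.inl a)) (Sum.inr (Sum.inr v)) y = 0 := rfl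

lemma tractorMetric_XY : tractorMetric G (Sum.inr (Sum.inr u)) (Sum.inl v) y = 1 := rfl

lemma tractorMetric_XZ : tractorMetric G (Sum.inr (Sum.inr u)) (Sum.inr (Sum.inl b)) y = 0 := rfl

lemma tractorMetric_XX : tractorMetric G (Sum.inr (Sum.inr u)) (Sum.inr (Sum.inr v)) y = 0 := rfl

lemma tractorMetricInv_YY : tractorMetricInv G (Sum.inl u) (Sum.inl v) y = 0 := rfl

lemma tractorMetricInv_YZ : tractorMetricInv G (Sum.inl u) (Sum.inr (Sum.inl b)) y = 0 := rfl

lemma tractorMetricInv_YX : tractorMetricInv G (Sum.inl u) (Sum.inr (Sum.inr v)) y = 1 := rfl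

lemma tractorMetricInv_ZY : tractorMetricInv G (Sum.inr (Sum.inl a)) (Sum.inl v) y = 0 := rfl

lemma tractorMetricInv_ZZ : tractorMetricInv G (Sum.inr (Sum.inl a)) (Sum.inr (Sum.inl b)) y =
    G y a b := rfl

lemma tractorMetricInv_ZX :
    tractorMetricInv G (Sum.inr (Sum.inl a)) (Sum.inr (Sum.inr v)) y = 0 := rfl

lemma tractorMetricInv_XY : tractorMetricInv G (Sum.inr (Sum.inr u)) (Sum.inl v) y = 1 := rfl

lemma tractorMetricInv_XZ :
    tractorMetricInv G (Sum.inr (Sum.inr u)) (Sum.inr (Sum.inl b)) y = 0 := rfl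

lemma tractorMetricInv_XX :
    tractorMetricInv G (Sum.inr (Sum.inr u)) (Sum.inr (Sum.inr v)) y = 0 := rfl

end Entries

namespace IsMetricOn

variable (h : IsMetricOn U G)
include h

lemma smooth_tractorMetric (A B : TIdx d) : SmoothOn U (tractorMetric G A B) := by
  rcases A with ⟨⟩ | a | ⟨⟩ <;> rcases B with ⟨⟩ | b | ⟨⟩
  · exact SmoothOn.const _
  · exact SmoothOn.const _
  · exact SmoothOn.const _
  · exact SmoothOn.const _
  · exact h.smooth_inv a b
  · exact SmoothOn.const _
  · exact SmoothOn.const _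
  · exact SmoothOn.const _
  · exact SmoothOn.const _

lemma smooth_tractorCurv (a b : Fin d) (C E : TIdx d) : SmoothOn U (tractorCurv G a b C E) := by
  unfold tractorCurv
  refine SmoothOn.sum fun D => (h.smooth_tractorMetric C D).mul ?_
  refine (SmoothMatOn.matCurvature h.isOpen h.smooth_tractorMat a b D E).congr fun z _ => ?_
  rw [← matCurvature_apply]
  rfl

lemma smooth_tractorCurvT (B C E F : TIdx d) : SmoothOn U (tractorCurvT G B C E F) := by
  unfold tractorCurvT
  exact SmoothOn.sum fun b => SmoothOn.sum fun c =>
    ((h.smooth_tractorMetric B (slotZ b)).mul (h.smooth_tractorMetric C (slotZ c))).mul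
      (h.smooth_tractorCurv b c E F)

lemma smooth_skewXCurv (i : Fin 0 → Fin d) (A : Fin 5 → TIdx d) :
    SmoothOn U (skewXCurv G i A) := by
  have hs : ∀ A B C E F, SmoothOn U (fun y => projX G A y * tractorCurvT G B C E F y) :=
    fun A B C E F => (h.smooth_tractorMetric A slotX).mul (h.smooth_tractorCurvT B C E F)
  unfold skewXCurv
  exact (SmoothOn.const _).mul ((((((hs _ _ _ _ _).add (hs _ _ _ _ _)).add (hs _ _ _ _ _)).sub
    (hs _ _ _ _ _)).sub (hs _ _ _ _ _)).sub (hs _ _ _ _ _))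

/-- The tractor curvature is linear in the Weyl and the Cotton tensor. -/
lemma tractorCurv_decomposition (C E : TIdx d) :
    ∃ (p : Fin d → Coord d → ℝ) (q : Fin d → Fin d → Coord d → ℝ),
      (∀ k, SmoothOn U (p k)) ∧ (∀ k l, SmoothOn U (q k l)) ∧ ∀ y ∈ U, ∀ a b,
        tractorCurv G a b C E y = ∑ k, p k y * cotton G k a b y
          + ∑ k, ∑ l, q k l y * weyl G a b k l y := by
  have key : ∀ y a b, tractorCurv G a b C E y =
      tractorMetric G C slotY y * connectionCurvature (tractorConn G) a b slotY E y
      + ∑ k, tractorMetric G C (slotZ k) y * connectionCurvature (tractorConn G) a b (slotZ k) E y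
      + tractorMetric G C slotX y * connectionCurvature (tractorConn G) a b slotX E y := by
    intro y a b
    simp only [tractorCurv, Fintype.sum_sum_type, Finset.univ_unique, Finset.sum_singleton,
      PUnit.default_eq_unit]
    ring
  rcases C with ⟨⟩ | c | ⟨⟩ <;> rcases E with ⟨⟩ | e | ⟨⟩
  -- With both tractor indices lowered, only three pairs of slots carry curvature: $YZ$ and $ZY$
  -- hold Cotton with opposite signs, $ZZ$ holds Weyl.
  case inl.inr.inl =>
    refine ⟨fun k y => -(G y)⁻¹ e k, fun _ _ _ => 0, fun k => (h.smooth_inv e k).neg,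
      fun _ _ => SmoothOn.const _, fun y hy a b => ?_⟩
    rw [key]
    simp [tractorMetric_YY, tractorMetric_YZ, tractorMetric_YX, h.tractorCurvature_XZ hy]
  case inr.inl.inl =>
    refine ⟨fun k y => (G y)⁻¹ c k, fun _ _ _ => 0, fun k => h.smooth_inv c k,
      fun _ _ => SmoothOn.const _, fun y hy a b => ?_⟩
    rw [key]
    simp [tractorMetric_ZY, tractorMetric_ZZ, tractorMetric_ZX, h.tractorCurvature_ZY hy]
  case inr.inl.inr.inl =>
    refine ⟨fun _ _ => 0, fun k l y => (G y)⁻¹ c k * (G y)⁻¹ e l, fun _ => SmoothOn.const _,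
      fun k l => (h.smooth_inv c k).mul (h.smooth_inv e l), fun y hy a b => ?_⟩
    rw [key]
    simp [tractorMetric_ZY, tractorMetric_ZZ, tractorMetric_ZX, h.tractorCurvature_ZZ hy,
      Finset.mul_sum, mul_assoc]
  all_goals
    refine ⟨fun _ _ => 0, fun _ _ _ => 0, fun k => SmoothOn.const _,
      fun _ _ => SmoothOn.const _, fun y hy a b => ?_⟩
    rw [key]
    simp [tractorMetric_YY, tractorMetric_YZ, tractorMetric_YX, tractorMetric_ZY,
      tractorMetric_ZZ, tractorMetric_ZX, tractorMetric_XY, tractorMetric_XZ, tractorMetric_XX,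
      h.tractorCurvature_XY hy, h.tractorCurvature_XX hy, h.tractorCurvature_ZX hy,
      h.tractorCurvature_Y hy]

variable {y : Coord d} (hy : y ∈ U)
include hy

lemma partialDeriv_mul_of_eq_zero {f g : Coord d → ℝ} (hf : SmoothOn U f) (hg : SmoothOn U g)
    (h0 : g y = 0) (i : Fin d) :
    partialDeriv i (fun z => f z * g z) y = f y * partialDeriv i g y := by
  rw [partialDeriv_mul i (hf.differentiableAt h.isOpen hy) (hg.differentiableAt h.isOpen hy), h0]
  ring

lemma sum_mul_tractorCurv_eq_zero {n : Fin d → ℝ} (b : Fin d)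
    (hC : ∀ c e, ∑ a, n a * weyl G a b c e y = 0) (hA : ∀ c, ∑ a, n a * cotton G c a b y = 0)
    (C E : TIdx d) : ∑ a, n a * tractorCurv G a b C E y = 0 := by
  obtain ⟨p, q, -, -, hpq⟩ := h.tractorCurv_decomposition C E
  have h1 : ∑ a, n a * ∑ k, p k y * cotton G k a b y = 0 := by
    have : ∑ k, p k y * ∑ a, n a * cotton G k a b y = 0 := by simp [hA]
    rw [← this]
    simp only [Finset.mul_sum]
    rw [Finset.sum_comm]
    simp only [mul_left_comm]
  have h2 : ∑ a, n a * ∑ k, ∑ l, q k l y * weyl G a b k l y = 0 := by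
    have : ∑ k, ∑ l, q k l y * ∑ a, n a * weyl G a b k l y = 0 := by simp [hC]
    rw [← this]
    simp only [Finset.mul_sum]
    rw [Finset.sum_comm]
    refine Finset.sum_congr rfl fun k _ => ?_
    rw [Finset.sum_comm]
    simp only [mul_left_comm]
  simp only [hpq y hy, mul_add, Finset.sum_add_distrib, h1, h2, add_zero]

lemma tractorCurv_eq_zero (hC : ∀ a b c e, weyl G a b c e y = 0)
    (hA : ∀ a b c, cotton G a b c y = 0) (a b : Fin d) (C E : TIdx d) :
    tractorCurv G a b C E y = 0 := by
  obtain ⟨p, q, -, -, hpq⟩ := h.tractorCurv_decomposition C E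
  simp [hpq y hy, hC, hA]

/-- Where $C$ and $A$ vanish, derivatives pass the coefficients of `tractorCurv_decomposition`, and
partial derivatives agree with covariant ones. The divergence of Cotton is then Bach and that of
Weyl is $(d-3)A$. -/
lemma divergence_tractorCurv_eq_zero (hd : 3 ≤ d) (hC : ∀ a b c e, weyl G a b c e y = 0)
    (hA : ∀ a b c, cotton G a b c y = 0) (hB : ∀ a b, bach G a b y = 0) (b : Fin d)
    (C E : TIdx d) :
    ∑ f, ∑ a, (G y)⁻¹ f a * partialDeriv f (tractorCurv G a b C E) y = 0 := by
  obtain ⟨p, q, hp, hq, hpq⟩ := h.tractorCurv_decomposition C E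
  have D := fun {f} (hf : SmoothOn U f) => hf.differentiableAt h.isOpen hy
  have h1 : ∀ f a, partialDeriv f (tractorCurv G a b C E) y =
      ∑ k, p k y * partialDeriv f (cotton G k a b) y
        + ∑ k, ∑ l, q k l y * partialDeriv f (weyl G a b k l) y := by
    intro f a
    have s1 := fun k => (hp k).mul (h.smooth_cotton k a b)
    have s2 := fun k l => (hq k l).mul (h.smooth_weyl a b k l)
    rw [partialDeriv_congr f h.isOpen hy fun z hz => hpq z hz a b,
      partialDeriv_add f (D (SmoothOn.sum s1)) (D (SmoothOn.sum fun k => SmoothOn.sum (s2 k))),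
      partialDeriv_sum f fun k => D (s1 k), partialDeriv_sum f fun k => D (SmoothOn.sum (s2 k))]
    congr 1
    · exact Finset.sum_congr rfl fun k _ =>
        h.partialDeriv_mul_of_eq_zero hy (hp k) (h.smooth_cotton k a b) (hA _ _ _) f
    · refine Finset.sum_congr rfl fun k _ => ?_
      rw [partialDeriv_sum f fun l => D (s2 k l)]
      exact Finset.sum_congr rfl fun l _ =>
        h.partialDeriv_mul_of_eq_zero hy (hq k l) (h.smooth_weyl a b k l) (hC _ _ _ _) f
  have hdA : ∀ k, ∑ f, ∑ a, (G y)⁻¹ f a * partialDeriv f (cotton G k a b) y = 0 := by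
    intro k
    have := hB k b
    simp only [bach_eq, nabla₃, hA, hC, mul_zero, Finset.sum_const_zero, sub_zero, add_zero] at this
    rw [← this, Finset.sum_comm]
    exact Finset.sum_congr rfl fun f _ => Finset.sum_congr rfl fun a _ => by rw [h.inv_symm hy]
  have hdC : ∀ k l, ∑ f, ∑ a, (G y)⁻¹ f a * partialDeriv f (weyl G a b k l) y = 0 := by
    intro k l
    have := h.divergence_weyl hy hd k l b
    simp only [nabla₄, hA, hC, mul_zero, Finset.sum_const_zero, sub_zero] at this
    rw [← this]
    exact Finset.sum_congr rfl fun f _ => Finset.sum_congr rfl fun a _ => by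
      rw [partialDeriv_congr f h.isOpen hy fun z hz => h.weyl_pair hz a b k l]
  have e1 : ∑ f, ∑ a, (G y)⁻¹ f a * ∑ k, p k y * partialDeriv f (cotton G k a b) y = 0 := by
    have : ∑ k, p k y * ∑ f, ∑ a, (G y)⁻¹ f a * partialDeriv f (cotton G k a b) y = 0 := by
      simp [hdA]
    rw [← this]
    simp only [Finset.mul_sum]
    rw [sum_rotate₂₃, Finset.sum_comm]
    simp only [mul_left_comm]
  have e2 : ∑ f, ∑ a, (G y)⁻¹ f a * ∑ k, ∑ l, q k l y * partialDeriv f (weyl G a b k l) y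
      = 0 := by
    have : ∑ k, ∑ l, q k l y * ∑ f, ∑ a, (G y)⁻¹ f a * partialDeriv f (weyl G a b k l) y = 0 := by
      simp [hdC]
    rw [← this]
    simp only [Finset.mul_sum]
    rw [sum_swap_pairs]
    simp only [mul_left_comm]
  simp only [h1, mul_add, Finset.sum_add_distrib, e1, e2, add_zero]

end IsMetricOn

end TractorCurvatureEntries

/-! ### The tractor-$D$ operator on fields vanishing at a point. -/

section TractorD

variable {d : ℕ} {U : Set (Coord d)} {G : LocalMetric d} {m : ℕ}

lemma covD_zero (G : LocalMetric d) (V : TensorField d 0 m) (i : Fin 1 → Fin d)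
    (A : Fin m → TIdx d) (y : Coord d) :
    covD G V i A y = partialDeriv (i 0) (V ![] A) y
      - ∑ j, ∑ E, tractorConn G (i 0) E (A j) y * V ![] (Function.update A j E) y := by
  have : Fin.tail i = ![] := Subsingleton.elim _ _
  simp [covD, this]

lemma covD_covD_zero (G : LocalMetric d) (V : TensorField d 0 m) (a b : Fin d)
    (A : Fin m → TIdx d) (y : Coord d) :
    covD G (covD G V) ![a, b] A y = partialDeriv a (covD G V ![b] A) y
      - ∑ e, christoffel G e a b y * covD G V ![e] A y
      - ∑ j, ∑ E, tractorConn G a E (A j) y * covD G V ![b] (Function.update A j E) y := by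
  have h1 : Fin.tail ![a, b] = ![b] := rfl
  have h2 : ∀ e, Function.update ![b] 0 e = ![e] := fun e => by ext i; fin_cases i; rfl
  have h3 : ∀ F : Fin (0 + 1) → ℝ, ∑ x, F x = F 0 := fun F => Fin.sum_univ_one F
  rw [covD, h1, h3]
  have h4 : ∑ e, christoffel G e (![a, b] 0) (![b] 0) y *
      covD G V (Function.update ![b] 0 e) A y = ∑ e, christoffel G e a b y * covD G V ![e] A y :=
    Finset.sum_congr rfl fun e _ => by rw [h2]; rfl
  exact congrArg₂ _ (congrArg₂ _ rfl h4) rfl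

namespace IsMetricOn

variable (h : IsMetricOn U G) {y : Coord d} (hy : y ∈ U) {V : TensorField d 0 (m + 1)}
  (hV : ∀ A, SmoothOn U (V ![] A)) (hV0 : ∀ A, V ![] A y = 0)
  (hVX : ∀ A, A 0 = slotX → ∀ z ∈ U, V ![] A z = 0)
include h hy hV hV0 hVX

omit h hy hV hVX in
lemma covD_of_eq_zero (a : Fin d) (A : Fin (m + 1) → TIdx d) :
    covD G V ![a] A y = partialDeriv a (V ![] A) y := by
  rw [covD_zero]
  simp [hV0]

-- The canonical tractor is not parallel: $\nabla_bX^A=Z_b{}^A$. Hence $V_AX^A=0$ gives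
-- $X^A\nabla_bV_A=-Z_b{}^AV_A$.
omit hV hV0 hy in
lemma covD_slotX {z : Coord d} (hz : z ∈ U) (b : Fin d) (A : Fin (m + 1) → TIdx d)
    (hA : A 0 = slotX) :
    covD G V ![b] A z = -∑ e, G z b e * V ![] (Function.update A 0 (slotZ e)) z := by
  have h1 : ∀ (j : Fin m) E, V ![] (Function.update A j.succ E) z = 0 := fun j E =>
    hVX _ (by rw [Function.update_of_ne (Fin.succ_ne_zero j).symm, hA]) z hz
  rw [covD_zero]
  simp only [Fin.sum_univ_succ, h1, mul_zero, Finset.sum_const_zero, hA, Fintype.sum_sum_type,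
    Finset.univ_unique, Finset.sum_singleton, tractorConn_YX, tractorConn_ZX, tractorConn_XX,
    zero_mul, add_zero, zero_add, Matrix.cons_val_zero,
    partialDeriv_eq_zero b h.isOpen hz fun z hz => hVX A hA z hz, zero_sub]

/-- Each of the two derivatives can fall on $X$, leaving the other on $V$. No undifferentiated term
survives because $V$ vanishes at `y`. -/
lemma covD_covD_slotX (a b : Fin d) (A : Fin (m + 1) → TIdx d) (hA : A 0 = slotX) :
    covD G (covD G V) ![a, b] A y =
      -∑ e, G y b e * partialDeriv a (V ![] (Function.update A 0 (slotZ e))) y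
      - ∑ e, G y a e * partialDeriv b (V ![] (Function.update A 0 (slotZ e))) y := by
  have h0 : ∀ B : Fin (m + 1) → TIdx d, B 0 = slotX → ∀ e, covD G V ![e] B y = 0 := by
    intro B hB e
    rw [covD_of_eq_zero hV0]
    exact partialDeriv_eq_zero e h.isOpen hy fun z hz => hVX B hB z hz
  have h1 : ∀ (j : Fin m) E, covD G V ![b] (Function.update A j.succ E) y = 0 := fun j E =>
    h0 _ (by rw [Function.update_of_ne (Fin.succ_ne_zero j).symm, hA]) b
  have h2 : partialDeriv a (covD G V ![b] A) y =
      -∑ e, G y b e * partialDeriv a (V ![] (Function.update A 0 (slotZ e))) y := by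
    rw [partialDeriv_congr a h.isOpen hy fun z hz => h.covD_slotX hVX hz b A hA,
      partialDeriv_neg, partialDeriv_sum a fun e =>
        ((h.smooth b e).mul (hV _)).differentiableAt h.isOpen hy]
    congr 1
    exact Finset.sum_congr rfl fun e _ =>
      h.partialDeriv_mul_of_eq_zero hy (h.smooth b e) (hV _) (hV0 _) a
  rw [covD_covD_zero, h2]
  simp only [h0 A hA, mul_zero, Finset.sum_const_zero, sub_zero, Fin.sum_univ_succ, h1, add_zero]
  simp only [hA, Fintype.sum_sum_type, Finset.univ_unique, Finset.sum_singleton, tractorConn_YX,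
    tractorConn_ZX, tractorConn_XX, zero_mul, add_zero, zero_add, covD_of_eq_zero hV0]

lemma laplacian_slotX (A : Fin (m + 1) → TIdx d) (hA : A 0 = slotX) :
    laplacian G V ![] A y =
      2 * ∑ a, partialDeriv a (V ![] (Function.update A 0 (slotZ a))) y := by
  have e1 : ∑ a, ∑ b, (G y)⁻¹ a b *
      ∑ e, G y b e * partialDeriv a (V ![] (Function.update A 0 (slotZ e))) y =
      ∑ a, partialDeriv a (V ![] (Function.update A 0 (slotZ a))) y :=
    Finset.sum_congr rfl fun a _ => h.sum_inv_mul_sum_mul hy a _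
  have e2 : ∑ a, ∑ b, (G y)⁻¹ a b *
      ∑ e, G y a e * partialDeriv b (V ![] (Function.update A 0 (slotZ e))) y =
      ∑ a, partialDeriv a (V ![] (Function.update A 0 (slotZ a))) y := by
    rw [Finset.sum_comm, ← e1]
    exact Finset.sum_congr rfl fun a _ => Finset.sum_congr rfl fun b _ => by rw [h.inv_symm hy]
  rw [laplacian]
  simp only [h.covD_covD_slotX hy hV hV0 hVX _ _ A hA, mul_sub, mul_neg, Finset.sum_sub_distrib,
    Finset.sum_neg_distrib, e1, e2]
  ring

/-- The contraction of the tractor-`D` operator of weight `-1` with a field that vanishes at `y`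
and is annihilated by the canonical tractor. -/
lemma sum_tractorD (B : Fin m → TIdx d) :
    ∑ A, ∑ A', tractorMetricInv G A A' y *
      tractorD G (-1) V ![] (Fin.cons A' (Fin.cons A B)) y =
    ((d : ℝ) - 2) * ∑ a, partialDeriv a (V ![] (Fin.cons (slotZ a) B)) y := by
  have hX := h.laplacian_slotX hy hV hV0 hVX (Fin.cons slotX B) rfl
  simp only [Fin.update_cons_zero] at hX
  have hZ : ∑ a, ∑ b, G y a b * ∑ c, (G y)⁻¹ b c *
      partialDeriv c (V ![] (Fin.cons (slotZ a) B)) y =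
      ∑ a, partialDeriv a (V ![] (Fin.cons (slotZ a) B)) y := by
    refine Finset.sum_congr rfl fun a _ => ?_
    have : (G y).mulVec ((G y)⁻¹.mulVec fun c =>
        partialDeriv c (V ![] (Fin.cons (slotZ a) B)) y) = fun c =>
        partialDeriv c (V ![] (Fin.cons (slotZ a) B)) y := by
      rw [Matrix.mulVec_mulVec, h.mul_inv hy, Matrix.one_mulVec]
    exact congrFun this a
  simp only [Fintype.sum_sum_type, Finset.univ_unique, Finset.sum_singleton,
    PUnit.default_eq_unit, tractorMetricInv_YY, tractorMetricInv_YZ, tractorMetricInv_YX,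
    tractorMetricInv_ZY, tractorMetricInv_ZZ, tractorMetricInv_ZX, tractorMetricInv_XY,
    tractorMetricInv_XZ, tractorMetricInv_XX, zero_mul, one_mul, Finset.sum_const_zero, zero_add,
    add_zero, tractorD, Fin.cons_zero, Fin.tail_cons, hV0, mul_zero, sub_zero, projX, projY,
    projZ, tractorMetric_YY, tractorMetric_YZ, tractorMetric_YX, tractorMetric_ZY,
    tractorMetric_ZZ, tractorMetric_ZX, tractorMetric_XZ, tractorMetric_XX,
    covD_of_eq_zero hV0, hX]
  -- For $w=-1$ the $Z$ slots contribute $d+2w-2=d-4$ copies of the divergence and the Laplacian in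
  -- the $X$ slot contributes 2 more (`laplacian_slotX`), giving $d-2$. The $Y_A$ and $J$ terms
  -- vanish with $V$ at `y`.
  have : ∑ a, ∑ b, G y a b * (((d : ℝ) + 2 * (-1) - 2) * ∑ c, (G y)⁻¹ b c *
      partialDeriv c (V ![] (Fin.cons (slotZ a) B)) y) = ((d : ℝ) + 2 * (-1) - 2) *
      ∑ a, partialDeriv a (V ![] (Fin.cons (slotZ a) B)) y := by
    rw [← hZ, Finset.mul_sum]
    refine Finset.sum_congr rfl fun a _ => ?_
    rw [Finset.mul_sum]
    exact Finset.sum_congr rfl fun b _ => by ring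
  rw [this]
  ring

end IsMetricOn

end TractorD

/-! ### Vanishing of $W$, and zeros of the 1-jet of $\sigma$. -/

section TractorW

variable {d : ℕ} {U : Set (Coord d)} {G : LocalMetric d}

lemma tractorCurvT_X (G : LocalMetric d) (B E F : TIdx d) (y : Coord d) :
    tractorCurvT G slotX B E F y = 0 := by
  simp [tractorCurvT, projZ, tractorMetric_XZ]

namespace IsMetricOn

variable (h : IsMetricOn U G) {y : Coord d} (hy : y ∈ U)
include h hy

lemma divergence_tractorCurvT_eq_zero (hd : 3 ≤ d) (hC : ∀ a b c e, weyl G a b c e y = 0)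
    (hA : ∀ a b c, cotton G a b c y = 0) (hB : ∀ a b, bach G a b y = 0) (C E F : TIdx d) :
    ∑ a, partialDeriv a (tractorCurvT G (slotZ a) C E F) y = 0 := by
  have D := fun {f} (hf : SmoothOn U f) => hf.differentiableAt h.isOpen hy
  have hs : ∀ a b c, SmoothOn U (fun z => projZ G (slotZ a) b z * projZ G C c z) := fun a b c =>
    (h.smooth_tractorMetric (slotZ a) (slotZ b)).mul (h.smooth_tractorMetric C (slotZ c))
  have hp := fun a b c => (hs a b c).mul (h.smooth_tractorCurv b c E F)
  have h1 : ∀ a, partialDeriv a (tractorCurvT G (slotZ a) C E F) y =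
      ∑ b, ∑ c, (G y)⁻¹ a b * projZ G C c y * partialDeriv a (tractorCurv G b c E F) y := by
    intro a
    unfold tractorCurvT
    rw [partialDeriv_sum a fun b => D (SmoothOn.sum (hp a b))]
    refine Finset.sum_congr rfl fun b _ => ?_
    rw [partialDeriv_sum a fun c => D (hp a b c)]
    exact Finset.sum_congr rfl fun c _ => h.partialDeriv_mul_of_eq_zero hy (hs a b c)
      (h.smooth_tractorCurv b c E F) (h.tractorCurv_eq_zero hy hC hA b c E F) a
  have h2 : ∑ c, projZ G C c y * ∑ a, ∑ b, (G y)⁻¹ a b *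
      partialDeriv a (tractorCurv G b c E F) y = 0 := by
    simp only [h.divergence_tractorCurv_eq_zero hy hd hC hA hB, mul_zero, Finset.sum_const_zero]
  rw [← h2]
  simp only [h1, Finset.mul_sum]
  rw [sum_rotate₂₃, Finset.sum_comm]
  exact Finset.sum_congr rfl fun c _ => Finset.sum_congr rfl fun a _ =>
    Finset.sum_congr rfl fun b _ => by ring

/-- The field $X_{[A}\Omega_{BC]EF}$ vanishes at the point and is annihilated by $X^A$ on `U`, so
`sum_tractorD` reduces $W$ to its divergence, hence to that of $\Omega$. -/
lemma tractorW_eq_zero (hd : 3 ≤ d) (hC : ∀ a b c e, weyl G a b c e y = 0)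
    (hA : ∀ a b c, cotton G a b c y = 0) (hB : ∀ a b, bach G a b y = 0) (B C E F : TIdx d) :
    tractorW G B C E F y = 0 := by
  have D := fun {f} (hf : SmoothOn U f) => hf.differentiableAt h.isOpen hy
  have hΩ : ∀ B C E F, tractorCurvT G B C E F y = 0 := fun B C E F => by
    simp [tractorCurvT, h.tractorCurv_eq_zero hy hC hA]
  have hV0 : ∀ A, skewXCurv G ![] A y = 0 := fun A => by simp [skewXCurv, hΩ]
  -- $X$ is null and orthogonal to the $Z$ projectors, so contraction with $X^A$ kills all six
  -- terms.
  have hVX : ∀ A : Fin 5 → TIdx d, A 0 = slotX → ∀ z ∈ U, skewXCurv G ![] A z = 0 := by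
    intro A hA z _
    have : ∀ B, tractorCurvT G B slotX (A 3) (A 4) z = 0 := fun B => by
      rw [tractorCurvT_swap, tractorCurvT_X, neg_zero]
    simp [skewXCurv, hA, this, tractorCurvT_X, projX, tractorMetric_XX]
  have key := h.sum_tractorD hy (h.smooth_skewXCurv ![]) hV0 hVX ![B, C, E, F]
  have hdiv : ∑ a, partialDeriv a (skewXCurv G ![] (Fin.cons (slotZ a) ![B, C, E, F])) y = 0 := by
    have e1 : ∀ a, partialDeriv a (skewXCurv G ![] (Fin.cons (slotZ a) ![B, C, E, F])) y =
        (1 / 3) * (projX G C y * partialDeriv a (tractorCurvT G (slotZ a) B E F) y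
          - projX G B y * partialDeriv a (tractorCurvT G (slotZ a) C E F) y) := by
      intro a
      -- Skewness of $\Omega$ merges the six terms in pairs, turning $1/6$ into $1/3$, and $X_A$ has
      -- no component in a $Z$ slot.
      have e2 : ∀ z, skewXCurv G ![] (Fin.cons (slotZ a) ![B, C, E, F]) z =
          (1 / 3) * (projX G C z * tractorCurvT G (slotZ a) B E F z
            - projX G B z * tractorCurvT G (slotZ a) C E F z) := by
        intro z
        change (1 / 6) * (projX G (slotZ a) z * tractorCurvT G B C E F z
          + projX G B z * tractorCurvT G C (slotZ a) E F z
          + projX G C z * tractorCurvT G (slotZ a) B E F z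
          - projX G (slotZ a) z * tractorCurvT G C B E F z
          - projX G B z * tractorCurvT G (slotZ a) C E F z
          - projX G C z * tractorCurvT G B (slotZ a) E F z) = _
        rw [tractorCurvT_swap G C (slotZ a), tractorCurvT_swap G B (slotZ a),
          show projX G (slotZ a) z = 0 from rfl]
        ring
      have hX : ∀ A, SmoothOn U (projX G A) := fun A => h.smooth_tractorMetric A slotX
      have s := fun B C => (hX C).mul (h.smooth_tractorCurvT (slotZ a) B E F)
      rw [partialDeriv_congr a h.isOpen hy fun z _ => e2 z,
        partialDeriv_mul a (D (SmoothOn.const _)) (D ((s B C).sub (s C B))),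
        partialDeriv_const, partialDeriv_sub a (D (s B C)) (D (s C B)),
        h.partialDeriv_mul_of_eq_zero hy (hX C)
          (h.smooth_tractorCurvT (slotZ a) B E F) (hΩ _ _ _ _),
        h.partialDeriv_mul_of_eq_zero hy (hX B)
          (h.smooth_tractorCurvT (slotZ a) C E F) (hΩ _ _ _ _)]
      ring
    simp only [e1, ← Finset.mul_sum, Finset.sum_sub_distrib,
      h.divergence_tractorCurvT_eq_zero hy hd hC hA hB, mul_zero, sub_zero]
  rw [hdiv, mul_zero] at key
  rw [tractorW]
  exact mul_eq_zero_of_right _ key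

end IsMetricOn

namespace IsParallelOn

variable {I : TIdx d → Coord d → ℝ} (hI : IsParallelOn U G I) {y : Coord d}
  (h : IsMetricOn U G) (hy : y ∈ U) (hσ : I slotY y = 0) (hμ : ∀ a, I (slotZ a) y = 0)
  (hρ : I slotX y ≠ 0)
include hI h hy hσ hμ hρ

omit hI h hy hσ hρ in
lemma raisedMid_eq_zero (e : Fin d) : raisedMid G I e y = 0 := by
  simp [raisedMid, hμ]

omit hρ in
lemma partialDeriv_raisedMid (f e : Fin d) :
    partialDeriv f (raisedMid G I e) y = -(if e = f then I slotX y else 0) := by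
  have := hI.nabla_raisedMid h hy f e
  simpa [hσ, raisedMid_eq_zero hμ] using this

/-- Differentiate $\mu^cF_c=0$: since $\mu$ vanishes at `y` with derivative $-\rho\,\mathrm{id}$,
only $-\rho F_f=0$ remains. It serves for both Cotton and Bach. -/
lemma eq_zero_of_raisedMid_mul {F : Fin d → Coord d → ℝ} (hF : ∀ c, SmoothOn U (F c))
    (h0 : ∀ z ∈ U, ∑ c, raisedMid G I c z * F c z = 0) (f : Fin d) : F f y = 0 := by
  have D := fun {f} (hf : SmoothOn U f) => hf.differentiableAt h.isOpen hy
  have hu := hI.smooth_raisedMid h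
  have h1 := partialDeriv_eq_zero f h.isOpen hy h0
  rw [partialDeriv_sum f fun c => D ((hu c).mul (hF c)), Finset.sum_congr rfl fun c _ =>
    partialDeriv_mul f (D (hu c)) (D (hF c))] at h1
  simp [hI.partialDeriv_raisedMid h hy hσ hμ, raisedMid_eq_zero hμ] at h1
  exact h1.resolve_left hρ

/-- In the derivative of $\sigma A+\mu\cdot C=0$ every term but $(\nabla_e\mu)\cdot C=-\rho\,C$
vanishes at `y`. -/
lemma weyl_eq_zero (a b c e : Fin d) : weyl G a b c e y = 0 := by
  have h1 := hI.nabla_cotton_add_weyl h hy e a b c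
  simp [hμ, hσ, raisedMid_eq_zero hμ, hI.partialDeriv_raisedMid h hy hσ hμ] at h1
  exact h1.resolve_left hρ

lemma cotton_eq_zero (a b c : Fin d) : cotton G a b c y = 0 :=
  hI.eq_zero_of_raisedMid_mul h hy hσ hμ hρ (F := fun a => cotton G a b c)
    (fun a => h.smooth_cotton a b c) (fun _ hz => hI.raisedMid_cotton h hz b c) a

end IsParallelOn

end TractorW

/-! ### Algebraic Weyl tensors in four dimensions. -/

section FourDimensions

/-- A positive definite inverse metric has an orthonormal frame adapted to a given vector. -/
lemma exists_adapted_frame {n : ℕ} {g : Matrix (Fin (n + 1)) (Fin (n + 1)) ℝ} (hg : g.PosDef)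
    {u : Fin (n + 1) → ℝ} (hu : u ≠ 0) :
    ∃ (E : Matrix (Fin (n + 1)) (Fin (n + 1)) ℝ) (t : ℝ),
      E * E.transpose = g⁻¹ ∧ ∀ a, E a 0 = t * u a := by
  -- A factorisation $g=S^{T}S$ makes $S$ an isometry onto Euclidean space. An orthonormal basis
  -- starting along $Su$ is pulled back by $S^{-1}$.
  obtain ⟨S, hS⟩ : ∃ S : Matrix (Fin (n + 1)) (Fin (n + 1)) ℝ, g = S.transpose * S := by
    open scoped MatrixOrder in
    obtain ⟨S, hS⟩ := (CStarAlgebra.nonneg_iff_eq_star_mul_self).1 hg.posSemidef.nonneg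
    exact ⟨S, by rw [hS, Matrix.star_eq_conjTranspose,
      Matrix.conjTranspose_eq_transpose_of_trivial]⟩
  have hdet : IsUnit S.det := by
    have := hg.det_pos.ne'
    rw [hS, Matrix.det_mul, Matrix.det_transpose] at this
    exact (left_ne_zero_of_mul this).isUnit
  set w : EuclideanSpace ℝ (Fin (n + 1)) := WithLp.toLp 2 (S.mulVec u) with hw
  have hw0 : w ≠ 0 := by
    intro h0
    have h1 : S.mulVec u = 0 := by simpa [hw] using h0
    apply hu
    rw [← Matrix.one_mulVec u, ← Matrix.nonsing_inv_mul S hdet, ← Matrix.mulVec_mulVec, h1,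
      Matrix.mulVec_zero]
  -- Of the constant family only the vector of index 0 matters; the construction completes it to an
  -- orthonormal basis.
  set b := InnerProductSpace.gramSchmidtOrthonormalBasis (𝕜 := ℝ)
    (E := EuclideanSpace ℝ (Fin (n + 1))) (ι := Fin (n + 1)) (by simp) (fun _ => w) with hb
  have hb0 : b 0 = ‖w‖⁻¹ • w := by
    have h1 : InnerProductSpace.gramSchmidtNormed ℝ (fun _ : Fin (n + 1) => w) 0 =
        ‖w‖⁻¹ • w := by
      simp [InnerProductSpace.gramSchmidtNormed, InnerProductSpace.gramSchmidt_bot, ← bot_eq_zero]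
    have h2 : InnerProductSpace.gramSchmidtNormed ℝ (fun _ : Fin (n + 1) => w) 0 ≠ 0 := by
      rw [h1]
      simp [hw0]
    rw [hb, InnerProductSpace.gramSchmidtOrthonormalBasis_apply _ h2, h1]
  set Q : Matrix (Fin (n + 1)) (Fin (n + 1)) ℝ :=
    (EuclideanSpace.basisFun (Fin (n + 1)) ℝ).toBasis.toMatrix b with hQ
  have hQQ : Q * Q.transpose = 1 := Matrix.mem_orthogonalGroup_iff _ _ |>.1
    ((EuclideanSpace.basisFun (Fin (n + 1)) ℝ).toMatrix_orthonormalBasis_mem_orthogonal b)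
  refine ⟨S⁻¹ * Q, ‖w‖⁻¹, ?_, fun a => ?_⟩
  · rw [Matrix.transpose_mul, Matrix.mul_assoc, ← Matrix.mul_assoc Q, hQQ, Matrix.one_mul, hS,
      Matrix.mul_inv_rev, Matrix.transpose_nonsing_inv]
  · have h1 : ∀ k, Q k 0 = ‖w‖⁻¹ * S.mulVec u k := by
      intro k
      simp [hQ, Module.Basis.toMatrix_apply, hb0, hw]
    have h2 : S⁻¹.mulVec (S.mulVec u) = u := by
      rw [Matrix.mulVec_mulVec, Matrix.nonsing_inv_mul S hdet, Matrix.one_mulVec]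
    have h3 : ∑ x, S⁻¹ a x * Q x 0 = ‖w‖⁻¹ * ∑ x, S⁻¹ a x * S.mulVec u x := by
      rw [Finset.mul_sum]
      exact Finset.sum_congr rfl fun x _ => by rw [h1]; ring
    rw [Matrix.mul_apply, h3]
    exact congrArg _ (congrFun h2 a)

/-- In three dimensions a trace-free algebraic curvature tensor vanishes. -/
lemma curvature_eq_zero_of_three_dim {K : Fin 4 → Fin 4 → Fin 4 → Fin 4 → ℝ}
    (h12 : ∀ i j k l, K i j k l = -K j i k l) (hp : ∀ i j k l, K i j k l = K k l i j)
    (htr : ∀ j l, ∑ i, K i j i l = 0) (h0 : ∀ j k l, K 0 j k l = 0) (i j k l : Fin 4) :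
    K i j k l = 0 := by
  -- By skewness and `h0`, the index pairs 12, 13, 23 determine everything; the reduction is applied
  -- to both pairs through `hp`.
  have hred : ∀ k l, K 1 2 k l = 0 → K 1 3 k l = 0 → K 2 3 k l = 0 → ∀ i j, K i j k l = 0 := by
    intro k l e1 e2 e3 i j
    fin_cases i <;> fin_cases j <;> simp only [Fin.zero_eta, Fin.mk_one, Fin.reduceFinMk] <;>
      linarith [h0 0 k l, h0 1 k l, h0 2 k l, h0 3 k l, h12 1 0 k l, h12 2 0 k l, h12 3 0 k l,
        h12 1 1 k l, h12 2 2 k l, h12 3 3 k l, h12 2 1 k l, h12 3 1 k l, h12 3 2 k l]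
  have h34 : ∀ i j k l, K i j k l = -K i j l k := fun i j k l => by
    rw [hp, h12, hp l k]
  have T : ∀ j l, K 1 j 1 l + K 2 j 2 l + K 3 j 3 l = 0 := fun j l => by
    have := htr j l
    rw [Fin.sum_univ_four, h0] at this
    linarith
  have hd : ∀ i k l, K i i k l = 0 := fun i k l => by linarith [h12 i i k l]
  have hd' : ∀ i j k, K i j k k = 0 := fun i j k => by linarith [h34 i j k k]
  have s := fun i j k l => (h12 i j k l).trans (congrArg _ (h34 j i k l))
  -- The diagonal traces say that any two of the three sectional components have sum zero, so all
  -- three vanish.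
  have a1 : K 1 2 1 2 = 0 := by
    linarith [T 1 1, T 2 2, T 3 3, hd 1 1 1, hd 2 2 2, hd 3 3 3, s 2 1 2 1, s 3 1 3 1, s 3 2 3 2]
  have a2 : K 1 3 1 3 = 0 := by
    linarith [T 1 1, T 2 2, T 3 3, hd 1 1 1, hd 2 2 2, hd 3 3 3, s 2 1 2 1, s 3 1 3 1, s 3 2 3 2]
  have a3 : K 2 3 2 3 = 0 := by
    linarith [T 1 1, T 2 2, T 3 3, hd 1 1 1, hd 2 2 2, hd 3 3 3, s 2 1 2 1, s 3 1 3 1, s 3 2 3 2]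
  -- An off-diagonal trace contains a single nontrivial component.
  have b1 : K 1 2 1 3 = 0 := by linarith [T 2 3, hd 2 2 3, hd' 3 2 3]
  have b2 : K 1 2 2 3 = 0 := by linarith [T 1 3, hd 1 1 3, hd' 3 1 3, h12 2 1 2 3]
  have b3 : K 1 3 2 3 = 0 := by
    linarith [T 1 2, hd 1 1 2, hd' 2 1 2, s 3 1 3 2]
  refine hred k l ?_ ?_ ?_ i j
  · rw [hp]
    exact hred 1 2 a1 ((hp _ _ _ _).trans b1) ((hp _ _ _ _).trans b2) k l
  · rw [hp]
    exact hred 1 3 b1 a2 ((hp _ _ _ _).trans b3) k l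
  · rw [hp]
    exact hred 2 3 b2 b3 a3 k l

/-- In four dimensions an algebraic Weyl tensor annihilated by a nonzero vector vanishes. -/
lemma weyl_eq_zero_of_four_dim {C : Fin 4 → Fin 4 → Fin 4 → Fin 4 → ℝ}
    {g : Matrix (Fin 4) (Fin 4) ℝ} (hg : g.PosDef) {u : Fin 4 → ℝ} (hu : u ≠ 0)
    (h12 : ∀ i j k l, C i j k l = -C j i k l) (hp : ∀ i j k l, C i j k l = C k l i j)
    (htr : ∀ j l, ∑ i, ∑ k, g⁻¹ i k * C i j k l = 0)
    (h0 : ∀ j k l, ∑ i, u i * C i j k l = 0) (i j k l : Fin 4) : C i j k l = 0 := by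
  obtain ⟨E, t, hE, hE0⟩ := exists_adapted_frame hg hu
  have hdet : IsUnit E.det := by
    have h1 : E.det * E.transpose.det ≠ 0 := by
      rw [← Matrix.det_mul, hE, Matrix.det_nonsing_inv]
      simpa using hg.det_pos.ne'
    exact (left_ne_zero_of_mul h1).isUnit
  -- The frame is invertible, so vanishing frame components imply vanishing of the tensor; used once
  -- per index at the end.
  have hinj : ∀ X : Fin 4 → ℝ, (∀ i, ∑ a, E a i * X a = 0) → ∀ a, X a = 0 := by
    intro X hX
    have h1 : E.transpose.mulVec X = 0 := funext hX
    have h2 : X = 0 := by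
      rw [← Matrix.one_mulVec X, ← Matrix.nonsing_inv_mul E.transpose
          (by rwa [Matrix.det_transpose]),
        ← Matrix.mulVec_mulVec, h1, Matrix.mulVec_zero]
    exact congrFun h2
  set K : Fin 4 → Fin 4 → Fin 4 → Fin 4 → ℝ := fun i j k l =>
    ∑ a, E a i * ∑ b, E b j * ∑ c, E c k * ∑ e, E e l * C a b c e with hK
  have hK' : ∀ i j k l, K i j k l =
      ∑ a, ∑ b, ∑ c, ∑ e, E a i * (E b j * (E c k * (E e l * C a b c e))) := fun i j k l => by
    simp only [hK, Finset.mul_sum]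
  have k12 : ∀ i j k l, K i j k l = -K j i k l := by
    intro i j k l
    rw [hK', hK', Finset.sum_comm]
    simp only [← Finset.sum_neg_distrib]
    exact Finset.sum_congr rfl fun a _ => Finset.sum_congr rfl fun b _ =>
      Finset.sum_congr rfl fun c _ => Finset.sum_congr rfl fun e _ => by rw [h12]; ring
  have kp : ∀ i j k l, K i j k l = K k l i j := by
    intro i j k l
    rw [hK', hK', sum_swap_pairs]
    exact Finset.sum_congr rfl fun a _ => Finset.sum_congr rfl fun b _ =>
      Finset.sum_congr rfl fun c _ => Finset.sum_congr rfl fun e _ => by rw [hp]; ring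
  have kc : ∀ a c, ∑ i, E a i * E c i = g⁻¹ a c := fun a c => by
    rw [← hE, Matrix.mul_apply]
    rfl
  have ktr : ∀ j l, ∑ i, K i j i l = 0 := by
    intro j l
    have h1 : ∑ b, ∑ e, E b j * (E e l * ∑ a, ∑ c, g⁻¹ a c * C a b c e) = 0 := by simp [htr]
    rw [← h1]
    simp only [hK', ← kc, Finset.mul_sum, Finset.sum_mul]
    calc ∑ i, ∑ a, ∑ b, ∑ c, ∑ e, E a i * (E b j * (E c i * (E e l * C a b c e)))
        = ∑ a, ∑ b, ∑ c, ∑ e, ∑ i, E a i * (E b j * (E c i * (E e l * C a b c e))) := by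
          rw [Finset.sum_comm]
          refine Finset.sum_congr rfl fun a _ => ?_
          rw [Finset.sum_comm]
          refine Finset.sum_congr rfl fun b _ => ?_
          rw [Finset.sum_comm]
          exact Finset.sum_congr rfl fun c _ => Finset.sum_comm
      _ = ∑ b, ∑ e, ∑ a, ∑ c, ∑ i, E a i * (E b j * (E c i * (E e l * C a b c e))) := by
          rw [Finset.sum_comm]
          refine Finset.sum_congr rfl fun b _ => ?_
          rw [sum_rotate₂₃, Finset.sum_comm]
      _ = _ := by
          exact Finset.sum_congr rfl fun a _ => Finset.sum_congr rfl fun b _ =>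
            Finset.sum_congr rfl fun c _ => Finset.sum_congr rfl fun e _ =>
              Finset.sum_congr rfl fun i _ => by ring
  have k0 : ∀ j k l, K 0 j k l = 0 := by
    intro j k l
    have h1 : ∑ b, ∑ c, ∑ e, t * (E b j * (E c k * (E e l * ∑ a, u a * C a b c e))) = 0 := by
      simp [h0]
    rw [hK', ← h1]
    simp only [Finset.mul_sum, hE0]
    rw [Finset.sum_comm]
    refine Finset.sum_congr rfl fun b _ => ?_
    rw [Finset.sum_comm]
    refine Finset.sum_congr rfl fun c _ => ?_
    rw [Finset.sum_comm]
    exact Finset.sum_congr rfl fun e _ => Finset.sum_congr rfl fun a _ => by ring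
  have hz := curvature_eq_zero_of_three_dim k12 kp ktr k0
  exact hinj _ (fun l => hinj _ (fun k => hinj _ (fun j => hinj _ (fun i => hz i j k l) i) j) k) l

end FourDimensions

/-! ### Unique continuation of parallel tractors. -/

section Vanishing

variable {d : ℕ} {U : Set (Coord d)} {G : LocalMetric d} {I : TIdx d → Coord d → ℝ}

lemma fderiv_eq_sum_partialDeriv (f : Coord d → ℝ) (y v : Coord d) :
    fderiv ℝ f y v = ∑ a, v a * partialDeriv a f y := by
  have : v = ∑ i, v i • (EuclideanSpace.single i (1 : ℝ) : EuclideanSpace ℝ (Fin d)) := by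
    rw [sum_smul_single]
  conv_lhs => rw [this]
  simp only [map_sum, map_smul, smul_eq_mul, partialDeriv]

/-- A parallel tractor that vanishes at one point of a convex set vanishes on that set. -/
lemma IsParallelOn.eq_zero_of_convex (hI : IsParallelOn U G I) (h : IsMetricOn U G)
    {s : Set (Coord d)} (hs : Convex ℝ s) (hsU : s ⊆ U) {x y : Coord d} (hx : x ∈ s) (hy : y ∈ s)
    (h0 : ∀ A, I A x = 0) (A : TIdx d) : I A y = 0 := by
  set c : ℝ → Coord d := fun t => AffineMap.lineMap x y t with hc
  have hcU : ∀ t ∈ Set.Icc (0 : ℝ) 1, c t ∈ U := fun t ht => hsU (hs.lineMap_mem hx hy ht)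
  have hcc : Continuous c := AffineMap.lineMap_continuous
  -- Along the segment the components of $I$ solve a linear ODE with coefficient matrix $-m$, which
  -- is bounded by compactness; Grönwall's inequality then applies.
  set m : ℝ → TIdx d → TIdx d → ℝ := fun t A B =>
    ∑ a, (y - x) a * tractorConn G a A B (c t) with hm
  have hmc : ContinuousOn m (Set.Icc 0 1) := by
    refine continuousOn_pi.2 fun A => continuousOn_pi.2 fun B => ?_
    refine continuousOn_finsetSum _ fun a _ => continuousOn_const.mul ?_
    exact (h.smooth_tractorMat a A B).continuousOn.comp hcc.continuousOn hcU
  obtain ⟨K, hK⟩ := isCompact_Icc.exists_bound_of_continuousOn hmc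
  have hder : ∀ t ∈ Set.Icc (0 : ℝ) 1, HasDerivAt (fun t A => I A (c t))
      (fun A => -∑ B, m t A B * I B (c t)) t := by
    intro t ht
    refine hasDerivAt_pi.2 fun A => ?_
    have h1 := ((hI.smooth A).differentiableAt h.isOpen (hcU t ht)).hasFDerivAt.comp_hasDerivAt t
      (AffineMap.hasDerivAt_lineMap (a := x) (b := y) (x := t))
    refine h1.congr_deriv ?_
    rw [fderiv_eq_sum_partialDeriv]
    simp only [hm, Finset.sum_mul]
    rw [Finset.sum_comm, ← Finset.sum_neg_distrib]
    refine Finset.sum_congr rfl fun a _ => ?_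
    rw [eq_neg_of_add_eq_zero_left (hI.parallel _ (hcU t ht) a A), mul_neg, Finset.mul_sum]
    simp only [mul_assoc, hc]
  -- In the sup norm each component of the derivative is a sum of `Fintype.card (TIdx d)` terms,
  -- each at most $K\lVert I\rVert$.
  have key := eq_zero_of_abs_deriv_le_mul_abs_self_of_eq_zero_right (a := 0) (b := 1)
    (K := Fintype.card (TIdx d) * K)
    (fun t ht => (hder t ht).continuousAt.continuousWithinAt)
    (fun t ht => (hder t ⟨ht.1, ht.2.le⟩).hasDerivWithinAt)
    (by ext A; simp [hc, h0]) ?_ 1 (by simp)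
  · simpa [hc] using congrFun key A
  · intro t ht
    have hK0 := (norm_nonneg _).trans (hK t ⟨ht.1, ht.2.le⟩)
    refine (pi_norm_le_iff_of_nonneg (by positivity)).2 fun A => ?_
    rw [norm_neg]
    refine (norm_sum_le _ _).trans ?_
    have : ∀ B ∈ Finset.univ, ‖m t A B * I B (c t)‖ ≤ K * ‖fun A => I A (c t)‖ := by
      intro B _
      rw [norm_mul]
      exact mul_le_mul ((norm_le_pi_norm (m t A) B).trans ((norm_le_pi_norm (m t) A).trans
        (hK t ⟨ht.1, ht.2.le⟩))) (norm_le_pi_norm (fun A => I A (c t)) B) (norm_nonneg _) hK0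
    refine (Finset.sum_le_card_nsmul _ _ _ this).trans_eq ?_
    rw [nsmul_eq_mul, mul_assoc, Finset.card_univ]

end Vanishing

/-! ### Passage from coordinate charts to the manifold. -/

section Manifolds

variable {d : ℕ} {M : Type*} [TopologicalSpace M] [ChartedSpace (EuclideanSpace ℝ (Fin d)) M]
  [IsManifold (𝓡 d) ∞ M] {conf : ConformalStructure d M}
  {φ : OpenPartialHomeomorph M (EuclideanSpace ℝ (Fin d))}

lemma isMetricOn_coordMetric (g : RiemMetric d M)
    (hφ : φ ∈ IsManifold.maximalAtlas (𝓡 d) ∞ M) : IsMetricOn φ.target (coordMetric g φ) where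
  isOpen := φ.open_target
  smooth i j := contDiffOn_coordMetric g hφ i j
  posDef _ hy := coordMetric_posDef g hφ hy

namespace TractorField

lemma IsParallel.isParallelOn {I : TractorField conf} (hI : I.IsParallel) (g : conf.metrics)
    (hφ : φ ∈ IsManifold.maximalAtlas (𝓡 d) ∞ M) :
    IsParallelOn φ.target (coordMetric g.1 φ) (I.comp g φ) where
  smooth := by
    rintro (⟨⟩ | a | ⟨⟩)
    · exact contDiffOn_function (I.top g) hφ
    · exact contDiffOn_covector (I.mid g) hφ a
    · exact contDiffOn_function (I.bot g) hφ
  parallel := hI g φ hφ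

lemma triple_eq_zero_iff (I : TractorField conf) (g : conf.metrics)
    (hφ : φ ∈ IsManifold.maximalAtlas (𝓡 d) ∞ M) {y : Coord d} (hy : y ∈ φ.target) :
    I.triple g (φ.symm y) = 0 ↔ ∀ A, I.comp g φ A y = 0 := by
  constructor
  · intro h A
    simp only [triple, Prod.mk_eq_zero] at h
    rcases A with ⟨⟩ | a | ⟨⟩
    · exact h.1
    · change I.mid g (φ.symm y) (coordVec φ y a) = 0
      rw [h.2.1]
      rfl
    · exact h.2.2
  · intro h
    simp only [triple, Prod.mk_eq_zero]
    exact ⟨h slotY, eq_zero_of_coordVec hφ hy _ fun i => h (slotZ i), h slotX⟩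

lemma exists_isRescaling (g ĝ : conf.metrics) :
    ∃ u : C^∞⟮𝓡 d, M; 𝓘(ℝ), ℝ⟯, IsRescaling u g.1 ĝ.1 :=
  Quotient.exact (s := conformalSetoid d M) (g.2.trans ĝ.2.symm)

/-- The change of scale acts linearly on the triple, so vanishing at a point does not depend on the
metric. This matters because `IsNonzero` may be witnessed in another scale. -/
lemma triple_eq_zero_of_eq_zero (I : TractorField conf) (g ĝ : conf.metrics) {p : M}
    (h : I.triple g p = 0) : I.triple ĝ p = 0 := by
  obtain ⟨u, hu⟩ := exists_isRescaling g ĝ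
  simp only [triple, Prod.mk_eq_zero] at h ⊢
  refine ⟨?_, ?_, ?_⟩
  · rw [I.top_transf g ĝ u hu, h.1, mul_zero]
  · refine ContinuousLinearMap.ext fun v => ?_
    rw [I.mid_transf g ĝ u hu, h.1, h.2.1]
    simp
  · rw [I.bot_transf g ĝ u hu, h.1, h.2.1, h.2.2]
    simp [cometric]

/-- The zero set of a parallel tractor is open and closed. -/
lemma IsParallel.eventually_triple_eq_zero_iff {I : TractorField conf} (hI : I.IsParallel)
    (g : conf.metrics) (p : M) :
    ∀ᶠ q in nhds p, (I.triple g q = 0 ↔ I.triple g p = 0) := by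
  set φ := chartAt (EuclideanSpace ℝ (Fin d)) p
  have hφ : φ ∈ IsManifold.maximalAtlas (𝓡 d) ∞ M := IsManifold.chart_mem_maximalAtlas p
  have hp : p ∈ φ.source := mem_chart_source _ p
  obtain ⟨r, hr, hball⟩ := Metric.isOpen_iff.1 φ.open_target _ (φ.map_source hp)
  have hpar := hI.isParallelOn g hφ
  have hG := isMetricOn_coordMetric g.1 hφ
  filter_upwards [φ.open_source.mem_nhds hp,
    (φ.continuousAt hp).preimage_mem_nhds (Metric.ball_mem_nhds _ hr)] with q hq hqr
  have h1 := I.triple_eq_zero_iff g hφ (φ.map_source hq)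
  have h2 := I.triple_eq_zero_iff g hφ (φ.map_source hp)
  rw [φ.left_inv hq] at h1
  rw [φ.left_inv hp] at h2
  rw [h1, h2]
  have hpr := Metric.mem_ball_self (x := φ p) hr
  exact ⟨fun h0 => hpar.eq_zero_of_convex hG (convex_ball _ _) hball hqr hpr h0,
    fun h0 => hpar.eq_zero_of_convex hG (convex_ball _ _) hball hpr hqr h0⟩

/-- The zero set is open and closed, hence empty or all of $M$ by connectedness. -/
lemma IsParallel.triple_ne_zero [ConnectedSpace M] {I : TractorField conf} (hI : I.IsParallel)
    (hI₀ : I.IsNonzero) (g : conf.metrics) (p : M) : I.triple g p ≠ 0 := by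
  obtain ⟨ĝ, q, hq⟩ := hI₀
  have hclopen : IsClopen {p | I.triple g p = 0} := by
    refine ⟨isOpen_compl_iff.1 (isOpen_iff_mem_nhds.2 fun p hp => ?_),
      isOpen_iff_mem_nhds.2 fun p hp => ?_⟩
    · filter_upwards [hI.eventually_triple_eq_zero_iff g p] with q hq
      exact fun h => hp (hq.1 h)
    · filter_upwards [hI.eventually_triple_eq_zero_iff g p] with q hq
      exact hq.2 hp
  rcases isClopen_iff.1 hclopen with h | h
  · exact fun hp => Set.notMem_empty p (h ▸ hp)
  · have hq0 : q ∈ {p | I.triple g p = 0} := h ▸ Set.mem_univ q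
    exact absurd (I.triple_eq_zero_of_eq_zero g ĝ hq0) hq

lemma scale_eq_top (I : TractorField conf) (g : conf.metrics) (p : M) :
    I.scale g p = I.top g p := by
  simp [scale, tractorInner, triple, cometric]

lemma IsParallel.nLow_eq {I : TractorField conf} (hI : I.IsParallel) (g : conf.metrics)
    (hφ : φ ∈ IsManifold.maximalAtlas (𝓡 d) ∞ M) {y : Coord d} (hy : y ∈ φ.target) (a : Fin d) :
    I.nLow g φ a y = I.comp g φ (slotZ a) y := by
  rw [← (hI.isParallelOn g hφ).partialDeriv_top hy a, nLow]
  simp only [scale_eq_top]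
  rfl

lemma IsParallel.nUp_eq {I : TractorField conf} (hI : I.IsParallel) (g : conf.metrics)
    (hφ : φ ∈ IsManifold.maximalAtlas (𝓡 d) ∞ M) {y : Coord d} (hy : y ∈ φ.target) (a : Fin d) :
    I.nUp g φ a y = raisedMid (coordMetric g.1 φ) (I.comp g φ) a y := by
  simp only [nUp, raisedMid, hI.nLow_eq g hφ hy]

end TractorField

end Manifolds

/-! ### Consequences for a nowhere vanishing parallel tractor. -/

namespace IsParallelOn

variable {d : ℕ} {U : Set (Coord d)} {G : LocalMetric d} {I : TIdx d → Coord d → ℝ}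
  (hI : IsParallelOn U G I) (h : IsMetricOn U G) (hne : ∀ z ∈ U, ∃ A, I A z ≠ 0)
  {y : Coord d} (hy : y ∈ U)
include hI h hy

/-- `cotton_add_weyl` at $\sigma=0$, with pair symmetry moving the contraction to the first index.
-/
lemma raisedMid_weyl (hσ : I slotY y = 0) (b c e : Fin d) :
    ∑ a, raisedMid G I a y * weyl G a b c e y = 0 := by
  have := hI.cotton_add_weyl h hy c e b
  rw [hσ, zero_mul, zero_add] at this
  rw [← neg_eq_zero, ← this, ← Finset.sum_neg_distrib]
  exact Finset.sum_congr rfl fun a _ => by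
    rw [h.weyl_pair hy, h.weyl_swap₃₄ hy]; ring

lemma mid_eq_zero_of_raisedMid (hμ : (fun a => raisedMid G I a y) = 0) (a : Fin d) :
    I (slotZ a) y = 0 := by
  have h1 : (G y)⁻¹.mulVec (fun b => I (slotZ b) y) = 0 := hμ
  have h2 : (fun b => I (slotZ b) y) = 0 := by
    rw [← Matrix.one_mulVec (fun b => I (slotZ b) y), ← h.mul_inv hy, ← Matrix.mulVec_mulVec, h1,
      Matrix.mulVec_zero]
  exact congrFun h2 a

include hne

lemma bot_ne_zero (hσ : I slotY y = 0) (hμ : ∀ a, I (slotZ a) y = 0) : I slotX y ≠ 0 := by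
  intro hρ
  obtain ⟨A, hA⟩ := hne y hy
  rcases A with ⟨⟩ | a | ⟨⟩
  exacts [hA hσ, hA (hμ a), hA hρ]

lemma raisedMid_bach (hd : 3 ≤ d) (b : Fin d) :
    ∑ a, raisedMid G I a y * bach G a b y = 0 :=
  hI.eq_zero_of_mul_top h hy hd hne
    (SmoothOn.sum fun a => (hI.smooth_raisedMid h a).mul (h.smooth_bach a b)).continuousOn
    fun _ hz => hI.raisedMid_bach_mul h hz hd b

end IsParallelOn

/-- If $n\ne0$ the algebra of four dimensions applies; if $n=0$ the 1-jet of $\sigma$ vanishes and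
the differentiated identity does. -/
lemma IsParallelOn.weyl_eq_zero_of_four_dim {U : Set (Coord 4)} {G : LocalMetric 4}
    {I : TIdx 4 → Coord 4 → ℝ} (hI : IsParallelOn U G I) (h : IsMetricOn U G)
    (hne : ∀ z ∈ U, ∃ A, I A z ≠ 0) {y : Coord 4} (hy : y ∈ U) (hσ : I slotY y = 0)
    (a b c e : Fin 4) : weyl G a b c e y = 0 := by
  by_cases hμ : (fun a => raisedMid G I a y) = 0
  · have hμ' := hI.mid_eq_zero_of_raisedMid h hy hμ
    exact hI.weyl_eq_zero h hy hσ hμ' (hI.bot_ne_zero h hne hy hσ hμ') a b c e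
  · exact AlmostEinstein.weyl_eq_zero_of_four_dim (C := fun a b c e => weyl G a b c e y)
      (h.posDef y hy) hμ (fun i j k l => weyl_swap₁₂ G i j k l y)
      (fun i j k l => h.weyl_pair hy i j k l)
      (fun j l => h.trace_weyl hy (by norm_num) j l) (fun j k l => hI.raisedMid_weyl h hy hσ j k l)
      a b c e

lemma IsParallelOn.bach_eq_zero_of_four_dim {U : Set (Coord 4)} {G : LocalMetric 4}
    {I : TIdx 4 → Coord 4 → ℝ} (hI : IsParallelOn U G I) (h : IsMetricOn U G)
    (hne : ∀ z ∈ U, ∃ A, I A z ≠ 0) {y : Coord 4} (hy : y ∈ U) (a b : Fin 4) :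
    bach G a b y = 0 := by
  refine hI.eq_zero_of_mul_top h hy (by norm_num) hne (h.smooth_bach a b).continuousOn
    fun z hz => ?_
  have := hI.bach_add_cotton h hz (by norm_num) a b
  norm_num at this
  simpa using this

end AlmostEinstein

end

theorem mainTheorem6 {d : ℕ} (hd : 3 ≤ d) {M : Type*} [TopologicalSpace M]
    [ChartedSpace (EuclideanSpace ℝ (Fin d)) M] [IsManifold (𝓡 d) ∞ M] [ConnectedSpace M]
    (conf : ConformalStructure d M) (I : TractorField conf)
    (hI₀ : I.IsNonzero) (hI : I.IsParallel) :
    ∀ g : conf.metrics, ∀ φ ∈ IsManifold.maximalAtlas (𝓡 d) ∞ M, ∀ p ∈ φ.source,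
      let G := coordMetric g.1 φ
      let σ := I.scale g p
      let n := fun a => I.nUp g φ a (φ p)
      (∀ a b c, σ * cotton G c a b (φ p) + ∑ e, n e * weyl G a b c e (φ p) = 0) ∧
      (∀ a b, ∑ c, n c * cotton G c a b (φ p) = 0) ∧
      (∀ a c, σ * bach G a c (φ p) + ((d : ℝ) - 4) * ∑ e, n e * cotton G c a e (φ p) = 0) ∧
      (∀ b, ∑ a, n a * bach G a b (φ p) = 0) ∧
      (σ = 0 → ∀ b c e, ∑ a, n a * weyl G a b c e (φ p) = 0) ∧
      (d = 4 → σ = 0 → ∀ a b c e, weyl G a b c e (φ p) = 0) ∧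
      (d = 4 → ∀ a b, bach G a b (φ p) = 0) ∧
      (d ≠ 4 → σ = 0 → ∀ b C E, ∑ a, n a * tractorCurv G a b C E (φ p) = 0) ∧
      (σ = 0 → (∀ a, I.nLow g φ a (φ p) = 0) →
        (∀ a b c e, weyl G a b c e (φ p) = 0) ∧
        (∀ b c e, cotton G b c e (φ p) = 0) ∧
        (∀ a b C E, tractorCurv G a b C E (φ p) = 0) ∧
        (∀ B C E F, tractorW G B C E F (φ p) = 0)) := by
  intro g φ hφ p hp G σ n
  have h : IsMetricOn φ.target G := isMetricOn_coordMetric g.1 hφ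
  have hP : IsParallelOn φ.target G (I.comp g φ) := hI.isParallelOn g hφ
  have hy : φ p ∈ φ.target := φ.map_source hp
  have hne : ∀ z ∈ φ.target, ∃ A, I.comp g φ A z ≠ 0 := fun z hz => by
    by_contra! hz0
    exact hI.triple_ne_zero hI₀ g _ ((I.triple_eq_zero_iff g hφ hz).2 hz0)
  have hσ : σ = I.comp g φ slotY (φ p) := by
    change I.scale g p = I.top g (φ.symm (φ p))
    rw [I.scale_eq_top, φ.left_inv hp]
  have hn : ∀ a, n a = raisedMid G (I.comp g φ) a (φ p) := hI.nUp_eq g hφ hy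
  simp only [hσ, hn, hI.nLow_eq g hφ hy]
  refine ⟨hP.cotton_add_weyl h hy, hP.raisedMid_cotton h hy, hP.bach_add_cotton h hy hd,
    hP.raisedMid_bach h hne hy hd, hP.raisedMid_weyl h hy, ?_, ?_, fun h4 hσ b C E => ?_,
    fun hσ hμ => ?_⟩
  · rintro rfl hσ
    exact hP.weyl_eq_zero_of_four_dim h hne hy hσ
  · rintro rfl
    exact hP.bach_eq_zero_of_four_dim h hne hy
  -- At $\sigma=0$ the Bach equation reads $(d-4)\,n^eA_{cae}=0$, so for $d\ne4$ the vector $n$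
  -- annihilates Cotton in a form index as well as Weyl.
  · refine h.sum_mul_tractorCurv_eq_zero hy b (fun c e => hP.raisedMid_weyl h hy hσ b c e)
      (fun c => ?_) C E
    have := hP.bach_add_cotton h hy hd b c
    rw [hσ, zero_mul, zero_add] at this
    have h4' : (d : ℝ) - 4 ≠ 0 := sub_ne_zero.2 (by exact_mod_cast h4)
    rw [← neg_eq_zero, ← (mul_eq_zero.1 this).resolve_left h4', ← Finset.sum_neg_distrib]
    exact Finset.sum_congr rfl fun a _ => by rw [cotton_swap]; ring
  · have hρ := hP.bot_ne_zero h hne hy hσ hμ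
    have hC := hP.weyl_eq_zero h hy hσ hμ hρ
    have hA := hP.cotton_eq_zero h hy hσ hμ hρ
    -- Bach vanishes here in every dimension: $n^aB_{ab}=0$ holds on the whole chart and can be
    -- differentiated at `p`.
    have hB : ∀ a b, bach G a b (φ p) = 0 := fun a b =>
      hP.eq_zero_of_raisedMid_mul h hy hσ hμ hρ (F := fun a => bach G a b)
        (fun a => h.smooth_bach a b) (fun z hz => hP.raisedMid_bach h hne hz hd b) a
    exact ⟨hC, hA, h.tractorCurv_eq_zero hy hC hA, h.tractorW_eq_zero hy hd hC hA hB⟩
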